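/- Let $G=(V,E)$ be a directed graph with $n\ge 1$ vertices, $e$ edges, strictly positive real edge weights $w$ and a source vertex $s$, given by adjacency lists. Algorithm $SP_1$ sets $D[x]:=\infty$, $fixed[x]:=\text{false}$ and $pred[x]:=$ the in-degree of $x$ for all vertices $x$, starts with empty FIFO queues $R,Q$ and an empty min-priority queue $H$, then sets $D[s]:=0$ and inserts $s$ into $H$ with key $D[s]$. While $H$ is not empty, it performs an iteration of the outer loop: it removes a vertex $j$ of minimum key from $H$ and, if $j$ is not fixed, 1. marks $j$ as fixed and inserts it into $R$; 2. while $R\neq\emptyset$, removes a vertex $z$ from $R$ and, for each edge $(z,k)\in E$ with $k$ not fixed at that moment, decreases $pred[k]$ by $1$ and replaces $D[k]$ by $D[z]+w(z,k)$ if this is smaller; then, if $pred[k]=0$, it marks $k$ as fixed and inserts it into $R$, and otherwise, if $D[k]$ was changed and $k\notin Q$, it inserts $k$ into $Q$; 3. removes every vertex $z$ from $Q$ and, if $z$ is not fixed, calls $H.\mathrm{insertOrAdjust}(z,D[z])$, which inserts $z$ with key $D[z]$ or, if $z$ is already in $H$, decreases its key to $D[z]$. Let $H$ be implemented as a Fibonacci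 heap, and measure time in steps of a unit-cost random access machine that can add and compare reals, including the time for the initialization. Then there is an absolute constant $C$ such that, for all $G,w,s$, $SP_1$ halts after at most $C\,(e+n\log n+1)$ steps. Moreover, if $G$ is acyclic and $s$ is its only vertex of in-degree zero, then it halts after at most $C\,(e+1)$ steps, performs exactly one iteration of the outer loop, and its only operations on $H$ besides tests for emptiness are the insertion of $s$ and one removal of the minimum; $\mathrm{insertOrAdjust}$ is never called. -/

import Mathlib

/-!
The algorithm `SP₁`, written out as a program for a unit-cost random access machine.  The machine
has integer registers, integer arrays and arrays of numbers in `ℝ ∪ {∞}`.  A single instruction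
touches a bounded number of cells, so that counting instructions counts time.  The priority queue
is a Fibonacci heap, implemented by pointers and run on the same machine, instruction by
instruction; no cost is postulated for its operations.
-/

namespace SP

/-! ### The machine -/

/-- Integer registers. -/
inductive Reg
  /-- input: the number of vertices, also used as the null pointer -/
  | n
  /-- input: the source vertex -/
  | src
  -- loop variables of the main program
  | i | j | fin | z | k | changed
  -- head and tail positions of the queues `R` and `Q`
  | rHead | rTail | qHead | qTail
  /-- argument of the heap insertions and result of `removeMin` -/
  | v
  -- the Fibonacci heap: its minimum node and the first node of its root list
  | hmin | roots
  -- local variables of the heap operations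
  | x | y | c | nx | pv | d | maxDeg | go
  deriving DecidableEq

/-- Integer arrays. -/
inductive Arr
  -- input, adjacency lists: the edges out of `u` sit at the positions `first u, …, last u - 1`,
  -- and `tgt p` is the head of the edge at position `p`
  | first | last | tgt
  -- the arrays `pred` and `fixed`, the queues `R` and `Q`, and the bit vector for membership in `Q`
  | pred | fixed | R | Q | inQ
  -- the Fibonacci heap: membership, links of the nodes (parent, first child, next and previous
  -- sibling), number of children, mark bit, and the table of roots by degree
  | inH | parent | child | nxt | prv | deg | mark | table
  deriving DecidableEq

/-- Arrays of numbers: edge weights (input), tentative distances, keys of the heap nodes. -/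
inductive NumArr
  | wt | D | key
  deriving DecidableEq

/-- The contents of the memory. -/
structure Mem where
  reg : Reg → ℕ
  cell : Arr → ℕ → ℕ
  num : NumArr → ℕ → WithTop ℝ

/-- Write `a` into register `r`. -/
def Mem.setReg (m : Mem) (r : Reg) (a : ℕ) : Mem :=
  { m with reg := Function.update m.reg r a }

/-- Write `b` into position `ix` of the integer array `a`. -/
def Mem.setCell (m : Mem) (a : Arr) (ix b : ℕ) : Mem :=
  { m with cell := Function.update m.cell a (Function.update (m.cell a) ix b) }

/-- Write `b` into position `ix` of the array `a` of numbers. -/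
def Mem.setNum (m : Mem) (a : NumArr) (ix : ℕ) (b : WithTop ℝ) : Mem :=
  { m with num := Function.update m.num a (Function.update (m.num a) ix b) }

/-- Integer operands: a literal, a register, an array cell addressed by a register. -/
inductive Word
  | lit (a : ℕ)
  | reg (r : Reg)
  | cell (a : Arr) (ix : Reg)

/-- The value of an integer operand. -/
def Word.eval (m : Mem) : Word → ℕ
  | .lit a => a
  | .reg r => m.reg r
  | .cell a ix => m.cell a (m.reg ix)

/-- Numerical operands: `0`, `∞`, a cell, the sum of two cells. -/
inductive Num
  | zero
  | infty
  | cell (a : NumArr) (ix : Reg)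
  | sum (a : NumArr) (ix : Reg) (b : NumArr) (jx : Reg)

/-- The value of a numerical operand. -/
noncomputable def Num.eval (m : Mem) : Num → WithTop ℝ
  | .zero => 0
  | .infty => ⊤
  | .cell a ix => m.num a (m.reg ix)
  | .sum a ix b jx => m.num a (m.reg ix) + m.num b (m.reg jx)

/-- Tests: comparisons of two operands. -/
inductive Test
  | eq (p q : Word)
  | ne (p q : Word)
  | lt (p q : Word)
  | le (p q : Word)
  | numLt (p q : Num)

/-- The truth of a test. -/
def Test.holds (m : Mem) : Test → Prop
  | .eq p q => p.eval m = q.eval m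
  | .ne p q => p.eval m ≠ q.eval m
  | .lt p q => p.eval m < q.eval m
  | .le p q => p.eval m ≤ q.eval m
  | .numLt p q => p.eval m < q.eval m

/-- Names of those parts of the program whose executions are recorded: an iteration of the outer
loop and the operations on the heap. -/
inductive Label
  | outerIteration
  | heapInsert
  | heapRemoveMin
  | heapInsertOrAdjust
  deriving DecidableEq

/-- Programs. -/
inductive Com
  | skip
  /-- register assignment -/
  | mov (r : Reg) (p : Word)
  /-- assignment to an integer array cell -/
  | put (a : Arr) (ix : Reg) (p : Word)
  /-- assignment to a numerical array cell -/
  | putNum (a : NumArr) (ix : Reg) (p : Num)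
  /-- add one to a register -/
  | inc (r : Reg)
  /-- add one to an array cell -/
  | incAt (a : Arr) (ix : Reg)
  /-- subtract one from an array cell -/
  | decAt (a : Arr) (ix : Reg)
  | seq (c₁ c₂ : Com)
  | cond (b : Test) (c₁ c₂ : Com)
  | loop (b : Test) (c : Com)
  /-- run `c` and record that this happened -/
  | call (l : Label) (c : Com)

/-- `Exec c m t l m'`: started in memory `m`, the program `c` halts after exactly `t` steps in
memory `m'`, and `l` is the list, in order of time, of the recorded calls.  Every assignment, every
evaluation of a test, every call and every `skip` is one step.  The machine is deterministic. -/
inductive Exec : Com → Mem → ℕ → List Label → Mem → Prop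
  | skip (m : Mem) : Exec .skip m 1 [] m
  | mov (m : Mem) (r : Reg) (p : Word) : Exec (.mov r p) m 1 [] (m.setReg r (p.eval m))
  | put (m : Mem) (a : Arr) (ix : Reg) (p : Word) :
      Exec (.put a ix p) m 1 [] (m.setCell a (m.reg ix) (p.eval m))
  | putNum (m : Mem) (a : NumArr) (ix : Reg) (p : Num) :
      Exec (.putNum a ix p) m 1 [] (m.setNum a (m.reg ix) (p.eval m))
  | inc (m : Mem) (r : Reg) : Exec (.inc r) m 1 [] (m.setReg r (m.reg r + 1))
  | incAt (m : Mem) (a : Arr) (ix : Reg) :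
      Exec (.incAt a ix) m 1 [] (m.setCell a (m.reg ix) (m.cell a (m.reg ix) + 1))
  | decAt (m : Mem) (a : Arr) (ix : Reg) :
      Exec (.decAt a ix) m 1 [] (m.setCell a (m.reg ix) (m.cell a (m.reg ix) - 1))
  | seq {c₁ c₂ : Com} {m m₁ m₂ : Mem} {t₁ t₂ : ℕ} {l₁ l₂ : List Label}
      (h₁ : Exec c₁ m t₁ l₁ m₁) (h₂ : Exec c₂ m₁ t₂ l₂ m₂) :
      Exec (.seq c₁ c₂) m (t₁ + t₂) (l₁ ++ l₂) m₂
  | condTrue {b : Test} {c₁ c₂ : Com} {m m₁ : Mem} {t : ℕ} {l : List Label}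
      (hb : b.holds m) (h : Exec c₁ m t l m₁) : Exec (.cond b c₁ c₂) m (1 + t) l m₁
  | condFalse {b : Test} {c₁ c₂ : Com} {m m₁ : Mem} {t : ℕ} {l : List Label}
      (hb : ¬ b.holds m) (h : Exec c₂ m t l m₁) : Exec (.cond b c₁ c₂) m (1 + t) l m₁
  | loopFalse {b : Test} {c : Com} {m : Mem} (hb : ¬ b.holds m) : Exec (.loop b c) m 1 [] m
  | loopTrue {b : Test} {c : Com} {m m₁ m₂ : Mem} {t₁ t₂ : ℕ} {l₁ l₂ : List Label}
      (hb : b.holds m) (h₁ : Exec c m t₁ l₁ m₁) (h₂ : Exec (.loop b c) m₁ t₂ l₂ m₂) :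
      Exec (.loop b c) m (1 + t₁ + t₂) (l₁ ++ l₂) m₂
  | call {k : Label} {c : Com} {m m₁ : Mem} {t : ℕ} {l : List Label}
      (h : Exec c m t l m₁) : Exec (.call k c) m (1 + t) (k :: l) m₁

infixr:60 ";;" => Com.seq

open Com

/-! ### Fibonacci heaps

A Fibonacci heap is a list of heap-ordered trees whose nodes are vertices.  The siblings below a
node form a doubly linked list that starts at the entry of `child`, the roots a list linked by
`nxt` that starts at `roots`; `hmin` is a root of minimum key.  The null pointer is `n`, which is
not a vertex. -/

/-- Put node `r` in front of the list of roots. -/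
def pushRoot (r : Reg) : Com :=
  put .parent r (.reg .n) ;;
  put .mark r (.lit 0) ;;
  put .nxt r (.reg .roots) ;;
  mov .roots (.reg r)

/-- Let `hmin` point to root `r` if the heap has no minimum yet or `r` has a smaller key. -/
def updateMin (r : Reg) : Com :=
  cond (.eq (.reg .hmin) (.reg .n))
    (mov .hmin (.reg r))
    (cond (.numLt (.cell .key r) (.cell .key .hmin)) (mov .hmin (.reg r)) skip)

/-- Insert vertex `v` with key `D[v]` as a new root. -/
def insertNode : Com :=
  put .inH .v (.lit 1) ;;
  putNum .key .v (.cell .D .v) ;;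
  put .child .v (.reg .n) ;;
  put .deg .v (.lit 0) ;;
  pushRoot .v ;;
  updateMin .v

/-- Make the root `y` a child of the root `x`. -/
def link : Com :=
  mov .c (.cell .child .x) ;;
  put .parent .y (.reg .x) ;;
  put .mark .y (.lit 0) ;;
  put .prv .y (.reg .n) ;;
  put .nxt .y (.reg .c) ;;
  cond (.ne (.reg .c) (.reg .n)) (put .prv .c (.reg .y)) skip ;;
  put .child .x (.reg .y) ;;
  incAt .deg .x

/-- Cut `x` off its parent `y` and make it a root. -/
def cut : Com :=
  mov .nx (.cell .nxt .x) ;;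
  mov .pv (.cell .prv .x) ;;
  cond (.eq (.reg .pv) (.reg .n))
    (put .child .y (.reg .nx))
    (put .nxt .pv (.reg .nx)) ;;
  cond (.ne (.reg .nx) (.reg .n)) (put .prv .nx (.reg .pv)) skip ;;
  decAt .deg .y ;;
  pushRoot .x

/-- Lower the key of the heap node `v` to `D[v]`, with cascading cuts: as soon as a node that is
not a root has lost a second child, it is cut as well. -/
def decreaseKey : Com :=
  putNum .key .v (.cell .D .v) ;;
  mov .x (.reg .v) ;;
  mov .y (.cell .parent .x) ;;
  mov .go (.lit 0) ;;
  cond (.ne (.reg .y) (.reg .n))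
    (cond (.numLt (.cell .key .x) (.cell .key .y)) (mov .go (.lit 1)) skip)
    skip ;;
  loop (.ne (.reg .go) (.lit 0))
    (cut ;;
     mov .x (.reg .y) ;;
     mov .y (.cell .parent .x) ;;
     cond (.eq (.reg .y) (.reg .n))
       (mov .go (.lit 0))
       (cond (.eq (.cell .mark .x) (.lit 0))
         (put .mark .x (.lit 1) ;; mov .go (.lit 0))
         skip)) ;;
  updateMin .v

/-- Turn the children of node `v` into roots. -/
def promoteChildren : Com :=
  mov .x (.cell .child .v) ;;
  loop (.ne (.reg .x) (.reg .n))
    (mov .nx (.cell .nxt .x) ;;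
     pushRoot .x ;;
     mov .x (.reg .nx))

/-- Enter the tree with root `x` into `table`, linking it with trees of equal degree until its
degree is new. -/
def enterTable : Com :=
  mov .d (.cell .deg .x) ;;
  loop (.ne (.cell .table .d) (.reg .n))
    (mov .y (.cell .table .d) ;;
     put .table .d (.reg .n) ;;
     cond (.numLt (.cell .key .y) (.cell .key .x))
       (mov .c (.reg .x) ;; mov .x (.reg .y) ;; mov .y (.reg .c))
       skip ;;
     link ;;
     inc .d) ;;
  put .table .d (.reg .x) ;;
  cond (.lt (.reg .maxDeg) (.reg .d)) (mov .maxDeg (.reg .d)) skip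

/-- Take all roots except `v` into `table`. -/
def consolidate : Com :=
  mov .maxDeg (.lit 0) ;;
  mov .x (.reg .roots) ;;
  loop (.ne (.reg .x) (.reg .n))
    (mov .nx (.cell .nxt .x) ;;
     cond (.ne (.reg .x) (.reg .v)) enterTable skip ;;
     mov .x (.reg .nx))

/-- Empty `table`, making its trees the new list of roots, and find the new minimum. -/
def rebuildRoots : Com :=
  mov .roots (.reg .n) ;;
  mov .hmin (.reg .n) ;;
  mov .d (.lit 0) ;;
  loop (.le (.reg .d) (.reg .maxDeg))
    (mov .x (.cell .table .d) ;;
     cond (.ne (.reg .x) (.reg .n))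
       (put .table .d (.reg .n) ;; pushRoot .x ;; updateMin .x)
       skip ;;
     inc .d)

/-- `v := H.removeMin()`. -/
def heapRemoveMin : Com :=
  call .heapRemoveMin
    (mov .v (.reg .hmin) ;;
     promoteChildren ;;
     consolidate ;;
     rebuildRoots ;;
     put .inH .v (.lit 0))

/-- `H.insert(v, D[v])`. -/
def heapInsert : Com :=
  call .heapInsert insertNode

/-- `H.insertOrAdjust(v, D[v])`. -/
def heapInsertOrAdjust : Com :=
  call .heapInsertOrAdjust (cond (.eq (.cell .inH .v) (.lit 0)) insertNode decreaseKey)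

/-! ### The algorithm -/

/-- `R.insert(r)`, at the tail. -/
def insertR (r : Reg) : Com := put .R .rTail (.reg r) ;; inc .rTail

/-- `Q.insert(r)`, at the tail. -/
def insertQ (r : Reg) : Com := put .Q .qTail (.reg r) ;; inc .qTail ;; put .inQ r (.lit 1)

/-- Initial values: `D[i] = ∞`, `fixed[i] = false`, `pred[i]` is the in-degree of `i`, and `R`, `Q`
and the heap are empty. -/
def setup : Com :=
  mov .i (.lit 0) ;;
  loop (.lt (.reg .i) (.reg .n))
    (putNum .D .i .infty ;;
     put .fixed .i (.lit 0) ;;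
     put .pred .i (.lit 0) ;;
     put .inQ .i (.lit 0) ;;
     put .inH .i (.lit 0) ;;
     put .table .i (.reg .n) ;;
     inc .i) ;;
  mov .i (.lit 0) ;;
  loop (.lt (.reg .i) (.reg .n))
    (mov .j (.cell .first .i) ;;
     mov .fin (.cell .last .i) ;;
     loop (.lt (.reg .j) (.reg .fin))
       (mov .k (.cell .tgt .j) ;;
        incAt .pred .k ;;
        inc .j) ;;
     inc .i) ;;
  mov .hmin (.reg .n) ;;
  mov .roots (.reg .n)

/-- `processEdge1(z, k)` for the edge `(z, k)` at position `j`. -/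
def processEdge : Com :=
  mov .changed (.lit 0) ;;
  decAt .pred .k ;;
  cond (.numLt (.sum .D .z .wt .j) (.cell .D .k))
    (putNum .D .k (.sum .D .z .wt .j) ;; mov .changed (.lit 1))
    skip ;;
  cond (.eq (.cell .pred .k) (.lit 0))
    (put .fixed .k (.lit 1) ;; insertR .k)
    (cond (.ne (.reg .changed) (.lit 0))
      (cond (.eq (.cell .inQ .k) (.lit 0)) (insertQ .k) skip)
      skip)

/-- The inner loop: explore the vertices in `R` until `R` is empty. -/
def exploreR : Com :=
  loop (.lt (.reg .rHead) (.reg .rTail))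
    (mov .z (.cell .R .rHead) ;;
     inc .rHead ;;
     mov .j (.cell .first .z) ;;
     mov .fin (.cell .last .z) ;;
     loop (.lt (.reg .j) (.reg .fin))
       (mov .k (.cell .tgt .j) ;;
        cond (.eq (.cell .fixed .k) (.lit 0)) processEdge skip ;;
        inc .j))

/-- Empty `Q`, handing its non-fixed vertices to the heap. -/
def flushQ : Com :=
  loop (.lt (.reg .qHead) (.reg .qTail))
    (mov .v (.cell .Q .qHead) ;;
     inc .qHead ;;
     put .inQ .v (.lit 0) ;;
     cond (.eq (.cell .fixed .v) (.lit 0)) heapInsertOrAdjust skip)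

/-- The body of the outer loop. -/
def outerIteration : Com :=
  call .outerIteration
    (heapRemoveMin ;;
     cond (.eq (.cell .fixed .v) (.lit 0))
       (mov .rHead (.lit 0) ;;
        mov .rTail (.lit 0) ;;
        mov .qHead (.lit 0) ;;
        mov .qTail (.lit 0) ;;
        insertR .v ;;
        put .fixed .v (.lit 1) ;;
        exploreR ;;
        flushQ)
       skip)

/-- The algorithm `SP₁` with a Fibonacci heap.  The heap is empty iff `hmin` is null. -/
def SP₁ : Com :=
  setup ;;
  putNum .D .src .zero ;;
  mov .v (.reg .src) ;;
  heapInsert ;;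
  loop (.ne (.reg .hmin) (.reg .n)) outerIteration

/-! ### The input -/

/-- The memory `m` holds, as input, the weighted digraph `(G, w)` and the source `s`: for every
vertex `u`, the positions `first u, …, last u - 1` of `tgt` list every out-neighbour of `u` exactly
once, in any order, and `wt` holds the weights of these edges.  All other contents of the memory
are arbitrary. -/
structure IsInput {n : ℕ} (G : Digraph (Fin n)) (w : Fin n → Fin n → ℝ) (s : Fin n) (m : Mem) :
    Prop where
  size : m.reg .n = n
  source : m.reg .src = s
  neighbours : ∀ u : Fin n, Set.BijOn (m.cell .tgt)
    (Set.Ico (m.cell .first u) (m.cell .last u)) {k | ∃ v : Fin n, G.Adj u v ∧ k = v}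
  weight : ∀ u v : Fin n, ∀ p ∈ Set.Ico (m.cell .first u) (m.cell .last u),
    m.cell .tgt p = v → m.num .wt p = (w u v : WithTop ℝ)

/-- The number of edges. -/
noncomputable def numEdges {n : ℕ} (G : Digraph (Fin n)) : ℕ :=
  {p : Fin n × Fin n | G.Adj p.1 p.2}.ncard

/-- The in-degree of a vertex. -/
noncomputable def inDegree {n : ℕ} (G : Digraph (Fin n)) (v : Fin n) : ℕ :=
  {u : Fin n | G.Adj u v}.ncard

/-- There is no directed cycle. -/
def IsAcyclic {n : ℕ} (G : Digraph (Fin n)) : Prop :=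
  ∀ v : Fin n, ¬ Relation.TransGen G.Adj v v

end SP

namespace SP

open Com Function

/-! ### Reading the memory -/

/-! Only the running time and the trace of calls are at stake, so nothing is proved about shortest
paths. The sole fact kept about distances is that `D` never increases after the initialization,
whence `D v ≤ key v` on the heap and an adjustment never raises a key.

Heap. The memory is abstracted to a heap-ordered `Forest` in which a node with `i` older siblings
has at least `i - 1` children. Hence a node with `d` children has at least `fib (d + 2)` descendants
(`Forest.fib_le_card_descendants`), and degrees are logarithmic (`Forest.deg_le`). With the
potential "roots plus twice the marked nodes", insertion and key decrease cost O(1) amortized,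
because every cut of a cascade after the first one removes a mark (`Heap.runs_insertNode`,
`Heap.runs_decreaseKey`). Removing the minimum costs O(log n), because every link removes a root and
at most one root per degree survives (`Heap.runs_removeMin`).

Graph. A vertex is explored at most once in the whole run, so all explorations together take O(n +
e) steps and make O(n + e) entries in `Q` (`Exploring.runs_exploreR`). Every outer iteration takes a
vertex out of the heap for good, since that vertex is then fixed and only non-fixed vertices are
inserted; so there are at most n iterations (`alive_lt`, `Outer.halts_loop`). The sum is O(e + n log
n).

Acyclic case. For a non-fixed `k`, `pred k` counts the edges into `k` that are not yet examined. If
`s` is the only source, then after the first exploration every non-fixed vertex has a nonzero count,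
hence a non-fixed predecessor. A finite acyclic graph has no nonempty set with this property, so all
vertices are fixed, `flushQ` calls nothing, and the heap, having lost `s`, is empty
(`Outer.halts_loop_once`). Every vertex but `s` has an incoming edge, so n ≤ e + 1, and the
initialization and the one logarithmic removal fit into O(e + 1). -/

@[simp] theorem Mem.setReg_reg (m : Mem) (r r' : Reg) (a : ℕ) :
    (m.setReg r a).reg r' = if r' = r then a else m.reg r' := by
  simp [Mem.setReg, Function.update_apply]

@[simp] theorem Mem.setReg_cell (m : Mem) (r : Reg) (a : ℕ) : (m.setReg r a).cell = m.cell := rfl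

@[simp] theorem Mem.setReg_num (m : Mem) (r : Reg) (a : ℕ) : (m.setReg r a).num = m.num := rfl

@[simp] theorem Mem.setCell_reg (m : Mem) (a : Arr) (i b : ℕ) : (m.setCell a i b).reg = m.reg := rfl

@[simp] theorem Mem.setCell_cell (m : Mem) (a a' : Arr) (i b : ℕ) :
    (m.setCell a i b).cell a' = if a' = a then update (m.cell a) i b else m.cell a' := by
  simp only [Mem.setCell, Function.update_apply]

@[simp] theorem Mem.setCell_num (m : Mem) (a : Arr) (i b : ℕ) : (m.setCell a i b).num = m.num := rfl

@[simp] theorem Mem.setNum_reg (m : Mem) (a : NumArr) (i : ℕ) (b : WithTop ℝ) :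
    (m.setNum a i b).reg = m.reg := rfl

@[simp] theorem Mem.setNum_cell (m : Mem) (a : NumArr) (i : ℕ) (b : WithTop ℝ) :
    (m.setNum a i b).cell = m.cell := rfl

@[simp] theorem Mem.setNum_num (m : Mem) (a a' : NumArr) (i : ℕ) (b : WithTop ℝ) :
    (m.setNum a i b).num a' = if a' = a then update (m.num a) i b else m.num a' := by
  simp only [Mem.setNum, Function.update_apply]

attribute [simp] Word.eval Num.eval Test.holds

/-! ### Frame conditions -/

/-- Does the program contain an assignment to register `r`? -/
def Com.setsReg (r : Reg) : Com → Bool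
  | .mov r' _ => r = r'
  | .inc r' => r = r'
  | .seq c₁ c₂ => c₁.setsReg r || c₂.setsReg r
  | .cond _ c₁ c₂ => c₁.setsReg r || c₂.setsReg r
  | .loop _ c => c.setsReg r
  | .call _ c => c.setsReg r
  | _ => false

/-- Does the program contain an assignment to the integer array `a`? -/
def Com.setsArr (a : Arr) : Com → Bool
  | .put a' _ _ => a = a'
  | .incAt a' _ => a = a'
  | .decAt a' _ => a = a'
  | .seq c₁ c₂ => c₁.setsArr a || c₂.setsArr a
  | .cond _ c₁ c₂ => c₁.setsArr a || c₂.setsArr a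
  | .loop _ c => c.setsArr a
  | .call _ c => c.setsArr a
  | _ => false

/-- Does the program contain an assignment to the array `a` of numbers? -/
def Com.setsNum (a : NumArr) : Com → Bool
  | .putNum a' _ _ => a = a'
  | .seq c₁ c₂ => c₁.setsNum a || c₂.setsNum a
  | .cond _ c₁ c₂ => c₁.setsNum a || c₂.setsNum a
  | .loop _ c => c.setsNum a
  | .call _ c => c.setsNum a
  | _ => false

/-- `setsReg` is computed from the syntax, so for a concrete program and register the side condition
is closed by `rfl`. -/
theorem Exec.reg_eq {c : Com} {m m' : Mem} {t : ℕ} {l : List Label} (h : Exec c m t l m') {r : Reg}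
    (hr : c.setsReg r = false) : m'.reg r = m.reg r := by
  induction h <;> simp_all [Com.setsReg]

theorem Exec.cell_eq {c : Com} {m m' : Mem} {t : ℕ} {l : List Label} (h : Exec c m t l m') {a : Arr}
    (ha : c.setsArr a = false) : m'.cell a = m.cell a := by
  induction h <;> simp_all [Com.setsArr]

theorem Exec.num_eq {c : Com} {m m' : Mem} {t : ℕ} {l : List Label} (h : Exec c m t l m')
    {a : NumArr} (ha : c.setsNum a = false) : m'.num a = m.num a := by
  induction h <;> simp_all [Com.setsNum]

/-! ### Total correctness with running time -/

/-- Started in `m`, the program halts without recorded calls, after `t` steps and in a memory `m'`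
such that `Q t m'`. -/
def Runs (c : Com) (m : Mem) (Q : ℕ → Mem → Prop) : Prop :=
  ∃ t m', Exec c m t [] m' ∧ Q t m'

theorem Runs.mono {c : Com} {m : Mem} {P Q : ℕ → Mem → Prop} (h : Runs c m P)
    (hPQ : ∀ t m', Exec c m t [] m' → P t m' → Q t m') : Runs c m Q := by
  obtain ⟨t, m', he, hp⟩ := h
  exact ⟨t, m', he, hPQ t m' he hp⟩

/-- The equivalences for loop-free programs are rewriting rules: with them `simp` executes the
program symbolically and applies the postcondition to the resulting memory and step count. -/
theorem runs_skip {m : Mem} {Q : ℕ → Mem → Prop} : Runs skip m Q ↔ Q 1 m :=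
  ⟨by rintro ⟨t, m', he, h⟩; cases he; exact h, fun h => ⟨_, _, .skip m, h⟩⟩

theorem runs_mov {r : Reg} {p : Word} {m : Mem} {Q : ℕ → Mem → Prop} :
    Runs (mov r p) m Q ↔ Q 1 (m.setReg r (p.eval m)) :=
  ⟨by rintro ⟨t, m', he, h⟩; cases he; exact h, fun h => ⟨_, _, .mov m r p, h⟩⟩

theorem runs_put {a : Arr} {ix : Reg} {p : Word} {m : Mem} {Q : ℕ → Mem → Prop} :
    Runs (put a ix p) m Q ↔ Q 1 (m.setCell a (m.reg ix) (p.eval m)) :=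
  ⟨by rintro ⟨t, m', he, h⟩; cases he; exact h, fun h => ⟨_, _, .put m a ix p, h⟩⟩

theorem runs_putNum {a : NumArr} {ix : Reg} {p : Num} {m : Mem} {Q : ℕ → Mem → Prop} :
    Runs (putNum a ix p) m Q ↔ Q 1 (m.setNum a (m.reg ix) (p.eval m)) :=
  ⟨by rintro ⟨t, m', he, h⟩; cases he; exact h, fun h => ⟨_, _, .putNum m a ix p, h⟩⟩

theorem runs_inc {r : Reg} {m : Mem} {Q : ℕ → Mem → Prop} :
    Runs (inc r) m Q ↔ Q 1 (m.setReg r (m.reg r + 1)) :=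
  ⟨by rintro ⟨t, m', he, h⟩; cases he; exact h, fun h => ⟨_, _, .inc m r, h⟩⟩

theorem runs_incAt {a : Arr} {ix : Reg} {m : Mem} {Q : ℕ → Mem → Prop} :
    Runs (incAt a ix) m Q ↔ Q 1 (m.setCell a (m.reg ix) (m.cell a (m.reg ix) + 1)) :=
  ⟨by rintro ⟨t, m', he, h⟩; cases he; exact h, fun h => ⟨_, _, .incAt m a ix, h⟩⟩

theorem runs_decAt {a : Arr} {ix : Reg} {m : Mem} {Q : ℕ → Mem → Prop} :
    Runs (decAt a ix) m Q ↔ Q 1 (m.setCell a (m.reg ix) (m.cell a (m.reg ix) - 1)) :=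
  ⟨by rintro ⟨t, m', he, h⟩; cases he; exact h, fun h => ⟨_, _, .decAt m a ix, h⟩⟩

theorem runs_seq {c₁ c₂ : Com} {m : Mem} {Q : ℕ → Mem → Prop} :
    Runs (c₁ ;; c₂) m Q ↔
      Runs c₁ m fun t₁ m₁ => Runs c₂ m₁ fun t₂ m₂ => Q (t₁ + t₂) m₂ := by
  constructor
  · rintro ⟨t, m', he, h⟩
    generalize hl : ([] : List Label) = l at he
    cases he with
    | seq h₁ h₂ =>
      obtain ⟨rfl, rfl⟩ := List.append_eq_nil_iff.1 hl.symm
      exact ⟨_, _, h₁, _, _, h₂, h⟩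
  · rintro ⟨t₁, m₁, h₁, t₂, m₂, h₂, h⟩
    exact ⟨_, _, .seq h₁ h₂, h⟩

open scoped Classical in
theorem runs_cond {b : Test} {c₁ c₂ : Com} {m : Mem} {Q : ℕ → Mem → Prop} :
    Runs (cond b c₁ c₂) m Q ↔
      if b.holds m then Runs c₁ m fun t m' => Q (1 + t) m'
      else Runs c₂ m fun t m' => Q (1 + t) m' := by
  constructor
  · rintro ⟨t, m', he, h⟩
    cases he with
    | condTrue hb h' => rw [if_pos hb]; exact ⟨_, _, h', h⟩
    | condFalse hb h' => rw [if_neg hb]; exact ⟨_, _, h', h⟩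
  · split_ifs with hb
    · rintro ⟨t, m', he, h⟩; exact ⟨_, _, .condTrue hb he, h⟩
    · rintro ⟨t, m', he, h⟩; exact ⟨_, _, .condFalse hb he, h⟩

/-- Loops get no rewriting rule, which would unroll without end; each loop is handled by an
induction of its own. -/
theorem runs_loop_of_not {b : Test} {c : Com} {m : Mem} {Q : ℕ → Mem → Prop} (hb : ¬ b.holds m)
    (h : Q 1 m) : Runs (loop b c) m Q :=
  ⟨_, _, .loopFalse hb, h⟩

theorem runs_loop_of {b : Test} {c : Com} {m : Mem} {Q : ℕ → Mem → Prop} (hb : b.holds m)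
    (h : Runs c m fun t₁ m₁ => Runs (loop b c) m₁ fun t₂ m₂ => Q (1 + t₁ + t₂) m₂) :
    Runs (loop b c) m Q := by
  obtain ⟨t₁, m₁, h₁, t₂, m₂, h₂, h⟩ := h
  exact ⟨_, _, .loopTrue hb h₁ h₂, h⟩

/-! ### Linked lists -/

/-- The pointers `nxt`, followed from `a` to the null pointer `n`, visit the list. -/
def Chain (n : ℕ) (nxt : ℕ → ℕ) : ℕ → List ℕ → Prop
  | a, [] => a = n
  | a, b :: L => a = b ∧ Chain n nxt (nxt b) L

/-- A doubly linked list that starts at `a`; the backward pointer of its first node is `p`. -/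
def DChain (n : ℕ) (nxt prv : ℕ → ℕ) : ℕ → ℕ → List ℕ → Prop
  | _, a, [] => a = n
  | p, a, b :: L => a = b ∧ prv b = p ∧ DChain n nxt prv b (nxt b) L

theorem DChain.chain {n : ℕ} {nxt prv : ℕ → ℕ} {p a : ℕ} {L : List ℕ}
    (h : DChain n nxt prv p a L) : Chain n nxt a L := by
  induction L generalizing p a with
  | nil => exact h
  | cons b L ih => exact ⟨h.1, ih h.2.2⟩

theorem Chain.congr {n : ℕ} {nxt nxt' : ℕ → ℕ} {a : ℕ} {L : List ℕ} (h : Chain n nxt a L)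
    (h' : ∀ b ∈ L, nxt' b = nxt b) : Chain n nxt' a L := by
  induction L generalizing a with
  | nil => exact h
  | cons b L ih =>
    refine ⟨h.1, ?_⟩
    rw [h' b (by simp)]
    exact ih h.2 fun c hc => h' c (by simp [hc])

theorem DChain.congr {n : ℕ} {nxt nxt' prv prv' : ℕ → ℕ} {p a : ℕ} {L : List ℕ}
    (h : DChain n nxt prv p a L) (h' : ∀ b ∈ L, nxt' b = nxt b) (h'' : ∀ b ∈ L, prv' b = prv b) :
    DChain n nxt' prv' p a L := by
  induction L generalizing p a with
  | nil => exact h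
  | cons b L ih =>
    refine ⟨h.1, (h'' b (by simp)).trans h.2.1, ?_⟩
    rw [h' b (by simp)]
    exact ih h.2.2 (fun c hc => h' c (by simp [hc])) fun c hc => h'' c (by simp [hc])

/-- Deleting a node from a doubly linked list. -/
theorem DChain.remove {n : ℕ} {nxt prv : ℕ → ℕ} {p a x : ℕ} {L₁ L₂ : List ℕ}
    (h : DChain n nxt prv p a (L₁ ++ x :: L₂)) (hd : (L₁ ++ x :: L₂).Nodup)
    (hn : n ∉ L₁ ++ x :: L₂) :
    DChain n (if L₁ = [] then nxt else update nxt (prv x) (nxt x))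
      (if nxt x ≠ n then update prv (nxt x) (prv x) else prv) p
      (if L₁ = [] then nxt x else a) (L₁ ++ L₂) ∧
    prv x = L₁.getLastD p ∧ (nxt x = n ∨ nxt x ∈ L₂) := by
  induction L₁ generalizing p a with
  | nil =>
    obtain ⟨rfl, h1, h2⟩ := h
    cases L₂ with
    | nil =>
      have : nxt a = n := h2
      simp [DChain, this, h1]
    | cons b L =>
      obtain ⟨h3, h4, h5⟩ := h2
      have hb : b ≠ n := by grind
      simp only [if_true, List.nil_append, DChain, h3, ne_eq, hb, not_false_eq_true, update_self, h1,
        List.getLastD_nil, List.mem_cons, true_or, or_true, and_self, and_true, true_and]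
      refine h5.congr (fun _ _ => rfl) fun c hc => ?_
      rw [update_of_ne]
      grind
  | cons b L ih =>
    obtain ⟨rfl, h1, h2⟩ := h
    obtain ⟨h3, h4, h5⟩ := ih h2 (by grind) (by grind)
    have hbn : a ≠ nxt x := by grind
    refine ⟨?_, ?_, h5⟩
    · simp only [reduceCtorEq, if_false, List.cons_append, DChain, true_and]
      constructor
      · split_ifs <;> simp [hbn, h1]
      -- If `x` directly follows `a`, the pointer out of `a` is the one redirected; otherwise the
      -- change happens further on and is already part of the induction hypothesis.
      · by_cases hL : L = []
        · subst hL
          simp only [List.getLastD_nil] at h4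
          simp only [if_true, List.nil_append] at h3
          simp only [h4, List.nil_append, update_self]
          rw [h4] at h3
          refine h3.congr (fun c hc => ?_) fun _ _ => rfl
          rw [update_of_ne]
          grind
        · simp only [hL, if_false] at h3
          have : prv x ∈ L := by
            rw [h4, List.getLastD_eq_getLast?, List.getLast?_eq_some_getLast hL]
            simp
          rw [update_of_ne (a := a) (by grind)]
          exact h3
    · rw [h4]; cases L <;> rfl

/-! ### Heap-ordered forests -/

/-- The arrays that make up the nodes of a Fibonacci heap. -/
structure Links where
  par : ℕ → ℕ
  chd : ℕ → ℕ
  nxt : ℕ → ℕ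
  prv : ℕ → ℕ
  deg : ℕ → ℕ
  mrk : ℕ → ℕ
  key : ℕ → WithTop ℝ

/-- The heap nodes in the memory. -/
def Mem.links (m : Mem) : Links :=
  ⟨m.cell .parent, m.cell .child, m.cell .nxt, m.cell .prv, m.cell .deg, m.cell .mark, m.num .key⟩

/-- On the nodes `S`, the arrays form a heap-ordered forest in which `ch x` lists the children of
`x`, latest first.  The roots are the nodes whose parent is not in `S`.  A node with `i` older
siblings has degree at least `i`, or `i - 1` if it is marked.  The node `e` may have one child less
than that, and the node `o` may have a smaller key than its parent. -/
structure Forest (n : ℕ) (S : Finset ℕ) (H : Links) (ch : ℕ → List ℕ) (e o : ℕ) : Prop where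
  lt : ∀ x ∈ S, x < n
  nodup : ∀ x ∈ S, (ch x).Nodup
  list : ∀ x ∈ S, DChain n H.nxt H.prv n (H.chd x) (ch x)
  mem : ∀ x ∈ S, ∀ c, c ∈ ch x ↔ c ∈ S ∧ H.par c = x
  deg : ∀ x ∈ S, H.deg x = (ch x).length
  mark : ∀ x ∈ S, H.mrk x ≤ 1
  young : ∀ x ∈ S, ∀ c L, c :: L <:+ ch x →
    L.length ≤ H.deg c + H.mrk c + if c = e then 1 else 0
  order : ∀ c ∈ S, H.par c ∈ S → c ≠ o → H.key (H.par c) ≤ H.key c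
  rank : ∃ h : ℕ → ℕ, ∀ c ∈ S, H.par c ∈ S → h c < h (H.par c)

namespace Forest

variable {n : ℕ} {S : Finset ℕ} {H : Links} {ch : ℕ → List ℕ} {e o : ℕ}

theorem not_mem (F : Forest n S H ch e o) : n ∉ S := fun h => (F.lt n h).false

theorem par_ne (F : Forest n S H ch e o) {x : ℕ} (hx : x ∈ S) : H.par x ≠ x := by
  obtain ⟨h, hh⟩ := F.rank
  intro hp
  have := hh x hx (by rwa [hp])
  rw [hp] at this
  exact this.false

/-- Add an isolated node. -/
theorem insert (F : Forest n S H ch n n) {v a : ℕ} {k : WithTop ℝ} (hv : v ∉ S) (hvn : v < n)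
    (hcl : ∀ c ∈ S, H.par c ≠ v) :
    Forest n (insert v S)
      { H with
        par := update H.par v n, chd := update H.chd v n, nxt := update H.nxt v a,
        deg := update H.deg v 0, mrk := update H.mrk v 0, key := update H.key v k }
      (update ch v []) n n := by
  have hne : ∀ x ∈ S, x ≠ v := fun x hx h => hv (h ▸ hx)
  refine ⟨?_, ?_, ?_, ?_, ?_, ?_, ?_, ?_, ?_⟩
  · intro x hx
    rcases Finset.mem_insert.1 hx with rfl | hx
    · exact hvn
    · exact F.lt x hx
  · intro x hx
    rcases eq_or_ne x v with rfl | hxv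
    · simp
    · rw [update_of_ne hxv]; exact F.nodup x (by grind)
  · intro x hx
    rcases eq_or_ne x v with rfl | hxv
    · simp [DChain]
    · have hxS : x ∈ S := by grind
      simp only [update_of_ne hxv]
      refine (F.list x hxS).congr (fun c hc => ?_) fun _ _ => rfl
      rw [update_of_ne (hne c ((F.mem x hxS c).1 hc).1)]
  · intro x hx c
    rcases eq_or_ne x v with rfl | hxv
    · simp only [update_self, List.not_mem_nil, false_iff]
      rintro ⟨hc, hp⟩
      rcases eq_or_ne c x with rfl | hcx
      · simp at hp; omega
      · rw [update_of_ne hcx] at hp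
        exact hcl c (by grind) (by rw [hp])
    · have hxS : x ∈ S := by grind
      rw [update_of_ne hxv, F.mem x hxS c]
      rcases eq_or_ne c v with rfl | hcv
      · simp only [update_self, hv, false_and, Finset.mem_insert, true_or, true_and, false_iff]
        have := F.lt x hxS
        omega
      · simp [hcv]
  · intro x hx
    rcases eq_or_ne x v with rfl | hxv
    · simp
    · simp only [update_of_ne hxv]; exact F.deg x (by grind)
  · intro x hx
    rcases eq_or_ne x v with rfl | hxv
    · simp
    · simp only [update_of_ne hxv]; exact F.mark x (by grind)
  · intro x hx c L hL
    rcases eq_or_ne x v with rfl | hxv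
    · simp at hL
    · have hxS : x ∈ S := by grind
      rw [update_of_ne hxv] at hL
      have hcv := hne c ((F.mem x hxS c).1 (hL.subset (by simp))).1
      simp only [update_of_ne hcv]
      exact F.young x hxS c L hL
  · intro c hc hp hcn
    rcases eq_or_ne c v with rfl | hcv
    · simp only [update_self, Finset.mem_insert] at hp
      rcases hp with hp | hp
      · omega
      · exact absurd hp F.not_mem
    · simp only [update_of_ne hcv] at hp ⊢
      have hcS : c ∈ S := by grind
      have hpv := hcl c hcS
      rw [update_of_ne hpv]
      exact F.order c hcS (by grind) hcn
  · obtain ⟨h, hh⟩ := F.rank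
    refine ⟨h, fun c hc hp => ?_⟩
    rcases eq_or_ne c v with rfl | hcv
    · simp only [update_self, Finset.mem_insert] at hp
      rcases hp with hp | hp
      · omega
      · exact absurd hp F.not_mem
    · simp only [update_of_ne hcv] at hp ⊢
      have hcS : c ∈ S := by grind
      have hpv := hcl c hcS
      exact hh c hcS (by grind)

/-- Remove a root. -/
theorem erase (F : Forest n S H ch n n) {v : ℕ} (hr : H.par v ∉ S) :
    Forest n (S.erase v) H ch n n := by
  -- The arrays stay as they are: the children of `v` become roots because their parent has left the
  -- node set.
  refine ⟨?_, ?_, ?_, ?_, ?_, ?_, ?_, ?_, ?_⟩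
  · exact fun x hx => F.lt x (Finset.mem_of_mem_erase hx)
  · exact fun x hx => F.nodup x (Finset.mem_of_mem_erase hx)
  · exact fun x hx => F.list x (Finset.mem_of_mem_erase hx)
  · intro x hx c
    rw [F.mem x (Finset.mem_of_mem_erase hx)]
    grind
  · exact fun x hx => F.deg x (Finset.mem_of_mem_erase hx)
  · exact fun x hx => F.mark x (Finset.mem_of_mem_erase hx)
  · exact fun x hx => F.young x (Finset.mem_of_mem_erase hx)
  · exact fun c hc hp => F.order c (Finset.mem_of_mem_erase hc) (Finset.mem_of_mem_erase hp)
  · obtain ⟨h, hh⟩ := F.rank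
    exact ⟨h, fun c hc hp => hh c (Finset.mem_of_mem_erase hc) (Finset.mem_of_mem_erase hp)⟩

/-- Normalize a root. -/
theorem pushRoot (F : Forest n S H ch n n) {x a : ℕ} (hx : x ∈ S) (hr : H.par x ∉ S) :
    Forest n S
      { H with par := update H.par x n, nxt := update H.nxt x a, mrk := update H.mrk x 0 }
      ch n n := by
  have hnS := F.not_mem
  have hne : ∀ z ∈ S, ∀ c ∈ ch z, c ≠ x := by
    rintro z hz c hc rfl
    exact hr (((F.mem z hz c).1 hc).2 ▸ hz)
  have hpar : ∀ c, update H.par x n c ∈ S → c ≠ x := by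
    rintro c hc rfl
    simp [hnS] at hc
  refine ⟨F.lt, F.nodup, ?_, ?_, F.deg, ?_, ?_, ?_, ?_⟩
  · intro z hz
    refine (F.list z hz).congr (fun c hc => ?_) fun _ _ => rfl
    exact update_of_ne (hne z hz c hc) _ _
  · intro z hz c
    rw [F.mem z hz]
    rcases eq_or_ne c x with rfl | hcx
    · simp only [update_self]
      grind
    · simp [hcx]
  · intro z hz
    rcases eq_or_ne z x with rfl | hzx
    · simp
    · simpa [hzx] using F.mark z hz
  · intro z hz c L hL
    have hcx := hne z hz c (hL.subset (by simp))
    simpa [hcx] using F.young z hz c L hL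
  · intro c hc hp hcn
    have hcx := hpar c hp
    simp only [update_of_ne hcx] at hp ⊢
    exact F.order c hc hp hcn
  · obtain ⟨h, hh⟩ := F.rank
    refine ⟨h, fun c hc hp => ?_⟩
    have hcx := hpar c hp
    simp only [update_of_ne hcx] at hp ⊢
    exact hh c hc hp

/-- Make the root `y` the latest child of the root `x`. -/
theorem link (F : Forest n S H ch n n) {x y : ℕ} (hx : x ∈ S) (hy : y ∈ S) (hxy : x ≠ y)
    (hrx : H.par x ∉ S) (hry : H.par y ∉ S) (hk : H.key x ≤ H.key y) (hd : H.deg x = H.deg y) :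
    Forest n S
      { H with
        par := update H.par y x, chd := update H.chd x y, nxt := update H.nxt y (H.chd x),
        prv := if H.chd x ≠ n then update (update H.prv y n) (H.chd x) y else update H.prv y n,
        deg := update H.deg x (H.deg x + 1), mrk := update H.mrk y 0 }
      (update ch x (y :: ch x)) n n := by
  have hnS := F.not_mem
  have hne : ∀ z ∈ S, ∀ c ∈ ch z, c ≠ y := by
    rintro z hz c hc rfl
    exact hry (((F.mem z hz c).1 hc).2 ▸ hz)
  have hhead : H.chd x = n ∨ H.chd x ∈ ch x := by
    have h := F.list x hx
    cases hL : ch x with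
    | nil => rw [hL] at h; exact .inl h
    | cons b L => rw [hL] at h; exact .inr (by simp [h.1])
  -- The first child of `x` lies in no other list of children, so writing its `prv` damages none of
  -- them.
  have hdisj : ∀ z ∈ S, z ≠ x → H.chd x ∉ ch z := by
    intro z hz hzx hc
    rcases hhead with h | h
    · exact hnS (h ▸ ((F.mem z hz _).1 hc).1)
    · exact hzx (((F.mem z hz _).1 hc).2.symm.trans ((F.mem x hx _).1 h).2)
  refine ⟨F.lt, ?_, ?_, ?_, ?_, ?_, ?_, ?_, ?_⟩
  · intro z hz
    rcases eq_or_ne z x with rfl | hzx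
    · rw [update_self, List.nodup_cons]
      exact ⟨fun h => hne z hz y h rfl, F.nodup z hz⟩
    · rw [update_of_ne hzx]; exact F.nodup z hz
  · intro z hz
    rcases eq_or_ne z x with rfl | hzx
    · simp only [update_self, DChain, true_and]
      have hl := F.list z hz
      have hnd := F.nodup z hz
      have hy' := hne z hz
      have hcn : ∀ c ∈ ch z, c ≠ n := fun c hc h => hnS (h ▸ ((F.mem z hz c).1 hc).1)
      generalize ch z = L at hl hnd hy' hcn
      cases L with
      | nil =>
        have : H.chd z = n := hl
        simp [this, DChain]
      | cons b L =>
        obtain ⟨hb, -, hl⟩ := hl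
        have hbn : b ≠ n := hcn b (by simp)
        have hby := hy' b (by simp)
        simp only [hb, ne_eq, hbn, not_false_eq_true, if_true, update_of_ne hby.symm, update_self,
          DChain, true_and, update_of_ne hby]
        refine hl.congr (fun c hc => ?_) fun c hc => ?_
        · rw [update_of_ne (hy' c (by simp [hc]))]
        · rw [update_of_ne (by grind), update_of_ne (hy' c (by simp [hc]))]
    · simp only [update_of_ne hzx]
      refine (F.list z hz).congr (fun c hc => ?_) fun c hc => ?_
      · rw [update_of_ne (hne z hz c hc)]
      · have h1 : c ≠ H.chd x := fun h => hdisj z hz hzx (h ▸ hc)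
        split_ifs
        · rw [update_of_ne h1, update_of_ne (hne z hz c hc)]
        · rw [update_of_ne (hne z hz c hc)]
  · intro z hz c
    have := F.mem z hz c
    simp only [update_apply]
    split_ifs <;> grind
  · intro z hz
    have := F.deg z hz
    simp only [update_apply]
    split_ifs with h
    · subst h; simp [this]
    · exact this
  · intro z hz
    have := F.mark z hz
    simp only [update_apply]
    split_ifs <;> omega
  · have key : ∀ z ∈ S, ∀ c L, c :: L <:+ ch z →
        L.length ≤ update H.deg x (H.deg x + 1) c + update H.mrk y 0 c +
          if c = n then 1 else 0 := by
      intro z hz c L hL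
      have h1 := F.young z hz c L hL
      have h2 := hne z hz c (hL.subset (by simp))
      simp only [update_apply, h2, if_false]
      split_ifs at h1 ⊢ <;> grind
    intro z hz c L hL
    rcases eq_or_ne z x with rfl | hzx
    -- The new child `y` has all former children of `x` as older siblings; equality of the degrees
    -- is exactly what `young` demands of it.
    · rw [update_self, List.suffix_cons_iff] at hL
      rcases hL with hL | hL
      · obtain ⟨rfl, rfl⟩ := List.cons.inj hL
        simp only [update_of_ne hxy.symm, ← hd, F.deg z hz]
        omega
      · exact key z hz c L hL
    · rw [update_of_ne hzx] at hL
      exact key z hz c L hL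
  · intro c hc hp hcn
    rcases eq_or_ne c y with rfl | hcy
    · simpa using hk
    · simp only [update_of_ne hcy] at hp ⊢
      exact F.order c hc hp hcn
  · obtain ⟨h, hh⟩ := F.rank
    -- Raising the rank of `x` above that of `y` is harmless because `x` is a root.
    refine ⟨update h x (max (h x) (h y + 1)), fun c hc hp => ?_⟩
    rcases eq_or_ne c y with rfl | hcy
    · simp [hxy.symm]
    · simp only [update_of_ne hcy] at hp ⊢
      have hcx : c ≠ x := by rintro rfl; exact hrx hp
      have := hh c hc hp
      rw [update_of_ne hcx, update_apply]
      split_ifs with h3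
      · rw [← h3]; omega
      · exact this

/-- Lower a key. -/
theorem setKey (F : Forest n S H ch n n) {v : ℕ} {k : WithTop ℝ} (hk : k ≤ H.key v)
    (ho : o = v ∨ H.par v ∉ S ∨ H.key (H.par v) ≤ k) :
    Forest n S { H with key := update H.key v k } ch n o := by
  refine ⟨F.lt, F.nodup, F.list, F.mem, F.deg, F.mark, F.young, ?_, F.rank⟩
  intro c hc hp hco
  have h1 := F.order c hc hp (fun h => F.not_mem (h ▸ hc))
  have h2 := F.par_ne hc
  simp only [update_apply]
  split_ifs with h3 h4 h4
  · exact le_rfl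
  · exact hk.trans (h3 ▸ h1)
  · subst h4; grind
  · exact h1

/-- Cut the node `x` off its parent and make it a root. -/
theorem cut (F : Forest n S H ch e o) {x a : ℕ} (hx : x ∈ S) (hp : H.par x ∈ S)
    (he : e = x ∨ e ∉ S) (ho : o = x ∨ o ∉ S) :
    (H.prv x = n ∨ H.par (H.prv x) ∈ S) ∧ ∃ ch', Forest n S
      { H with
        par := update H.par x n
        chd := if H.prv x = n then update H.chd (H.par x) (H.nxt x) else H.chd
        nxt := update (if H.prv x = n then H.nxt else update H.nxt (H.prv x) (H.nxt x)) x a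
        prv := if H.nxt x ≠ n then update H.prv (H.nxt x) (H.prv x) else H.prv
        deg := update H.deg (H.par x) (H.deg (H.par x) - 1)
        mrk := update H.mrk x 0 }
      ch' (H.par x) n := by
  obtain ⟨L₁, L₂, hL⟩ := List.append_of_mem ((F.mem _ hp x).2 ⟨hx, rfl⟩)
  have hnS := F.not_mem
  have hyx := F.par_ne hx
  obtain ⟨y, hy⟩ : ∃ y, H.par x = y := ⟨_, rfl⟩
  rw [hy] at hp hL hyx ⊢
  have hndy := F.nodup y hp
  have hly := F.list y hp
  have hmy := F.mem y hp
  have hdy := F.deg y hp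
  rw [hL] at hndy hly hmy hdy
  have hsub : ∀ c ∈ L₁ ++ x :: L₂, c ∈ S ∧ H.par c = y := fun c hc => (hmy c).1 hc
  have hnL : n ∉ L₁ ++ x :: L₂ := fun h => hnS (hsub n h).1
  obtain ⟨h1, h2, h3⟩ := hly.remove hndy hnL
  have hpv : H.prv x = n ↔ L₁ = [] := by
    rw [h2]
    constructor
    · intro h
      by_contra hne
      rw [List.getLastD_eq_getLast?, List.getLast?_eq_some_getLast hne] at h
      exact hnL (by rw [← h]; simp)
    · rintro rfl; rfl
  have hpvL : L₁ ≠ [] → H.prv x ∈ L₁ := by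
    intro hne
    rw [h2, List.getLastD_eq_getLast?, List.getLast?_eq_some_getLast hne]
    simp
  simp only [← hpv] at h1
  have hpar : ∀ c, update H.par x n c ∈ S → c ≠ x := by
    rintro c hc rfl
    simp [hnS] at hc
  refine ⟨?_, update ch y (L₁ ++ L₂), F.lt, ?_, ?_, ?_, ?_, ?_, ?_, ?_, ?_⟩
  -- The previous sibling is also a child of `y`, hence not a root; so the write to its `nxt` does
  -- not touch the list of roots.
  · rw [or_iff_not_imp_left, hpv]
    intro hne
    rw [(hsub _ (List.mem_append_left _ (hpvL hne))).2]
    exact hp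
  · intro z hz
    rcases eq_or_ne z y with rfl | hzy
    · rw [update_self]; grind
    · rw [update_of_ne hzy]; exact F.nodup z hz
  · intro z hz
    rcases eq_or_ne z y with hzy | hzy
    · subst hzy
      simp only [update_self]
      have h4 : (if H.prv x = n then update H.chd z (H.nxt x) else H.chd) z =
          if H.prv x = n then H.nxt x else H.chd z := by split_ifs <;> simp
      rw [h4]
      refine h1.congr (fun c hc => ?_) fun _ _ => rfl
      rw [update_of_ne (by grind)]
    · have h4 : (if H.prv x = n then update H.chd y (H.nxt x) else H.chd) z = H.chd z := by
        split_ifs <;> simp [hzy]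
      simp only [h4, update_of_ne hzy]
      have h5 : ∀ c ∈ ch z, c ∉ L₁ ++ x :: L₂ := fun c hc hc' =>
        hzy (((F.mem z hz c).1 hc).2.symm.trans (hsub c hc').2)
      refine (F.list z hz).congr (fun c hc => ?_) fun c hc => ?_
      · have := h5 c hc
        rw [update_of_ne (by grind)]
        split_ifs with h6
        · rfl
        · have := hpvL (fun h => h6 (hpv.2 h))
          rw [update_of_ne (by grind)]
      · have := h5 c hc
        split_ifs with h6
        · have h7 : H.nxt x ∈ L₂ := h3.resolve_left h6
          rw [update_of_ne (by grind)]
        · rfl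
  · intro z hz c
    rcases eq_or_ne z y with hzy | hzy
    · rw [hzy, update_self]
      rcases eq_or_ne c x with rfl | hcx
      · simp only [update_self]
        grind
      · simp only [update_of_ne hcx, ← hmy c]
        simp [hcx]
    · rw [update_of_ne hzy, F.mem z hz]
      rcases eq_or_ne c x with rfl | hcx
      · simp only [update_self]
        grind
      · simp only [update_of_ne hcx]
  · intro z hz
    rcases eq_or_ne z y with hzy | hzy
    · subst hzy
      simp only [update_self, hdy, List.length_append, List.length_cons]
      omega
    · simp only [update_of_ne hzy, F.deg z hz]
  · intro z hz
    have := F.mark z hz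
    simp only [update_apply]
    split_ifs <;> omega
  -- Among the remaining children only `y` can lose degree, and `y` is now the exempt node; `x`
  -- itself is nobody's child any more.
  · have key : ∀ z ∈ S, ∀ c L, c :: L <:+ ch z → c ≠ x →
        L.length ≤ update H.deg y (H.deg y - 1) c + update H.mrk x 0 c +
          if c = y then 1 else 0 := by
      intro z hz c L hc hcx
      have h4 := F.young z hz c L hc
      have h5 : c ∈ S := ((F.mem z hz c).1 (hc.subset (by simp))).1
      have h6 : c ≠ e := by rintro rfl; exact he.elim hcx (fun h => h h5)
      simp only [h6, if_false, add_zero] at h4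
      simp only [update_apply, hcx, if_false]
      split_ifs with h7
      · subst h7; omega
      · exact h4
    intro z hz c L hc
    rcases eq_or_ne z y with hzy | hzy
    · rw [hzy, update_self] at hc
      have hcL : c ∈ L₁ ++ L₂ := hc.subset (by simp)
      have hcx : c ≠ x := by grind
      have hsuf : L₂ <:+ ch y := by
        rw [hL]
        exact (List.suffix_cons x L₂).trans (List.suffix_append _ _)
      -- Siblings younger than `x` lose an older sibling, which only weakens the demand on them: a
      -- suffix starting in `L₁` comes from a longer suffix of the old list.
      rcases List.suffix_or_suffix_of_suffix hc (List.suffix_append L₁ L₂) with h | ⟨T, hT⟩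
      · exact key y hp c L (h.trans hsuf) hcx
      · cases T with
        | nil =>
          rw [List.nil_append] at hT
          exact key y hp c L (hT ▸ hsuf) hcx
        | cons d T =>
          obtain ⟨rfl, rfl⟩ := List.cons.inj hT
          obtain ⟨U, hU⟩ := hc
          have hU' : L₁ = U ++ d :: T := by
            apply List.append_cancel_right (bs := L₂)
            rw [← hU]; simp
          refine le_trans ?_ (key y hp d (T ++ x :: L₂) ⟨U, ?_⟩ hcx)
          · simp
          · rw [hL, hU']; simp
    · rw [update_of_ne hzy] at hc
      refine key z hz c L hc ?_
      rintro rfl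
      exact hzy (((F.mem z hz c).1 (hc.subset (by simp))).2.symm.trans hy)
  · intro c hc hp hcn
    have hcx := hpar c hp
    simp only [update_of_ne hcx] at hp ⊢
    refine F.order c hc hp ?_
    rintro rfl
    exact ho.elim hcx (fun h => h hc)
  · obtain ⟨h, hh⟩ := F.rank
    refine ⟨h, fun c hc hp => ?_⟩
    have hcx := hpar c hp
    simp only [update_of_ne hcx] at hp ⊢
    exact hh c hc hp

/-- A root needs no exemption. -/
theorem of_root (F : Forest n S H ch e n) (hr : H.par e ∉ S) : Forest n S H ch n n := by
  refine ⟨F.lt, F.nodup, F.list, F.mem, F.deg, F.mark, fun z hz c L hL => ?_, F.order, F.rank⟩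
  have h1 := (F.mem z hz c).1 (hL.subset (by simp))
  have h2 := F.young z hz c L hL
  have : c ≠ e := by rintro rfl; exact hr (h1.2 ▸ hz)
  simp only [this, if_false] at h2
  omega

/-- A node that lost one child gets marked. -/
theorem setMark (F : Forest n S H ch e n) (hm : H.mrk e = 0) :
    Forest n S { H with mrk := update H.mrk e 1 } ch n n := by
  refine ⟨F.lt, F.nodup, F.list, F.mem, F.deg, fun z hz => ?_, fun z hz c L hL => ?_, F.order,
    F.rank⟩
  · have := F.mark z hz
    simp only [update_apply]
    split_ifs <;> omega
  · have h2 := F.young z hz c L hL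
    simp only [update_apply]
    split_ifs at h2 ⊢ <;> grind

/-- A key that is minimal among the roots is minimal. -/
theorem min_le (F : Forest n S H ch n n) {k : WithTop ℝ}
    (hk : ∀ c ∈ S, H.par c ∉ S → k ≤ H.key c) : ∀ c ∈ S, k ≤ H.key c := by
  obtain ⟨h, hh⟩ := F.rank
  -- Induction from the roots downwards: a parent has larger rank, hence a smaller distance to the
  -- maximal rank.
  suffices ∀ d, ∀ c ∈ S, S.sup h - h c = d → k ≤ H.key c from fun c hc => this _ c hc rfl
  intro d
  induction d using Nat.strong_induction_on with
  | _ d ih =>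
    intro c hc hd
    by_cases hp : H.par c ∈ S
    · have h1 := hh c hc hp
      have h2 : h (H.par c) ≤ S.sup h := Finset.le_sup hp
      exact (ih _ (by omega) _ hp rfl).trans (F.order c hc hp fun h => F.not_mem (h ▸ hc))
    · exact hk c hc hp

/-! ### The Fibonacci bound on degrees -/

/-- In the application `f c` is the number of descendants of the child `c`, and `T` consists of its
older siblings. -/
theorem sum_fib_le (f : ℕ → ℕ) (L : List ℕ)
    (hL : ∀ c T, c :: T <:+ L → Nat.fib (T.length + 1) ≤ f c) :
    ∑ k ∈ Finset.range (L.length + 1), Nat.fib k ≤ (L.map f).sum := by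
  induction L with
  | nil => simp
  | cons c L ih =>
    have h1 := hL c L (List.suffix_refl _)
    have h2 := ih fun d T hT => hL d T (hT.trans (List.suffix_cons _ _))
    rw [List.length_cons, Finset.sum_range_succ, List.map_cons, List.sum_cons]
    omega

-- A child with `i` older siblings has degree at least `i - 1`, hence by induction at least `fib (i
-- + 1)` descendants; with the node itself these add up to `fib (d + 2)`. Different children have
-- disjoint sets of descendants because the ancestors of a node form a chain.
open scoped Classical in
theorem fib_le_card_descendants (F : Forest n S H ch n n) {x : ℕ} (hx : x ∈ S) :
    Nat.fib (H.deg x + 2) ≤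
      (S.filter fun c => Relation.ReflTransGen (fun c d => H.par c = d ∧ c ∈ S ∧ d ∈ S) c x).card := by
  obtain ⟨h, hh⟩ := F.rank
  set r : ℕ → ℕ → Prop := fun c d => H.par c = d ∧ c ∈ S ∧ d ∈ S with hr
  have hle : ∀ c d, Relation.ReflTransGen r c d → h c ≤ h d := by
    intro c d hcd
    induction hcd with
    | refl => exact le_rfl
    | tail _ h2 ih =>
      obtain ⟨rfl, h3, h4⟩ := h2
      exact ih.trans (hh _ h3 h4).le
  have huniq : Relator.RightUnique r := fun a b c h1 h2 => h1.1.symm.trans h2.1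
  suffices ∀ d, ∀ x ∈ S, h x = d →
      Nat.fib (H.deg x + 2) ≤ (S.filter fun c => Relation.ReflTransGen r c x).card from
    this _ x hx rfl
  intro d
  induction d using Nat.strong_induction_on with
  | _ d ih =>
    intro x hx hd
    have hch : ∀ c ∈ ch x, r c x := fun c hc =>
      ⟨((F.mem x hx c).1 hc).2, ((F.mem x hx c).1 hc).1, hx⟩
    have hlt : ∀ c ∈ ch x, h c < h x := fun c hc => by
      have := hh c (hch c hc).2.1 (by rw [(hch c hc).1]; exact hx)
      rwa [(hch c hc).1] at this
    have hback : ∀ c ∈ ch x, ¬ Relation.ReflTransGen r x c := fun c hc hxc =>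
      (hlt c hc).not_ge (hle _ _ hxc)
    have hno : ∀ c ∈ ch x, ∀ d ∈ ch x, c ≠ d → ¬ Relation.ReflTransGen r c d := by
      intro c hc d hd hcd hrd
      rcases hrd.cases_head with h1 | ⟨b, h1, h2⟩
      · exact hcd h1
      · rw [huniq h1 (hch c hc)] at h2
        exact hback d hd h2
    have hsub : Insert.insert x ((ch x).toFinset.biUnion fun c =>
        S.filter fun a => Relation.ReflTransGen r a c) ⊆
        S.filter fun c => Relation.ReflTransGen r c x := by
      intro a ha
      rw [Finset.mem_filter]
      rcases Finset.mem_insert.1 ha with rfl | ha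
      · exact ⟨hx, .refl⟩
      · obtain ⟨c, hc, hac⟩ := Finset.mem_biUnion.1 ha
        rw [Finset.mem_filter] at hac
        exact ⟨hac.1, hac.2.tail (hch c (List.mem_toFinset.1 hc))⟩
    refine le_trans ?_ (Finset.card_le_card hsub)
    rw [Finset.card_insert_of_notMem, Finset.card_biUnion, List.sum_toFinset _ (F.nodup x hx),
      Nat.fib_succ_eq_succ_sum, F.deg x hx]
    · refine Nat.succ_le_succ (sum_fib_le _ _ fun c T hT => ?_)
      have hc : c ∈ ch x := hT.subset (by simp)
      refine le_trans (Nat.fib_mono ?_) (ih (h c) (hd ▸ hlt c hc) c (hch c hc).2.1 rfl)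
      have h1 := F.young x hx c T hT
      have h2 := F.mark c (hch c hc).2.1
      have h3 : c ≠ n := fun h => F.not_mem (h ▸ (hch c hc).2.1)
      simp only [h3, if_false] at h1
      omega
    · intro c hc d hd hcd
      rw [Function.onFun, Finset.disjoint_left]
      intro a ha ha'
      have hc' := List.mem_toFinset.1 hc
      have hd' := List.mem_toFinset.1 hd
      rcases Relation.ReflTransGen.total_of_right_unique huniq (Finset.mem_filter.1 ha).2
        (Finset.mem_filter.1 ha').2 with h1 | h1
      · exact hno c hc' d hd' hcd h1
      · exact hno d hd' c hc' hcd.symm h1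
    · intro ha
      obtain ⟨c, hc, hac⟩ := Finset.mem_biUnion.1 ha
      exact hback c (List.mem_toFinset.1 hc) (Finset.mem_filter.1 hac).2

theorem fib_le (F : Forest n S H ch n n) {x : ℕ} (hx : x ∈ S) : Nat.fib (H.deg x + 2) ≤ n := by
  classical
  refine (F.fib_le_card_descendants hx).trans ((Finset.card_filter_le _ _).trans ?_)
  have : S ⊆ Finset.range n := fun x hx => Finset.mem_range.2 (F.lt x hx)
  simpa using Finset.card_le_card this

/-- This keeps the accesses to `table` within its initialized part. -/
theorem deg_lt (F : Forest n S H ch n n) {x : ℕ} (hx : x ∈ S) : H.deg x < n := by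
  have h1 := F.fib_le hx
  have h2 := Nat.le_fib_add_one (H.deg x + 2)
  omega

/-- The Fibonacci numbers at least double in two steps. This stands in for the golden ratio, at the
price of the factor 2 in `deg_le`. -/
theorem two_pow_le_fib (d : ℕ) : 2 ^ d ≤ Nat.fib (2 * d + 2) := by
  induction d with
  | zero => simp
  | succ d ih =>
    have h1 : Nat.fib (2 * (d + 1) + 2) = Nat.fib (2 * d + 2) + Nat.fib (2 * d + 3) :=
      Nat.fib_add_two
    have h2 : Nat.fib (2 * d + 2) ≤ Nat.fib (2 * d + 3) := Nat.fib_le_fib_succ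
    rw [pow_succ]
    omega

/-- Degrees are logarithmic in the number of vertices. -/
theorem deg_le (F : Forest n S H ch n n) {x : ℕ} (hx : x ∈ S) :
    H.deg x ≤ 2 * Nat.log 2 n + 1 := by
  have h1 := F.fib_le hx
  have h2 : 2 ^ (H.deg x / 2) ≤ n :=
    (two_pow_le_fib _).trans ((Nat.fib_mono (by omega)).trans h1)
  have h3 := Nat.le_log_of_pow_le (by norm_num) h2
  omega

end Forest

/-! ### The operations of the Fibonacci heap -/

attribute [simp] runs_skip runs_mov runs_put runs_putNum runs_inc runs_incAt runs_decAt runs_seq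
  runs_cond

theorem Mem.setReg_self (m : Mem) (r : Reg) : m.setReg r (m.reg r) = m := by
  simp [Mem.setReg]

/-- `rt` is the list of roots of the forest on the nodes `S`. -/
structure RootList (n : ℕ) (S : Finset ℕ) (m : Mem) (rt : List ℕ) : Prop where
  size : m.reg .n = n
  chain : Chain n (m.cell .nxt) (m.reg .roots) rt
  nodup : rt.Nodup
  mem : ∀ c, c ∈ rt ↔ c ∈ S ∧ m.cell .parent c ∉ S
  root : ∀ c ∈ rt, m.cell .parent c = n ∧ m.cell .mark c = 0

/-- The memory holds a Fibonacci heap with the nodes `S` and the list `rt` of roots. -/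
structure Heap (n : ℕ) (S : Finset ℕ) (m : Mem) (rt : List ℕ) : Prop
    extends RootList n S m rt where
  forest : ∃ ch, Forest n S m.links ch n n
  hmin : S = ∅ ∧ m.reg .hmin = n ∨
    m.reg .hmin ∈ rt ∧ ∀ c ∈ rt, m.num .key (m.reg .hmin) ≤ m.num .key c
  inH : ∀ v < n, m.cell .inH v = 0 ↔ v ∉ S
  -- Null between the operations, so that a removal need not clear the whole table.
  table : ∀ i < n, m.cell .table i = n
  -- Only an inequality: `D v` may have been lowered while `v` waits in `Q`.
  key : ∀ v ∈ S, m.num .D v ≤ m.num .key v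

/-- The potential for the amortized analysis. -/
def potential (S : Finset ℕ) (m : Mem) (rt : List ℕ) : ℕ :=
  rt.length + 2 * ∑ x ∈ S, m.cell .mark x

/-- The three branches are merged by writing `b` in every case, since rewriting the old value of
`hmin` changes nothing. -/
theorem runs_updateMin {r : Reg} {m : Mem} {Q : ℕ → Mem → Prop}
    (h : ∀ t ≤ 3, ∀ b,
      (b = m.reg r ∧ (m.reg .hmin = m.reg .n ∨ m.num .key (m.reg r) < m.num .key (m.reg .hmin)) ∨
        b = m.reg .hmin ∧ m.reg .hmin ≠ m.reg .n ∧
          m.num .key (m.reg .hmin) ≤ m.num .key (m.reg r)) →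
      Q t (m.setReg .hmin b)) :
    Runs (updateMin r) m Q := by
  simp only [updateMin, runs_cond, runs_mov, runs_skip, Test.holds, Word.eval, Num.eval]
  split_ifs with h1 h2
  · exact h _ (by omega) _ (.inl ⟨rfl, .inl h1⟩)
  · exact h _ (by omega) _ (.inl ⟨rfl, .inr h2⟩)
  · have := h (1 + (1 + 1)) (by omega) _ (.inr ⟨rfl, h1, not_lt.1 h2⟩)
    rwa [Mem.setReg_self] at this

theorem runs_cut (m : Mem) :
    Runs cut m fun t m' => t ≤ 12 ∧ m'.reg .roots = m.reg .x ∧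
      m'.links =
        let H := m.links
        let x := m.reg .x
        let y := m.reg .y
        let n := m.reg .n
        { H with
          par := update H.par x n
          chd := if H.prv x = n then update H.chd y (H.nxt x) else H.chd
          nxt := update (if H.prv x = n then H.nxt else update H.nxt (H.prv x) (H.nxt x)) x
            (m.reg .roots)
          prv := if H.nxt x ≠ n then update H.prv (H.nxt x) (H.prv x) else H.prv
          deg := update H.deg y (H.deg y - 1)
          mrk := update H.mrk x 0 } := by
  simp only [cut, pushRoot, runs_seq, runs_cond, runs_mov, runs_put, runs_skip, runs_decAt,
    Test.holds, Word.eval]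
  by_cases h1 : m.cell .prv (m.reg .x) = m.reg .n <;>
    by_cases h2 : m.cell .nxt (m.reg .x) = m.reg .n <;>
    simp [h1, h2, Mem.links]

theorem runs_link (m : Mem) :
    Runs link m fun t m' => t ≤ 9 ∧
      m'.links =
        let H := m.links
        let x := m.reg .x
        let y := m.reg .y
        let n := m.reg .n
        { H with
          par := update H.par y x
          chd := update H.chd x y
          nxt := update H.nxt y (H.chd x)
          prv := if H.chd x ≠ n then update (update H.prv y n) (H.chd x) y else update H.prv y n
          deg := update H.deg x (H.deg x + 1)
          mrk := update H.mrk y 0 } := by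
  simp only [link, runs_seq, runs_cond, runs_mov, runs_put, runs_skip, runs_incAt,
    Test.holds, Word.eval]
  by_cases h1 : m.cell .child (m.reg .x) = m.reg .n <;> simp [h1, Mem.links]

/-- A stale parent pointer would turn an old root into a child of a newly inserted `v`. There is
none, because the parents of roots are null. -/
theorem Heap.par_ne {n : ℕ} {S : Finset ℕ} {m : Mem} {rt : List ℕ} (h : Heap n S m rt) {v : ℕ}
    (hv : v ∉ S) (hvn : v < n) : ∀ c ∈ S, m.cell .parent c ≠ v := by
  intro c hc hcv
  by_cases hp : m.cell .parent c ∈ S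
  · exact hv (hcv ▸ hp)
  · have := (h.root c ((h.mem c).2 ⟨hc, hp⟩)).1
    omega

theorem Heap.runs_insertNode {n : ℕ} {S : Finset ℕ} {m : Mem} {rt : List ℕ} (h : Heap n S m rt)
    (hv : m.reg .v ∉ S) (hvn : m.reg .v < n) :
    Runs insertNode m fun t m' => t ≤ 11 ∧ Heap n (insert (m.reg .v) S) m' (m.reg .v :: rt) ∧
      potential (insert (m.reg .v) S) m' (m.reg .v :: rt) = potential S m rt + 1 := by
  obtain ⟨ch, F⟩ := h.forest
  have hn := h.size
  have hcl := h.par_ne hv hvn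
  have hne : ∀ c ∈ S, c ≠ m.reg .v := fun c hc h => hv (h ▸ hc)
  have hrt : ∀ c ∈ rt, c ≠ m.reg .v := fun c hc => hne c ((h.mem c).1 hc).1
  simp [insertNode, SP.pushRoot]
  apply runs_updateMin
  intro t ht b hb
  simp at hb
  refine ⟨by omega, ⟨⟨by simp [hn], ?_, ?_, ?_, ?_⟩, ?_, ?_, ?_, ?_, ?_⟩, ?_⟩
  · simp only [Chain]
    refine ⟨by simp, ?_⟩
    simp only [Mem.setReg_cell, Mem.setCell_cell, Mem.setNum_cell, if_true, reduceCtorEq, if_false,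
      update_self]
    refine (h.chain).congr fun c hc => ?_
    simp [hrt c hc]
  · exact List.nodup_cons.2 ⟨fun hc => hrt _ hc rfl, h.nodup⟩
  · intro c
    rcases eq_or_ne c (m.reg .v) with rfl | hc
    · simp [hn, F.not_mem, hvn.ne']
    · simp only [List.mem_cons, hc, false_or, h.mem c, Finset.mem_insert]
      refine and_congr_right fun hcS => ?_
      simp [hc, hcl c hcS]
  · intro c hc
    rcases List.mem_cons.1 hc with rfl | hc
    · simp [hn]
    · simpa [hrt c hc] using h.root c hc
  · refine ⟨update ch (m.reg .v) [], ?_⟩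
    have := F.insert (a := m.reg .roots) (k := m.num .D (m.reg .v)) hv hvn hcl
    simpa [Mem.links, hn] using this
  · right
    rcases hb with ⟨rfl, hb⟩ | ⟨rfl, hb, hb'⟩
    · refine ⟨by simp, fun c hc => ?_⟩
      rcases List.mem_cons.1 hc with rfl | hc
      · simp
      · simp only [Mem.setReg_reg, Mem.setReg_num, Mem.setCell_num, Mem.setNum_num, if_true,
          update_self, update_of_ne (hrt c hc)]
        rcases h.hmin with h1 | h1
        · rw [h.mem, h1.1] at hc; simp at hc
        · rcases hb with hb | hb
          · have := F.lt _ ((h.mem _).1 h1.1).1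
            omega
          · rw [update_of_ne (hrt _ h1.1)] at hb
            exact hb.le.trans (h1.2 c hc)
    · rcases h.hmin with h1 | h1
      · exact absurd h1.2 (by rwa [hn] at hb)
      · refine ⟨by simp [h1.1], fun c hc => ?_⟩
        have h2 := hrt _ h1.1
        rcases List.mem_cons.1 hc with rfl | hc
        · simpa [h2] using hb'
        · simpa [h2, hrt c hc] using h1.2 c hc
  · intro u hu
    rcases eq_or_ne u (m.reg .v) with rfl | hc
    · simp
    · simpa [hc] using h.inH u hu
  · simpa using h.table
  · intro u hu
    rcases eq_or_ne u (m.reg .v) with rfl | hc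
    · simp
    · simpa [hc] using h.key u (by grind)
  · simp only [potential, Finset.sum_insert hv]
    simp only [Mem.setReg_cell, Mem.setCell_cell, Mem.setNum_cell, if_true, reduceCtorEq, if_false,
      update_self]
    rw [Finset.sum_congr rfl fun c hc => update_of_ne (hne c hc) _ _]
    simp; ring

theorem sum_update_add {S : Finset ℕ} (f : ℕ → ℕ) {x : ℕ} (hx : x ∈ S) (b : ℕ) :
    ∑ c ∈ S, update f x b c + f x = ∑ c ∈ S, f c + b := by
  rw [Finset.sum_update_of_mem hx, ← Finset.add_sum_erase S f hx, ← Finset.erase_eq]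
  ring

/-! ### Decreasing a key -/

/-- The body of the loop of cascading cuts. -/
def cascadeBody : Com :=
  cut ;;
  mov .x (.reg .y) ;;
  mov .y (.cell .parent .x) ;;
  cond (.eq (.reg .y) (.reg .n))
    (mov .go (.lit 0))
    (cond (.eq (.cell .mark .x) (.lit 0))
      (put .mark .x (.lit 1) ;; mov .go (.lit 0))
      skip)

/-- The effect of a single cut on the root list and the forest together: the exemption from `young`
moves from `x` to its parent `y`, which has lost a child. -/
theorem RootList.cascade {n : ℕ} {S : Finset ℕ} {m m₁ : Mem} {rt : List ℕ} {ch : ℕ → List ℕ}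
    {e o t : ℕ} (hR : RootList n S m rt) (F : Forest n S m.links ch e o) (hx : m.reg .x ∈ S)
    (hp : m.cell .parent (m.reg .x) ∈ S) (hy : m.reg .y = m.cell .parent (m.reg .x))
    (he : e = m.reg .x ∨ e ∉ S) (ho : o = m.reg .x ∨ o ∉ S) (hE : Exec cut m t [] m₁)
    (hroots : m₁.reg .roots = m.reg .x)
    (hlinks : m₁.links =
        let H := m.links
        let x := m.reg .x
        let y := m.reg .y
        let n := m.reg .n
        { H with
          par := update H.par x n
          chd := if H.prv x = n then update H.chd y (H.nxt x) else H.chd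
          nxt := update (if H.prv x = n then H.nxt else update H.nxt (H.prv x) (H.nxt x)) x
            (m.reg .roots)
          prv := if H.nxt x ≠ n then update H.prv (H.nxt x) (H.prv x) else H.prv
          deg := update H.deg y (H.deg y - 1)
          mrk := update H.mrk x 0 }) :
    RootList n S m₁ (m.reg .x :: rt) ∧ (∃ ch', Forest n S m₁.links ch' (m.reg .y) n) ∧
      m₁.cell .parent = update (m.cell .parent) (m.reg .x) n ∧
      m₁.cell .mark = update (m.cell .mark) (m.reg .x) 0 := by
  have hn := hR.size
  obtain ⟨hpv, ch', F'⟩ := F.cut (a := m.reg .roots) hx hp he ho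
  have hpar : m₁.cell .parent = update (m.cell .parent) (m.reg .x) n := by
    have := congrArg Links.par hlinks
    simpa [Mem.links, hn] using this
  have hmrk : m₁.cell .mark = update (m.cell .mark) (m.reg .x) 0 := by
    have := congrArg Links.mrk hlinks
    simpa [Mem.links] using this
  have hnxt := congrArg Links.nxt hlinks
  have hxrt : ∀ c ∈ rt, c ≠ m.reg .x := by
    rintro c hc rfl
    exact ((hR.mem _).1 hc).2 hp
  refine ⟨⟨?_, ?_, ?_, ?_, ?_⟩, ⟨ch', ?_⟩, hpar, hmrk⟩
  · rw [hE.reg_eq rfl, hn]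
  · rw [hroots]
    refine ⟨rfl, ?_⟩
    change Chain n m₁.links.nxt (m₁.links.nxt (m.reg .x)) rt
    rw [hnxt]
    simp only [update_self]
    refine hR.chain.congr fun c hc => ?_
    rw [update_of_ne (hxrt c hc)]
    split_ifs with h
    · rfl
    · rw [update_of_ne]
      · rfl
      · rintro rfl
        rw [hn] at h
        exact ((hR.mem _).1 hc).2 (hpv.resolve_left h)
  · exact List.nodup_cons.2 ⟨fun h => hxrt _ h rfl, hR.nodup⟩
  · intro c
    rw [hpar, List.mem_cons, hR.mem]
    rcases eq_or_ne c (m.reg .x) with rfl | hc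
    · simp [hx, F.not_mem]
    · simp [hc]
  · intro c hc
    rw [hpar, hmrk]
    rcases List.mem_cons.1 hc with rfl | hc
    · simp
    · simpa [hxrt c hc] using hR.root c hc
  · rw [hlinks]
    simp only [hn]
    rw [hy]
    exact F'

/-- Every cut creates a root, so `k`, a bound on the number of non-roots, limits the rounds. A round
takes at most 20 steps. The `mark` term records that cutting a marked `x` releases 40, enough for a
round and for the new root. The last round adds at most a root and a mark, worth 60, which with its
own 20 steps makes 80. -/
theorem runs_cascade {n : ℕ} {S : Finset ℕ} (k : ℕ) : ∀ {m : Mem} {rt : List ℕ}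
    {ch : ℕ → List ℕ} {e o : ℕ}, S.card ≤ rt.length + k → RootList n S m rt →
    Forest n S m.links ch e o → m.reg .x ∈ S → m.cell .parent (m.reg .x) ∈ S →
    m.reg .y = m.cell .parent (m.reg .x) → m.reg .go ≠ 0 →
    (e = m.reg .x ∨ e ∉ S) → (o = m.reg .x ∨ o ∉ S) →
    Runs (loop (.ne (.reg .go) (.lit 0)) cascadeBody) m fun t m' => ∃ rt', RootList n S m' rt' ∧
      (∃ ch', Forest n S m'.links ch' n n) ∧ rt ⊆ rt' ∧ m.reg .x ∈ rt' ∧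
      t + 20 * potential S m' rt' + 40 * m.cell .mark (m.reg .x) ≤
        20 * potential S m rt + 80 := by
  induction k with
  | zero =>
    intro m rt ch e o hk hR F hx hp
    -- Otherwise the roots together with the non-root `x` would outnumber `S`.
    exfalso
    have h1 : m.reg .x ∉ rt := fun h => ((hR.mem _).1 h).2 hp
    have h2 : (m.reg .x :: rt).toFinset ⊆ S := by
      intro c hc
      rcases List.mem_cons.1 (List.mem_toFinset.1 hc) with rfl | hc
      · exact hx
      · exact ((hR.mem c).1 hc).1
    have h3 := Finset.card_le_card h2
    rw [List.toFinset_card_of_nodup (List.nodup_cons.2 ⟨h1, hR.nodup⟩)] at h3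
    simp at h3 hk
    omega
  | succ k ih =>
    intro m rt ch e o hk hR F hx hp hy hgo he ho
    refine runs_loop_of hgo (runs_seq.2 ((runs_cut m).mono ?_))
    rintro t₁ m₁ hE ⟨ht₁, hroots, hlinks⟩
    obtain ⟨hR₁, ⟨ch₁, F₁⟩, hpar, hmrk⟩ := hR.cascade F hx hp hy he ho hE hroots hlinks
    have hn := hR.size
    have hn₁ := hR₁.size
    have hyS : m.reg .y ∈ S := hy ▸ hp
    have hyx : m.reg .y ≠ m.reg .x := by rw [hy]; exact F.par_ne hx
    have hy₁ : m₁.reg .y = m.reg .y := hE.reg_eq rfl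
    have hgo₁ : m₁.reg .go = m.reg .go := hE.reg_eq rfl
    have hpary : m₁.cell .parent (m.reg .y) = m.cell .parent (m.reg .y) := by
      rw [hpar, update_of_ne hyx]
    have hpot : potential S m₁ (m.reg .x :: rt) + 2 * m.cell .mark (m.reg .x) =
        potential S m rt + 1 := by
      have := sum_update_add (m.cell .mark) hx 0
      simp only [potential, hmrk, List.length_cons]
      omega
    simp only [runs_seq, runs_mov, runs_cond, runs_put, runs_skip, Test.holds, Word.eval,
      Mem.setReg_reg, Mem.setReg_cell, if_true, reduceCtorEq, if_false, hy₁, hn₁]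
    by_cases h1 : m₁.cell .parent (m.reg .y) = n
    · rw [if_pos h1]
      refine runs_loop_of_not (by simp) ⟨m.reg .x :: rt, ⟨by simp [hn₁], by simpa using hR₁.chain,
        hR₁.nodup, hR₁.mem, hR₁.root⟩, ⟨ch₁, F₁.of_root ?_⟩, by simp, by simp, ?_⟩
      · change m₁.cell .parent (m.reg .y) ∉ S
        rw [h1]; exact F.not_mem
      · change _ + 20 * potential S m₁ (m.reg .x :: rt) + _ ≤ _
        omega
    · rw [if_neg h1]
      have hpS : m₁.cell .parent (m.reg .y) ∈ S := by
        by_contra h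
        exact h1 (hR₁.root _ ((hR₁.mem _).2 ⟨hyS, h⟩)).1
      by_cases h2 : m₁.cell .mark (m.reg .y) = 0
      · rw [if_pos h2]
        refine runs_loop_of_not (by simp) ⟨m.reg .x :: rt, ⟨by simp [hn₁],
          by simpa using hR₁.chain, hR₁.nodup, by simpa using hR₁.mem, ?_⟩, ⟨ch₁, ?_⟩, by simp,
          by simp, ?_⟩
        · intro c hc
          have hcy : c ≠ m.reg .y := by
            rintro rfl
            exact ((hR₁.mem _).1 hc).2 hpS
          simpa [hcy] using hR₁.root c hc
        · simpa [Mem.links] using F₁.setMark h2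
        · have := sum_update_add (m₁.cell .mark) hyS 1
          simp only [potential, Mem.setReg_cell, Mem.setCell_cell, if_true] at hpot ⊢
          omega
      -- `y` was already marked and is cut next, so it may stay the exempt node in the induction
      -- hypothesis.
      · rw [if_neg h2]
        have h3 := F₁.mark _ hyS
        have h4 : m₁.cell .mark (m.reg .y) = 1 := by
          change m₁.cell .mark (m.reg .y) ≤ 1 at h3
          omega
        set m₂ := (m₁.setReg .x (m.reg .y)).setReg .y (m₁.cell .parent (m.reg .y)) with hm₂
        have hR₂ : RootList n S m₂ (m.reg .x :: rt) :=
          ⟨by simp [hm₂, hn₁], by simpa [hm₂] using hR₁.chain, hR₁.nodup, hR₁.mem, hR₁.root⟩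
        refine (ih (m := m₂) (by simp; omega) hR₂ F₁ (by simpa [hm₂] using hyS)
          (by simpa [hm₂] using hpS) (by simp [hm₂]) (by simpa [hm₂, hgo₁] using hgo)
          (by simp [hm₂]) (.inr F.not_mem)).mono ?_
        rintro t₂ m' - ⟨rt', h5, h6, h7, -, h8⟩
        refine ⟨rt', h5, h6, fun c hc => h7 (by simp [hc]), h7 (by simp), ?_⟩
        have h9 : potential S m₂ (m.reg .x :: rt) = potential S m₁ (m.reg .x :: rt) := rfl
        have h10 : m₂.cell .mark (m₂.reg .x) = 1 := by simpa [hm₂] using h4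
        omega

theorem Heap.hmin_le {n : ℕ} {S : Finset ℕ} {m : Mem} {rt : List ℕ} (h : Heap n S m rt)
    (hS : S.Nonempty) :
    m.reg .hmin ∈ rt ∧ ∀ c ∈ S, m.num .key (m.reg .hmin) ≤ m.num .key c := by
  obtain ⟨ch, F⟩ := h.forest
  rcases h.hmin with h1 | h1
  · exact absurd h1.1 hS.ne_empty
  · exact ⟨h1.1, F.min_le fun c hc hp => h1.2 c ((h.mem c).2 ⟨hc, hp⟩)⟩

/-- `updateMin` does not check that `v` is a root. But a `v` with key below the minimum is one: a
parent would have a key at most that of `v` by heap order, while its key is unchanged and thus at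
least the old minimum. -/
theorem Heap.runs_updateMin {n : ℕ} {S : Finset ℕ} {m m' : Mem} {rt rt' : List ℕ}
    (h : Heap n S m rt) (hv : m.reg .v ∈ S) (hR : RootList n S m' rt')
    (hF : ∃ ch, Forest n S m'.links ch n n) (hsub : rt ⊆ rt') (hv' : m'.reg .v = m.reg .v)
    (hmin : m'.reg .hmin = m.reg .hmin) (hinH : m'.cell .inH = m.cell .inH)
    (htable : m'.cell .table = m.cell .table) (hD : m'.num .D = m.num .D)
    (hkey : m'.num .key = update (m.num .key) (m.reg .v) (m.num .D (m.reg .v))) :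
    Runs (updateMin .v) m' fun t m'' => t ≤ 3 ∧ Heap n S m'' rt' ∧
      potential S m'' rt' = potential S m' rt' := by
  obtain ⟨h1, h2⟩ := h.hmin_le ⟨_, hv⟩
  obtain ⟨ch, F⟩ := hF
  have h3 : ∀ c ∈ S, m'.num .key c ≤ m.num .key c := by
    intro c hc
    rw [hkey, update_apply]
    split_ifs with hcv
    · rw [hcv]; exact h.key _ hv
    · exact le_rfl
  have hminS := ((h.mem _).1 h1).1
  have h4 : ∀ c ∈ S, c ≠ m.reg .v → m'.num .key (m.reg .hmin) ≤ m'.num .key c := by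
    intro c hc hcv
    refine (h3 _ hminS).trans ((h2 c hc).trans ?_)
    rw [hkey, update_of_ne hcv]
  apply SP.runs_updateMin
  intro t ht b hb
  rw [hv', hmin, hR.size] at hb
  refine ⟨ht, ⟨⟨by simp [hR.size], by simpa using hR.chain, hR.nodup, hR.mem, hR.root⟩,
    ⟨ch, F⟩, ?_, by simpa [hinH] using h.inH, by simpa [htable] using h.table, ?_⟩, rfl⟩
  · right
    simp only [Mem.setReg_reg, if_true, Mem.setReg_num]
    rcases hb with ⟨rfl, hb⟩ | ⟨rfl, -, hb⟩
    · rcases hb with hb | hb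
      · exact absurd hminS (hb ▸ F.not_mem)
      · constructor
        · rw [hR.mem]
          refine ⟨hv, fun hp => ?_⟩
          have h5 := F.order _ hv hp (fun h => F.not_mem (h ▸ hv))
          have h6 := h4 _ hp (F.par_ne hv)
          exact (hb.trans_le (h6.trans h5)).false
        · intro c hc
          rcases eq_or_ne c (m.reg .v) with rfl | hcv
          · exact le_rfl
          · exact hb.le.trans (h4 c ((hR.mem c).1 hc).1 hcv)
    · refine ⟨hsub h1, fun c hc => ?_⟩
      rcases eq_or_ne c (m.reg .v) with rfl | hcv
      · exact hb
      · exact h4 c ((hR.mem c).1 hc).1 hcv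
  · intro u hu
    simp only [Mem.setReg_num, hD, hkey, update_apply]
    split_ifs with huv
    · rw [huv]
    · exact h.key u hu

theorem Heap.runs_decreaseKey {n : ℕ} {S : Finset ℕ} {m : Mem} {rt : List ℕ} (h : Heap n S m rt)
    (hv : m.reg .v ∈ S) :
    Runs decreaseKey m fun t m' => ∃ rt', Heap n S m' rt' ∧
      t + 20 * potential S m' rt' ≤ 20 * potential S m rt + 100 := by
  obtain ⟨ch, F⟩ := h.forest
  have hn := h.size
  have hvn := F.par_ne hv
  change m.cell .parent (m.reg .v) ≠ m.reg .v at hvn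
  have hbody : decreaseKey =
    (putNum .key .v (.cell .D .v) ;; mov .x (.reg .v) ;; mov .y (.cell .parent .x) ;;
      mov .go (.lit 0) ;;
      cond (.ne (.reg .y) (.reg .n))
        (cond (.numLt (.cell .key .x) (.cell .key .y)) (mov .go (.lit 1)) skip)
        skip ;;
      loop (.ne (.reg .go) (.lit 0)) cascadeBody ;; updateMin .v) := rfl
  -- The case without cuts: `v` is a root, or its new key is not below that of its parent.
  have hstay : ∀ m₁ : Mem, m₁.cell = m.cell →
      m₁.num = (m.setNum .key (m.reg .v) (m.num .D (m.reg .v))).num → m₁.reg .go = 0 →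
      (∀ r, r ≠ .x → r ≠ .y → r ≠ .go → m₁.reg r = m.reg r) →
      (m.cell .parent (m.reg .v) = n ∨
        m.num .key (m.cell .parent (m.reg .v)) ≤ m.num .D (m.reg .v)) →
      Runs (loop (.ne (.reg .go) (.lit 0)) cascadeBody ;; updateMin .v) m₁ fun t m' =>
        ∃ rt', Heap n S m' rt' ∧ t + 20 * potential S m' rt' ≤ 20 * potential S m rt + 4 := by
    intro m₁ hc hk hgo hr hp
    refine runs_seq.2 (runs_loop_of_not (by simp [hgo]) ?_)
    refine (h.runs_updateMin (m' := m₁) (rt' := rt) hv ⟨?_, ?_, h.nodup, ?_, ?_⟩ ⟨ch, ?_⟩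
      (List.Subset.refl _) (hr _ ?_ ?_ ?_) (hr _ ?_ ?_ ?_) ?_ ?_ ?_ ?_).mono ?_
    any_goals simp
    · rw [hr _ (by simp) (by simp) (by simp), hn]
    · rw [hc, hr _ (by simp) (by simp) (by simp)]; exact h.chain
    · rw [hc]; exact h.mem
    · rw [hc]; exact h.root
    · have := F.setKey (v := m.reg .v) (k := m.num .D (m.reg .v)) (o := n) (h.key _ hv)
        (.inr (hp.imp (fun h => by change m.cell .parent _ ∉ S; rw [h]; exact F.not_mem) id))
      simpa [Mem.links, hc, hk] using this
    · rw [hc]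
    · rw [hc]
    · simp [hk]
    · simp [hk]
    · intro t m' _ ht hH hpot
      refine ⟨rt, hH, ?_⟩
      rw [hpot]
      simp only [potential, hc]
      omega
  rw [hbody]
  simp only [runs_seq (c₁ := putNum _ _ _), runs_seq (c₁ := mov _ _), runs_seq (c₁ := Com.cond _ _ _),
    runs_mov, runs_cond, runs_skip, runs_putNum, Test.holds, Word.eval, Num.eval,
    Mem.setReg_reg, Mem.setReg_cell, Mem.setReg_num, Mem.setNum_reg, Mem.setNum_cell,
    Mem.setNum_num, if_true, reduceCtorEq, if_false, hn, update_self]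
  by_cases h1 : m.cell .parent (m.reg .v) = n
  · rw [if_neg (by simpa using h1)]
    refine (hstay _ (by simp) (by simp) (by simp) ?_ (.inl h1)).mono ?_
    · intro r h1 h2 h3; simp [h1, h2, h3]
    · rintro t m' - ⟨rt', h2, h3⟩
      exact ⟨rt', h2, by omega⟩
  · rw [if_pos h1, update_of_ne hvn]
    split_ifs with h2
    · have hp : m.cell .parent (m.reg .v) ∈ S := by
        by_contra hp
        exact h1 (h.root _ ((h.mem _).2 ⟨hv, hp⟩)).1
      refine runs_seq.2 ((runs_cascade (n := n) (S := S) S.card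
        (m := ((((m.setNum .key (m.reg .v) (m.num .D (m.reg .v))).setReg .x (m.reg .v)).setReg .y
          (m.cell .parent (m.reg .v))).setReg .go 0).setReg .go 1)
        (rt := rt) (ch := ch) (e := n) (o := m.reg .v) (by omega) ⟨by simp [hn], by simpa using h.chain, h.nodup, h.mem, h.root⟩
        ?_ (by simpa using hv) (by simpa using hp) (by simp) (by simp) (.inr F.not_mem)
        (.inl (by simp))).mono ?_)
      · have := F.setKey (v := m.reg .v) (k := m.num .D (m.reg .v)) (o := m.reg .v) (h.key _ hv)
          (.inl rfl)
        simpa [Mem.links] using this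
      · rintro t m₁ hE ⟨rt', hR, hF, hsub, -, ht⟩
        refine (h.runs_updateMin (m' := m₁) (rt' := rt') hv hR hF hsub ?_ ?_ ?_ ?_ ?_ ?_).mono ?_
        · rw [hE.reg_eq rfl]; simp
        · rw [hE.reg_eq rfl]; simp
        · rw [hE.cell_eq rfl]; simp
        · rw [hE.cell_eq rfl]; simp
        · rw [hE.num_eq rfl]; simp
        · rw [hE.num_eq rfl]; simp
        · rintro t' m' - ⟨h3, h4, h5⟩
          refine ⟨rt', h4, ?_⟩
          rw [h5]
          simp only [potential, Mem.setReg_cell, Mem.setNum_cell] at ht ⊢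
          omega
    · refine (hstay _ (by simp) (by simp) (by simp) ?_ (.inr (not_lt.1 h2))).mono ?_
      · intro r h1 h2 h3; simp [h1, h2, h3]
      · rintro t m' - ⟨rt', h2, h3⟩
        exact ⟨rt', h2, by omega⟩

/-! ### Removing the minimum -/

theorem sum_update_zero_le (S : Finset ℕ) (f : ℕ → ℕ) (x : ℕ) :
    ∑ c ∈ S, update f x 0 c ≤ ∑ c ∈ S, f c := by
  refine Finset.sum_le_sum fun c _ => ?_
  rw [update_apply]
  split_ifs
  · exact Nat.zero_le _
  · exact le_rfl

theorem Forest.exists_root {n : ℕ} {S : Finset ℕ} {H : Links} {ch : ℕ → List ℕ} {e o : ℕ}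
    (F : Forest n S H ch e o) (hS : S.Nonempty) : ∃ c ∈ S, H.par c ∉ S := by
  obtain ⟨h, hh⟩ := F.rank
  obtain ⟨c, hc, hmax⟩ := S.exists_max_image h hS
  exact ⟨c, hc, fun hp => (hh c hc hp).not_ge (hmax _ hp)⟩

/-- The state while the children of the removed root `v` are turned into roots: the children `L`
remain, and the list `rt` of roots still holds `v`. -/
structure Promoting (n : ℕ) (T : Finset ℕ) (v B : ℕ) (m : Mem) (L rt : List ℕ) : Prop where
  size : m.reg .n = n
  forest : ∃ ch, Forest n T m.links ch n n
  chain : Chain n (m.cell .nxt) (m.reg .roots) rt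
  nodup : rt.Nodup
  chain' : Chain n (m.cell .nxt) (m.reg .x) L
  nodup' : L.Nodup
  child : ∀ c ∈ L, c ∈ T ∧ m.cell .parent c ∉ T ∧ c ∉ rt
  root : ∀ c ∈ rt, c ≠ v → c ∈ T ∧ m.cell .parent c = n ∧ m.cell .mark c = 0
  mem : ∀ c ∈ T, m.cell .parent c ∉ T → c ∈ L ∨ c ∈ rt
  marks : ∑ c ∈ T, m.cell .mark c ≤ B

theorem Promoting.runs {n : ℕ} {T : Finset ℕ} {v B : ℕ} {m : Mem} {L rt : List ℕ}
    (h : Promoting n T v B m L rt) :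
    Runs (loop (.ne (.reg .x) (.reg .n))
      (mov .nx (.cell .nxt .x) ;; pushRoot .x ;; mov .x (.reg .nx))) m fun t m' =>
      t = 7 * L.length + 1 ∧ ∃ rt', rt'.length = rt.length + L.length ∧
        Promoting n T v B m' [] rt' := by
  induction L generalizing m rt with
  | nil =>
    have hx : m.reg .x = n := h.chain'
    exact runs_loop_of_not (by simp [hx, h.size]) ⟨by simp, rt, by simp, h⟩
  | cons x L ih =>
    obtain ⟨ch, F⟩ := h.forest
    have hn := h.size
    obtain ⟨hx, hL⟩ := h.chain'
    obtain ⟨hxT, hxp, hxrt⟩ := h.child x (by simp)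
    obtain ⟨hxL, hLd⟩ := List.nodup_cons.1 h.nodup'
    have hxn : x ≠ n := fun h => F.not_mem (h ▸ hxT)
    have hne : ∀ c ∈ rt, c ≠ x := fun c hc h => hxrt (h ▸ hc)
    have hneL : ∀ c ∈ L, c ≠ x := fun c hc h => hxL (h ▸ hc)
    refine runs_loop_of (by simp [hx, hn, hxn]) ?_
    simp only [SP.pushRoot, runs_seq, runs_mov, runs_put, Word.eval, Mem.setReg_reg,
      Mem.setReg_cell, Mem.setCell_reg, Mem.setCell_cell, if_true, reduceCtorEq, if_false, hx, hn]
    refine (ih (rt := x :: rt) ⟨by simp [hn], ⟨ch, ?_⟩, ⟨by simp, ?_⟩, ?_, ?_, hLd, ?_, ?_, ?_,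
      ?_⟩).mono ?_
    · simpa [Mem.links] using F.pushRoot (a := m.reg .roots) hxT hxp
    · simp only [Mem.setReg_cell, Mem.setCell_cell, if_true, reduceCtorEq, if_false, update_self]
      exact h.chain.congr fun c hc => by simp [hne c hc]
    · exact List.nodup_cons.2 ⟨hxrt, h.nodup⟩
    · simp only [Mem.setReg_cell, Mem.setCell_cell, Mem.setReg_reg, if_true, reduceCtorEq, if_false]
      exact hL.congr fun c hc => by simp [hneL c hc]
    · intro c hc
      have := h.child c (by simp [hc])
      simpa [hneL c hc] using this
    · intro c hc hcv
      rcases List.mem_cons.1 hc with rfl | hc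
      · simp [hxT]
      · simpa [hne c hc] using h.root c hc hcv
    · intro c hc hp
      rcases eq_or_ne c x with rfl | hcx
      · simp
      · simpa [hcx] using h.mem c hc (by simpa [hcx] using hp)
    · simp only [Mem.setReg_cell, Mem.setCell_cell, if_true, reduceCtorEq, if_false]
      exact (sum_update_zero_le _ _ _).trans h.marks
    · rintro t m' - ⟨ht, rt', hl, h'⟩
      refine ⟨by simp only [List.length_cons]; omega, rt', ?_, h'⟩
      simp only [List.length_cons] at hl ⊢
      omega

/-! ### Consolidation -/

/-- The state while the roots are entered into `table`: the roots in `P`, linked from `a`, are still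
to be visited, and the root `X`, if it is not the null pointer, is about to be entered. -/
structure Consolidating (n : ℕ) (T : Finset ℕ) (v B : ℕ) (m : Mem) (a : ℕ) (P : List ℕ) (X : ℕ) :
    Prop where
  size : m.reg .n = n
  reg_v : m.reg .v = v
  forest : ∃ ch, Forest n T m.links ch n n
  chain : Chain n (m.cell .nxt) a P
  nodup : P.Nodup
  pending : ∀ c ∈ P, c ≠ v → c ∈ T ∧ m.cell .parent c ∉ T
  root : ∀ c ∈ T, m.cell .parent c ∉ T → m.cell .parent c = n ∧ m.cell .mark c = 0 ∧
    (c ∈ P ∨ m.cell .table (m.cell .deg c) = c ∨ c = X)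
  table : ∀ d < n, m.cell .table d ≠ n → m.cell .table d ∈ T ∧
    m.cell .parent (m.cell .table d) ∉ T ∧ m.cell .deg (m.cell .table d) = d ∧
    m.cell .table d ∉ P ∧ m.cell .table d ≠ X ∧ d ≤ m.reg .maxDeg
  maxDeg : m.reg .maxDeg < n ∧ m.reg .maxDeg ≤ 2 * Nat.log 2 n + 1
  marks : ∑ c ∈ T, m.cell .mark c ≤ B

/-- The number of roots. -/
def numRoots (T : Finset ℕ) (m : Mem) : ℕ := (T.filter fun c => m.cell .parent c ∉ T).card

/-- The body of the loop in `enterTable`. -/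
def enterBody : Com :=
  mov .y (.cell .table .d) ;;
  put .table .d (.reg .n) ;;
  cond (.numLt (.cell .key .y) (.cell .key .x))
    (mov .c (.reg .x) ;; mov .x (.reg .y) ;; mov .y (.reg .c))
    skip ;;
  link ;;
  inc .d

/-- Of the two roots of degree `d`, `X'` survives and `Y'` becomes its child. Slot `d` is rightly
empty afterwards, since `X'` now has degree `d + 1` and `Y'` is no root. -/
theorem Consolidating.link {n : ℕ} {T : Finset ℕ} {v B : ℕ} {m m₁ m₂ : Mem} {P : List ℕ}
    {X Y X' Y' d t : ℕ} (h : Consolidating n T v B m (m.reg .nx) P X) (hX : X ∈ T)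
    (hXp : m.cell .parent X ∉ T) (hXP : X ∉ P) (hd : m.cell .deg X = d)
    (hY : m.cell .table d = Y) (hYn : Y ≠ n)
    (hsel : X' = X ∧ Y' = Y ∨ X' = Y ∧ Y' = X) (hkey : m.num .key X' ≤ m.num .key Y')
    (hcell : ∀ a, m₁.cell a = if a = .table then update (m.cell .table) d n else m.cell a)
    (hnum : m₁.num = m.num) (hreg : ∀ r, r ≠ .x → r ≠ .y → r ≠ .c → m₁.reg r = m.reg r)
    (hx : m₁.reg .x = X') (hy : m₁.reg .y = Y') (hE : Exec link m₁ t [] m₂)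
    (hlinks : m₂.links =
        let H := m₁.links
        let x := m₁.reg .x
        let y := m₁.reg .y
        let n := m₁.reg .n
        { H with
          par := update H.par y x
          chd := update H.chd x y
          nxt := update H.nxt y (H.chd x)
          prv := if H.chd x ≠ n then update (update H.prv y n) (H.chd x) y else update H.prv y n
          deg := update H.deg x (H.deg x + 1)
          mrk := update H.mrk y 0 }) :
    Consolidating n T v B m₂ (m₂.reg .nx) P X' ∧ X' ∈ T ∧ m₂.cell .parent X' ∉ T ∧ X' ∉ P ∧
      m₂.cell .deg X' = d + 1 ∧ m₂.reg .x = X' ∧ m₂.reg .d = m.reg .d ∧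
      numRoots T m₂ + 1 = numRoots T m := by
  obtain ⟨ch, F⟩ := h.forest
  have hdn : d < n := hd ▸ F.deg_lt hX
  obtain ⟨hYT, hYp, hYd, hYP, hYX, hdm⟩ := h.table d hdn (by rwa [hY])
  rw [hY] at hYT hYp hYd hYP hYX
  have hX'T : X' ∈ T := by rcases hsel with h | h <;> rw [h.1] <;> assumption
  have hY'T : Y' ∈ T := by rcases hsel with h | h <;> rw [h.2] <;> assumption
  have hX'p : m.cell .parent X' ∉ T := by rcases hsel with h | h <;> rw [h.1] <;> assumption
  have hY'p : m.cell .parent Y' ∉ T := by rcases hsel with h | h <;> rw [h.2] <;> assumption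
  have hX'P : X' ∉ P := by rcases hsel with h | h <;> rw [h.1] <;> assumption
  have hY'P : Y' ∉ P := by rcases hsel with h | h <;> rw [h.2] <;> assumption
  have hX'd : m.cell .deg X' = d := by rcases hsel with h | h <;> rw [h.1] <;> assumption
  have hY'd : m.cell .deg Y' = d := by rcases hsel with h | h <;> rw [h.2] <;> assumption
  have hPY : ∀ c ∈ P, c ≠ Y' := fun c hc h => hY'P (h ▸ hc)
  have hXY : X' ≠ Y' := by
    rcases hsel with ⟨rfl, rfl⟩ | ⟨rfl, rfl⟩
    · exact hYX.symm
    · exact hYX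
  have hl₁ : m₁.links = m.links := by simp [Mem.links, hcell, hnum]
  have hn₁ : m₁.reg .n = n := by rw [hreg _ (by simp) (by simp) (by simp), h.size]
  rw [hl₁, hx, hy, hn₁] at hlinks
  have F' := F.link hX'T hY'T hXY hX'p hY'p hkey (hX'd.trans hY'd.symm)
  have hpar : m₂.cell .parent = update (m.cell .parent) Y' X' := congrArg Links.par hlinks
  have hdeg : m₂.cell .deg = update (m.cell .deg) X' (d + 1) := by
    have : m₂.cell .deg = update (m.cell .deg) X' (m.cell .deg X' + 1) := congrArg Links.deg hlinks
    rw [this, hX'd]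
  have hmrk : m₂.cell .mark = update (m.cell .mark) Y' 0 := congrArg Links.mrk hlinks
  have hnxt : m₂.cell .nxt = update (m.cell .nxt) Y' (m.cell .child X') :=
    congrArg Links.nxt hlinks
  have htab : m₂.cell .table = update (m.cell .table) d n := by
    rw [hE.cell_eq rfl, hcell]; simp
  have hreg₂ : ∀ r, r ≠ .x → r ≠ .y → r ≠ .c → m₂.reg r = m.reg r := by
    intro r h1 h2 h3
    rw [← hreg r h1 h2 h3]
    exact hE.reg_eq (by simpa [SP.link, Com.setsReg] using h3)
  have hpar' : ∀ c, m₂.cell .parent c ∉ T → c ≠ Y' ∧ m.cell .parent c ∉ T := by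
    intro c hc
    have hcY : c ≠ Y' := by
      rintro rfl
      rw [hpar, update_self] at hc
      exact hc hX'T
    rw [hpar, update_of_ne hcY] at hc
    exact ⟨hcY, hc⟩
  refine ⟨⟨?_, ?_, ⟨_, hlinks ▸ F'⟩, ?_, h.nodup, ?_, ?_, ?_, ?_, ?_⟩, hX'T, ?_, hX'P, ?_, ?_, ?_,
    ?_⟩
  · rw [hreg₂ _ (by simp) (by simp) (by simp), h.size]
  · rw [hreg₂ _ (by simp) (by simp) (by simp), h.reg_v]
  · rw [hreg₂ _ (by simp) (by simp) (by simp), hnxt]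
    exact h.chain.congr fun c hc => update_of_ne (hPY c hc) _ _
  · intro c hc hcv
    rw [hpar, update_of_ne (hPY c hc)]
    exact h.pending c hc hcv
  · intro c hc hp
    obtain ⟨hcY, hp'⟩ := hpar' c hp
    obtain ⟨h1, h2, h3⟩ := h.root c hc hp'
    rw [hpar, hmrk, update_of_ne hcY, update_of_ne hcY]
    refine ⟨h1, h2, ?_⟩
    rcases eq_or_ne c X' with rfl | hcX
    · simp
    · rw [hdeg, update_of_ne hcX, htab]
      rcases h3 with h3 | h3 | h3
      · exact .inl h3
      · right; left
        rw [update_of_ne]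
        · exact h3
        · intro h4
          rw [h4, hY] at h3
          grind
      · grind
  · intro i hi hti
    rw [htab] at hti ⊢
    rcases eq_or_ne i d with rfl | hid
    · simp at hti
    · rw [update_of_ne hid] at hti ⊢
      obtain ⟨h1, h2, h3, h4, h5, h6⟩ := h.table i hi hti
      have h7 : m.cell .table i ≠ X' := fun h => hid (h3.symm.trans (h ▸ hX'd))
      have h8 : m.cell .table i ≠ Y' := fun h => hid (h3.symm.trans (h ▸ hY'd))
      rw [hpar, hdeg, update_of_ne h7, update_of_ne h8, hreg₂ _ (by simp) (by simp) (by simp)]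
      exact ⟨h1, h2, h3, h4, h7, h6⟩
  · rw [hreg₂ _ (by simp) (by simp) (by simp)]
    exact h.maxDeg
  · rw [hmrk]
    exact (sum_update_zero_le _ _ _).trans h.marks
  · rw [hpar, update_of_ne hXY]; exact hX'p
  · rw [hdeg, update_self]
  · rw [hE.reg_eq rfl, hx]
  · exact hreg₂ _ (by simp) (by simp) (by simp)
  · have : (T.filter fun c => m₂.cell .parent c ∉ T) =
        (T.filter fun c => m.cell .parent c ∉ T).erase Y' := by
      ext c
      simp only [Finset.mem_filter, Finset.mem_erase]
      constructor
      · rintro ⟨h1, h2⟩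
        exact ⟨(hpar' c h2).1, h1, (hpar' c h2).2⟩
      · rintro ⟨h1, h2, h3⟩
        refine ⟨h2, ?_⟩
        rwa [hpar, update_of_ne h1]
    rw [numRoots, this]
    exact Finset.card_erase_add_one (by simp [hY'T, hY'p])

/-- A round takes at most 17 steps and destroys a root, so `17 * numRoots` is the potential; the
last 1 is the failing test. -/
theorem Consolidating.runs_enterLoop {n : ℕ} {T : Finset ℕ} {v B : ℕ} (k : ℕ) : ∀ {m : Mem}
    {P : List ℕ} {X : ℕ}, numRoots T m ≤ k → Consolidating n T v B m (m.reg .nx) P X → X ∈ T →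
    m.cell .parent X ∉ T → X ∉ P → m.reg .x = X → m.reg .d = m.cell .deg X →
    Runs (loop (.ne (.cell .table .d) (.reg .n)) enterBody) m fun t m' =>
      ∃ X', Consolidating n T v B m' (m'.reg .nx) P X' ∧ X' ∈ T ∧ m'.cell .parent X' ∉ T ∧
        X' ∉ P ∧ m'.reg .x = X' ∧ m'.reg .d = m'.cell .deg X' ∧
        m'.cell .table (m'.reg .d) = n ∧
        t + 17 * numRoots T m' ≤ 17 * numRoots T m + 1 := by
  induction k with
  | zero =>
    intro m P X hk h hX hXp
    exfalso
    have : X ∈ T.filter fun c => m.cell .parent c ∉ T := by simp [hX, hXp]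
    rw [numRoots, Nat.le_zero, Finset.card_eq_zero] at hk
    rw [hk] at this
    simp at this
  | succ k ih =>
    intro m P X hk h hX hXp hXP hx hd
    by_cases hT : m.cell .table (m.reg .d) = n
    · exact runs_loop_of_not (by simp [hT, h.size]) ⟨X, h, hX, hXp, hXP, hx, hd, hT, by omega⟩
    · have step : ∀ X' Y' m₁ u, (X' = X ∧ Y' = m.cell .table (m.reg .d) ∨
            X' = m.cell .table (m.reg .d) ∧ Y' = X) →
          m.num .key X' ≤ m.num .key Y' →
          (∀ a, m₁.cell a = if a = .table then update (m.cell .table) (m.reg .d) n else m.cell a) →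
          m₁.num = m.num → (∀ r, r ≠ .x → r ≠ .y → r ≠ .c → m₁.reg r = m.reg r) →
          m₁.reg .x = X' → m₁.reg .y = Y' → u ≤ 6 →
          Runs (SP.link ;; inc .d) m₁ fun t₁ m₂ =>
            Runs (loop (.ne (.cell .table .d) (.reg .n)) enterBody) m₂ fun t₂ m' =>
            ∃ X', Consolidating n T v B m' (m'.reg .nx) P X' ∧ X' ∈ T ∧ m'.cell .parent X' ∉ T ∧
              X' ∉ P ∧ m'.reg .x = X' ∧ m'.reg .d = m'.cell .deg X' ∧
              m'.cell .table (m'.reg .d) = n ∧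
              1 + (u + t₁) + t₂ + 17 * numRoots T m' ≤ 17 * numRoots T m + 1 := by
        intro X' Y' m₁ u hsel hkey hcell hnum hreg hx₁ hy₁ hu
        refine runs_seq.2 ((runs_link m₁).mono ?_)
        rintro t₁ m₂ hE ⟨ht₁, hl⟩
        obtain ⟨h1, h2, h3, h4, h5, h6, h7, h8⟩ :=
          h.link hX hXp hXP hd.symm rfl hT hsel hkey hcell hnum hreg hx₁ hy₁ hE hl
        rw [runs_inc]
        refine (ih (m := m₂.setReg .d (m₂.reg .d + 1)) (P := P) (X := X') ?_ ?_ h2 h3 h4 ?_ ?_).mono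
          ?_
        · change numRoots T m₂ ≤ k
          omega
        · obtain ⟨g1, g2, g3, g4, g5, g6, g7, g8, g9, g10⟩ := h1
          exact ⟨by simpa using g1, by simpa using g2, g3, by simpa using g4, g5, g6, g7,
            by simpa using g8, by simpa using g9, g10⟩
        · simpa using h6
        · simp [h5, h7]
        · rintro t₂ m' - ⟨X'', k1, k2, k3, k4, k5, k6, k7, k8⟩
          refine ⟨X'', k1, k2, k3, k4, k5, k6, k7, ?_⟩
          change _ ≤ 17 * numRoots T m₂ + 1 at k8
          omega
      refine runs_loop_of (by simpa [h.size] using hT) ?_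
      simp only [enterBody, runs_seq (c₁ := mov _ _), runs_seq (c₁ := put _ _ _),
        runs_seq (c₁ := Com.cond _ _ _),
        runs_mov, runs_cond, runs_skip, runs_put, Test.holds, Word.eval, Num.eval,
        Mem.setReg_reg, Mem.setReg_cell, Mem.setReg_num, Mem.setCell_reg, Mem.setCell_num,
        if_true, reduceCtorEq, if_false, hx, h.size]
      split_ifs with hlt
      · refine (step _ _ _ 6 (.inr ⟨rfl, rfl⟩) hlt.le ?_ ?_ ?_ ?_ ?_ le_rfl).mono ?_
        · intro a; simp
        · simp
        · intro r h1 h2 h3; simp [h1, h2, h3]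
        · simp
        · simp
        · intro t₁ m₂ _ hr
          refine hr.mono ?_
          rintro t₂ m' - ⟨X', k1, k2, k3, k4, k5, k6, k7, k8⟩
          exact ⟨X', k1, k2, k3, k4, k5, k6, k7, by omega⟩
      · refine (step _ _ _ 4 (.inl ⟨rfl, rfl⟩) (not_lt.1 hlt) ?_ ?_ ?_ ?_ ?_ (by omega)).mono ?_
        · intro a; simp
        · simp
        · intro r h1 h2 h3; simp [h1, h2, h3]
        · simp [hx]
        · simp
        · intro t₁ m₂ _ hr
          refine hr.mono ?_
          rintro t₂ m' - ⟨X', k1, k2, k3, k4, k5, k6, k7, k8⟩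
          exact ⟨X', k1, k2, k3, k4, k5, k6, k7, by omega⟩

theorem Consolidating.runs_enterTable {n : ℕ} {T : Finset ℕ} {v B : ℕ} {m : Mem} {P : List ℕ}
    {X : ℕ} (h : Consolidating n T v B m (m.reg .nx) P X) (hX : X ∈ T)
    (hXp : m.cell .parent X ∉ T) (hXP : X ∉ P) (hx : m.reg .x = X) :
    Runs enterTable m fun t m' => Consolidating n T v B m' (m'.reg .nx) P n ∧
      t + 17 * numRoots T m' ≤ 17 * numRoots T m + 5 := by
  have hbody : enterTable =
    (mov .d (.cell .deg .x) ;;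
      loop (.ne (.cell .table .d) (.reg .n)) enterBody ;;
      put .table .d (.reg .x) ;;
      cond (.lt (.reg .maxDeg) (.reg .d)) (mov .maxDeg (.reg .d)) skip) := rfl
  rw [hbody, runs_seq, runs_mov, Word.eval, hx]
  refine runs_seq.2 ((Consolidating.runs_enterLoop (n := n) (T := T) (v := v) (B := B) _
    (m := m.setReg .d (m.cell .deg X)) (P := P) (X := X) le_rfl ?_ hX hXp hXP
    (by simpa using hx) (by simp)).mono ?_)
  · obtain ⟨g1, g2, g3, g4, g5, g6, g7, g8, g9, g10⟩ := h
    exact ⟨by simpa using g1, by simpa using g2, g3, by simpa using g4, g5, g6, g7,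
      by simpa using g8, by simpa using g9, g10⟩
  · rintro t m₁ hE ⟨Y, h1, hY, hYp, hYP, hx₁, hd₁, hT, ht⟩
    have hroots : numRoots T (m.setReg .d (m.cell .deg X)) = numRoots T m := rfl
    obtain ⟨ch, F⟩ := h1.forest
    have hYn : Y ≠ n := fun h => F.not_mem (h ▸ hY)
    -- Covers both outcomes of the update of `maxDeg`. The root in transit now sits in the table, so
    -- the null pointer takes its place.
    have key : ∀ m₂ : Mem, (∀ a, m₂.cell a = if a = .table then
          update (m₁.cell .table) (m₁.reg .d) Y else m₁.cell a) → m₂.num = m₁.num →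
        (∀ r, r ≠ .maxDeg → m₂.reg r = m₁.reg r) →
        m₂.reg .maxDeg = max (m₁.reg .maxDeg) (m₁.reg .d) →
        Consolidating n T v B m₂ (m₂.reg .nx) P n := by
      intro m₂ hc hnum hreg hmax
      have hl : m₂.links = m₁.links := by simp [Mem.links, hc, hnum]
      refine ⟨?_, ?_, ⟨ch, hl ▸ F⟩, ?_, h1.nodup, ?_, ?_, ?_, ?_, ?_⟩
      · rw [hreg _ (by simp), h1.size]
      · rw [hreg _ (by simp), h1.reg_v]
      · rw [hreg _ (by simp)]; simpa [hc] using h1.chain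
      · simpa [hc] using h1.pending
      · intro c hcT hp
        simp only [hc, reduceCtorEq, if_false, if_true] at hp ⊢
        obtain ⟨k1, k2, k3⟩ := h1.root c hcT hp
        refine ⟨k1, k2, ?_⟩
        rcases k3 with k3 | k3 | k3
        · exact .inl k3
        · right; left
          rw [update_apply]
          split_ifs with h4
          · rw [h4, hT] at k3
            exact absurd hcT (k3 ▸ F.not_mem)
          · exact k3
        · right; left
          rw [k3, ← hd₁, update_self]
      · intro i hi hti
        simp only [hc, reduceCtorEq, if_false, if_true, hmax] at hti ⊢
        rcases eq_or_ne i (m₁.reg .d) with rfl | hid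
        · simp only [update_self]
          exact ⟨hY, hYp, hd₁.symm, hYP, hYn, le_max_right _ _⟩
        · rw [update_of_ne hid] at hti ⊢
          obtain ⟨k1, k2, k3, k4, k5, k6⟩ := h1.table i hi hti
          exact ⟨k1, k2, k3, k4, hti, k6.trans (le_max_left _ _)⟩
      · have k1 : m₁.cell .deg Y < n := F.deg_lt hY
        have k2 : m₁.cell .deg Y ≤ 2 * Nat.log 2 n + 1 := F.deg_le hY
        rw [hmax, hd₁]
        exact ⟨max_lt h1.maxDeg.1 k1, max_le h1.maxDeg.2 k2⟩
      · simpa [hc] using h1.marks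
    simp only [runs_seq, runs_put, runs_cond, runs_mov, runs_skip, Test.holds, Word.eval,
      Mem.setCell_reg, hx₁]
    split_ifs with hlt
    · refine ⟨key _ (by simp) (by simp) (fun r hr => by simp [hr]) (by simp [hlt.le]), ?_⟩
      have : numRoots T ((m₁.setCell .table (m₁.reg .d) Y).setReg .maxDeg (m₁.reg .d)) =
        numRoots T m₁ := by simp [numRoots]
      omega
    · refine ⟨key _ (by simp) (by simp) (fun r hr => by simp) (by simp [not_lt.1 hlt]), ?_⟩
      have : numRoots T (m₁.setCell .table (m₁.reg .d) Y) = numRoots T m₁ := by simp [numRoots]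
      omega

/-- A null `X` says that no root is in transit between the list and the table. Apart from the links,
an entry of the list costs at most 10 steps. -/
theorem Consolidating.runs_loop {n : ℕ} {T : Finset ℕ} {v B : ℕ} (hv : v < n) (hvT : v ∉ T)
    (P : List ℕ) :
    ∀ {m : Mem}, Consolidating n T v B m (m.reg .x) P n →
    Runs (loop (.ne (.reg .x) (.reg .n))
      (mov .nx (.cell .nxt .x) ;;
       cond (.ne (.reg .x) (.reg .v)) enterTable skip ;;
       mov .x (.reg .nx))) m fun t m' =>
      (∃ a, Consolidating n T v B m' a [] n) ∧
      t + 17 * numRoots T m' ≤ 17 * numRoots T m + 10 * P.length + 1 := by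
  induction P with
  | nil =>
    intro m h
    have hx : m.reg .x = n := h.chain
    exact runs_loop_of_not (by simp [hx, h.size]) ⟨⟨_, h⟩, by simp [add_comm]⟩
  | cons c P ih =>
    intro m h
    obtain ⟨ch, F⟩ := h.forest
    obtain ⟨hx, hP⟩ := h.chain
    obtain ⟨hcP, hPd⟩ := List.nodup_cons.1 h.nodup
    have hcn : c ≠ n := by
      intro hcn
      by_cases hcv : c = v
      · omega
      · exact F.not_mem (hcn ▸ (h.pending c (by simp) hcv).1)
    refine runs_loop_of (by simp [hx, h.size, hcn]) ?_
    rw [runs_seq, runs_mov, runs_seq, runs_cond]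
    simp only [Test.holds, Word.eval, Mem.setReg_reg, if_true, reduceCtorEq, if_false, hx, h.reg_v,
      runs_skip, runs_mov]
    -- The rest of the loop once `c` is dealt with: `s` counts the steps of `enterTable`, `u` the
    -- others.
    have hfin : ∀ {m₁ : Mem} {u : ℕ}, Consolidating n T v B m₁ (m₁.reg .nx) P n → u ≤ 5 →
        ∀ s, s + 17 * numRoots T m₁ ≤ 17 * numRoots T m + 5 → 
        Runs (loop (.ne (.reg .x) (.reg .n))
          (mov .nx (.cell .nxt .x) ;;
          cond (.ne (.reg .x) (.reg .v)) enterTable skip ;;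
          mov .x (.reg .nx))) (m₁.setReg .x (m₁.reg .nx)) fun t m' =>
          (∃ a, Consolidating n T v B m' a [] n) ∧
          u + s + t + 17 * numRoots T m' ≤ 17 * numRoots T m + 10 * (c :: P).length + 1 := by
      intro m₁ u h1 hu s hs
      refine (ih (m := m₁.setReg .x (m₁.reg .nx)) ?_).mono ?_
      · obtain ⟨g1, g2, g3, g4, g5, g6, g7, g8, g9, g10⟩ := h1
        exact ⟨by simpa using g1, by simpa using g2, g3, by simpa using g4, g5, g6, g7,
          by simpa using g8, by simpa using g9, g10⟩
      · rintro t m' - ⟨h2, h3⟩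
        refine ⟨h2, ?_⟩
        change _ ≤ 17 * numRoots T m₁ + _ + 1 at h3
        rw [List.length_cons]
        omega
    by_cases hcv : c = v
    · rw [if_neg (by simpa using hcv)]
      refine (hfin (m₁ := m.setReg .nx (m.cell .nxt c)) (u := 5) ?_ le_rfl 0 ?_).mono ?_
      · obtain ⟨g1, g2, g3, g4, g5, g6, g7, g8, g9, g10⟩ := h
        refine ⟨by simpa using g1, by simpa using g2, g3, by simpa using hP, hPd,
          fun d hd => g6 d (by simp [hd]), ?_, ?_, by simpa using g9, g10⟩
        · intro d hd hp
          obtain ⟨k1, k2, k3⟩ := g7 d hd hp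
          refine ⟨k1, k2, k3.imp_left fun k3 => ?_⟩
          rcases List.mem_cons.1 k3 with k3 | k3
          · exact absurd hd (k3.trans hcv ▸ hvT)
          · exact k3
        · intro d hd hp
          obtain ⟨k1, k2, k3, k4, k5, k6⟩ := g8 d hd hp
          exact ⟨k1, k2, k3, fun h => k4 (List.mem_cons_of_mem _ h), k5, by simpa using k6⟩
      · change 0 + 17 * numRoots T m ≤ _
        omega
      · rintro t m' - ⟨h2, h3⟩
        exact ⟨h2, by omega⟩
    · rw [if_pos hcv]
      obtain ⟨hcT, hcp⟩ := h.pending c (by simp) hcv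
      refine (Consolidating.runs_enterTable (n := n) (T := T) (v := v) (B := B)
        (m := m.setReg .nx (m.cell .nxt c)) (P := P) (X := c) ?_ hcT hcp hcP
        (by simpa using hx)).mono ?_
      · obtain ⟨g1, g2, g3, g4, g5, g6, g7, g8, g9, g10⟩ := h
        refine ⟨by simpa using g1, by simpa using g2, g3, by simpa using hP, hPd,
          fun d hd => g6 d (by simp [hd]), ?_, ?_, by simpa using g9, g10⟩
        · intro d hd hp
          obtain ⟨k1, k2, k3⟩ := g7 d hd hp
          refine ⟨k1, k2, ?_⟩
          rw [List.mem_cons] at k3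
          have : d ≠ n := fun h => F.not_mem (h ▸ hd)
          simp only [Mem.setReg_cell]
          tauto
        · intro d hd hp
          obtain ⟨k1, k2, k3, k4, k5, k6⟩ := g8 d hd hp
          simp only [List.mem_cons, not_or] at k4
          exact ⟨k1, k2, k3, k4.2, k4.1, by simpa using k6⟩
      · rintro t₁ m₁ - ⟨h1, h2⟩
        refine (hfin (u := 4) h1 (by omega) t₁ h2).mono ?_
        rintro t m' - ⟨h3, h4⟩
        exact ⟨h3, by omega⟩

/-! ### Rebuilding the list of roots -/

/-- The state while `table` is emptied, at degree `d`. -/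
structure Rebuilding (n : ℕ) (T : Finset ℕ) (B : ℕ) (m : Mem) (d : ℕ) (rt : List ℕ) : Prop where
  size : m.reg .n = n
  forest : ∃ ch, Forest n T m.links ch n n
  chain : Chain n (m.cell .nxt) (m.reg .roots) rt
  nodup : rt.Nodup
  -- One root per degree: this makes the final number of roots logarithmic.
  length : rt.length ≤ d
  root : ∀ c ∈ rt, c ∈ T ∧ m.cell .parent c = n ∧ m.cell .mark c = 0 ∧ m.cell .deg c < d
  mem : ∀ c ∈ T, m.cell .parent c ∉ T →
    c ∈ rt ∨ m.cell .table (m.cell .deg c) = c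
  table : ∀ i < n, m.cell .table i ≠ n → m.cell .table i ∈ T ∧
    m.cell .parent (m.cell .table i) ∉ T ∧ m.cell .deg (m.cell .table i) = i ∧
    d ≤ i ∧ i ≤ m.reg .maxDeg
  hmin : rt = [] ∧ m.reg .hmin = n ∨
    m.reg .hmin ∈ rt ∧ ∀ c ∈ rt, m.num .key (m.reg .hmin) ≤ m.num .key c
  marks : ∑ c ∈ T, m.cell .mark c ≤ B

/-- The body of the loop in `rebuildRoots`. -/
def rebuildBody : Com :=
  mov .x (.cell .table .d) ;;
  cond (.ne (.reg .x) (.reg .n))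
    (put .table .d (.reg .n) ;; pushRoot .x ;; updateMin .x)
    skip ;;
  inc .d

theorem Rebuilding.runs_body {n : ℕ} {T : Finset ℕ} {B : ℕ} {m : Mem} {rt : List ℕ}
    (h : Rebuilding n T B m (m.reg .d) rt) (hd : m.reg .d < n) :
    Runs rebuildBody m fun t m' => t ≤ 11 ∧ m'.reg .d = m.reg .d + 1 ∧
      ∃ rt', Rebuilding n T B m' (m'.reg .d) rt' := by
  obtain ⟨ch, F⟩ := h.forest
  have hn := h.size
  by_cases hT : m.cell .table (m.reg .d) = n
  · simp only [rebuildBody, runs_seq, runs_mov, runs_cond, runs_skip, runs_inc, Test.holds, Word.eval,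
      Mem.setReg_reg, if_true, reduceCtorEq, if_false, hn, hT, ne_eq, not_true_eq_false]
    refine ⟨by omega, trivial, rt, by simp [hn], ⟨ch, F⟩, by simpa using h.chain, h.nodup, ?_, ?_,
      h.mem, ?_, by simpa using h.hmin, h.marks⟩
    · exact h.length.trans (Nat.le_succ _)
    · intro c hc
      obtain ⟨k1, k2, k3, k4⟩ := h.root c hc
      exact ⟨k1, k2, k3, k4.trans (Nat.lt_succ_self _)⟩
    · intro i hi hti
      obtain ⟨k1, k2, k3, k4, k5⟩ := h.table i hi hti
      refine ⟨k1, k2, k3, ?_, by simpa using k5⟩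
      rcases k4.eq_or_lt with k4 | k4
      · rw [← k4] at hti; exact absurd hT hti
      · exact k4
  · obtain ⟨hxT, hxp, hxd, -, hdm⟩ := h.table _ hd hT
    obtain ⟨x, hx⟩ : ∃ x, m.cell .table (m.reg .d) = x := ⟨_, rfl⟩
    rw [hx] at hT hxT hxp hxd
    have hxrt : ∀ c ∈ rt, c ≠ x := by
      rintro c hc rfl
      have := (h.root c hc).2.2.2
      omega
    simp only [rebuildBody, SP.pushRoot, runs_seq, runs_mov, runs_cond, runs_put, runs_inc,
      Test.holds, Word.eval, Mem.setReg_reg, Mem.setReg_cell, Mem.setCell_reg, Mem.setCell_cell,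
      if_true, reduceCtorEq, if_false, hn, hx, hT, ne_eq, not_false_eq_true]
    apply SP.runs_updateMin
    intro t ht b hb
    simp only [Mem.setReg_reg, Mem.setCell_reg, Mem.setReg_num, Mem.setCell_num, if_true,
      reduceCtorEq, if_false, hn] at hb
    refine ⟨by omega, by simp, x :: rt, by simp [hn], ⟨ch, ?_⟩, ⟨by simp, ?_⟩, ?_, ?_, ?_, ?_, ?_, ?_,
      ?_⟩
    · simpa [Mem.links] using F.pushRoot (a := m.reg .roots) hxT hxp
    · simp only [Mem.setReg_cell, Mem.setCell_cell, if_true, reduceCtorEq, if_false, update_self]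
      exact h.chain.congr fun c hc => by simp [hxrt c hc]
    · exact List.nodup_cons.2 ⟨fun h => hxrt _ h rfl, h.nodup⟩
    · simpa using h.length
    · intro c hc
      rcases List.mem_cons.1 hc with rfl | hc
      · simp [hxT, hxd]
      · obtain ⟨k1, k2, k3, k4⟩ := h.root c hc
        simp [hxrt c hc, k1, k2, k3]
        omega
    · intro c hc hp
      rcases eq_or_ne c x with rfl | hcx
      · simp
      · simp only [Mem.setReg_cell, Mem.setCell_cell, if_true, reduceCtorEq, if_false,
          update_of_ne hcx] at hp ⊢
        rcases h.mem c hc hp with k1 | k1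
        · exact .inl (List.mem_cons_of_mem _ k1)
        · right
          rw [update_of_ne]
          · exact k1
          · intro k2
            rw [k2, hx] at k1
            exact hcx k1.symm
    · intro i hi hti
      simp only [Mem.setReg_cell, Mem.setCell_cell, if_true, reduceCtorEq, if_false,
        Mem.setReg_reg, Mem.setCell_reg] at hti ⊢
      rcases eq_or_ne i (m.reg .d) with rfl | hid
      · simp at hti
      · rw [update_of_ne hid] at hti ⊢
        obtain ⟨k1, k2, k3, k4, k5⟩ := h.table i hi hti
        have k6 : m.cell .table i ≠ x := fun h => hid (k3.symm.trans (h ▸ hxd))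
        rw [update_of_ne k6]
        exact ⟨k1, k2, k3, by omega, k5⟩
    · right
      simp only [Mem.setReg_reg, Mem.setReg_num, Mem.setCell_num, if_true, reduceCtorEq, if_false]
      rcases hb with ⟨rfl, hb⟩ | ⟨rfl, hb, hb'⟩
      · refine ⟨by simp, fun c hc => ?_⟩
        rcases List.mem_cons.1 hc with rfl | hc
        · exact le_rfl
        · rcases h.hmin with k1 | k1
          · rw [k1.1] at hc; simp at hc
          · rcases hb with hb | hb
            · exact absurd (h.root _ k1.1).1 (hb ▸ F.not_mem)
            · exact hb.le.trans (k1.2 c hc)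
      · rcases h.hmin with k1 | k1
        · exact absurd k1.2 hb
        · refine ⟨List.mem_cons_of_mem _ k1.1, fun c hc => ?_⟩
          rcases List.mem_cons.1 hc with rfl | hc
          · exact hb'
          · exact k1.2 c hc
    · simp only [Mem.setReg_cell, Mem.setCell_cell, if_true, reduceCtorEq, if_false]
      exact (sum_update_zero_le _ _ _).trans h.marks

theorem Rebuilding.runs_loop {n : ℕ} {T : Finset ℕ} {B : ℕ} (k : ℕ) : ∀ {m : Mem} {rt : List ℕ},
    m.reg .d + k = m.reg .maxDeg + 1 → m.reg .maxDeg < n → Rebuilding n T B m (m.reg .d) rt →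
    Runs (loop (.le (.reg .d) (.reg .maxDeg)) rebuildBody) m fun t m' => t ≤ 12 * k + 1 ∧
      ∃ rt', Rebuilding n T B m' (m.reg .maxDeg + 1) rt' := by
  induction k with
  | zero =>
    intro m rt hk hn h
    refine runs_loop_of_not (by simp; omega) ⟨by omega, rt, ?_⟩
    rwa [← hk]
  | succ k ih =>
    intro m rt hk hn h
    refine runs_loop_of (by simp; omega) ((h.runs_body (by omega)).mono ?_)
    rintro t₁ m₁ hE ⟨h1, h2, rt₁, h3⟩
    have hm : m₁.reg .maxDeg = m.reg .maxDeg := hE.reg_eq rfl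
    refine (ih (m := m₁) (by omega) (by omega) h3).mono ?_
    rintro t₂ m' - ⟨h4, h5⟩
    rw [hm] at h5
    exact ⟨by omega, h5⟩

/-- An old root costs at most 10 + 17 steps, paid by its share 40 of the potential. The children of
the minimum, the scan of the table up to `maxDeg` and the at most `maxDeg + 1` new roots are
logarithmic in number, and marks only disappear. -/
theorem Heap.runs_removeMin {n : ℕ} {S : Finset ℕ} {m : Mem} {rt : List ℕ} (h : Heap n S m rt)
    (hS : S.Nonempty) :
    Runs (mov .v (.reg .hmin) ;; promoteChildren ;; consolidate ;; rebuildRoots ;;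
      put .inH .v (.lit 0)) m fun t m' => m'.reg .v ∈ S ∧ ∃ rt',
      Heap n (S.erase (m'.reg .v)) m' rt' ∧
      t + 40 * potential (S.erase (m'.reg .v)) m' rt' ≤
        40 * potential S m rt + 300 * (Nat.log 2 n + 1) := by
  obtain ⟨ch, F⟩ := h.forest
  have hn := h.size
  have hvrt := (h.hmin_le hS).1
  obtain ⟨v, hv⟩ : ∃ v, m.reg .hmin = v := ⟨_, rfl⟩
  rw [hv] at hvrt
  obtain ⟨hvS, hvp⟩ := (h.mem v).1 hvrt
  have hvn := F.lt v hvS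
  have hvT : v ∉ S.erase v := by simp
  have hdeg : m.cell .deg v ≤ 2 * Nat.log 2 n + 1 := F.deg_le hvS
  have hdegL : m.cell .deg v = (ch v).length := F.deg v hvS
  rw [runs_seq, runs_mov, Word.eval, hv, runs_seq, promoteChildren, runs_seq, runs_mov]
  simp only [Word.eval, Mem.setReg_reg, Mem.setReg_cell, if_true]
  refine (Promoting.runs (n := n) (T := S.erase v) (v := v) (B := ∑ c ∈ S, m.cell .mark c)
    (m := (m.setReg .v v).setReg .x (m.cell .child v)) (L := ch v) (rt := rt)
    ⟨by simp [hn], ⟨ch, F.erase hvp⟩, by simpa using h.chain, h.nodup,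
      by simpa [Mem.links] using (F.list v hvS).chain, F.nodup v hvS, ?_, ?_, ?_, ?_⟩).mono ?_
  · intro c hc
    obtain ⟨k1, k2⟩ := (F.mem v hvS c).1 hc
    have k2 : m.cell .parent c = v := k2
    refine ⟨Finset.mem_erase.2 ⟨?_, k1⟩, ?_, ?_⟩
    · rintro rfl; exact F.par_ne hvS k2
    · change m.cell .parent c ∉ _; rw [k2]; exact hvT
    · intro k3
      exact ((h.mem c).1 k3).2 (k2 ▸ hvS)
  · intro c hc hcv
    exact ⟨Finset.mem_erase.2 ⟨hcv, ((h.mem c).1 hc).1⟩, h.root c hc⟩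
  · intro c hc hp
    change m.cell .parent c ∉ _ at hp
    by_cases k1 : m.cell .parent c ∈ S
    · left
      refine (F.mem v hvS c).2 ⟨Finset.mem_of_mem_erase hc, ?_⟩
      by_contra k2
      exact hp (Finset.mem_erase.2 ⟨k2, k1⟩)
    · exact .inr ((h.mem c).2 ⟨Finset.mem_of_mem_erase hc, k1⟩)
  · exact Finset.sum_le_sum_of_subset (Finset.erase_subset _ _)
  rintro t₁ m₁ hE₁ ⟨ht₁, rt₁, hrt₁, h₁⟩
  have htab₁ : m₁.cell .table = m.cell .table := by rw [hE₁.cell_eq rfl]; simp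
  have hv₁ : m₁.reg .v = v := by rw [hE₁.reg_eq rfl]; simp
  rw [runs_seq, consolidate, runs_seq, runs_mov, runs_seq, runs_mov]
  simp only [Word.eval, Mem.setReg_reg, reduceCtorEq, if_false]
  obtain ⟨m₂, hm₂⟩ : ∃ m₂, (m₁.setReg .maxDeg 0).setReg .x (m₁.reg .roots) = m₂ := ⟨_, rfl⟩
  have hc₂ : Consolidating n (S.erase v) v (∑ c ∈ S, m.cell .mark c) m₂ (m₂.reg .x) rt₁ n := by
    subst hm₂
    refine ⟨by simp [h₁.size], by simp [hv₁], h₁.forest, by simpa using h₁.chain, h₁.nodup,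
      ?_, ?_, ?_, by simp; omega, h₁.marks⟩
    · intro c hc hcv
      obtain ⟨k1, k2, -⟩ := h₁.root c hc hcv
      refine ⟨k1, ?_⟩
      change m₁.cell .parent c ∉ _
      rw [k2]
      exact fun h => F.not_mem (Finset.mem_of_mem_erase h)
    · intro c hc hp
      rcases h₁.mem c hc hp with k1 | k1
      · simp at k1
      · have := h₁.root c k1 (fun h => hvT (h ▸ hc))
        exact ⟨this.2.1, this.2.2, .inl k1⟩
    · intro d hd hd'
      exact absurd (h.table d hd) (by simpa [htab₁] using hd')
  have hroots : numRoots (S.erase v) m₂ ≤ rt₁.length := by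
    rw [← List.toFinset_card_of_nodup h₁.nodup]
    refine Finset.card_le_card fun c hc => ?_
    obtain ⟨k1, k2⟩ := Finset.mem_filter.1 hc
    subst hm₂
    rcases h₁.mem c k1 k2 with k3 | k3
    · simp at k3
    · exact List.mem_toFinset.2 k3
  rw [hm₂]
  refine (Consolidating.runs_loop hvn hvT rt₁ hc₂).mono ?_
  rintro t₂ m₃ hE₃ ⟨⟨a, h₃⟩, ht₂⟩
  rw [runs_seq, rebuildRoots, runs_seq, runs_mov, runs_seq, runs_mov, runs_seq, runs_mov]
  simp only [Word.eval, Mem.setReg_reg, reduceCtorEq, if_false, h₃.size]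
  obtain ⟨m₄, hm₄⟩ : ∃ m₄, ((m₃.setReg .roots n).setReg .hmin n).setReg .d 0 = m₄ := ⟨_, rfl⟩
  have h₄ : Rebuilding n (S.erase v) (∑ c ∈ S, m.cell .mark c) m₄ (m₄.reg .d) [] := by
    subst hm₄
    obtain ⟨ch₃, F₃⟩ := h₃.forest
    refine ⟨by simp [h₃.size], ⟨ch₃, F₃⟩, by simp [Chain], by simp, by simp, by simp, ?_, ?_,
      by simp, h₃.marks⟩
    · intro c hc hp
      obtain ⟨-, -, k3⟩ := h₃.root c hc hp
      rcases k3 with k3 | k3 | k3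
      · simp at k3
      · exact .inr k3
      · exact absurd hc (k3 ▸ F₃.not_mem)
    · intro i hi hti
      obtain ⟨k1, k2, k3, -, -, k4⟩ := h₃.table i hi hti
      exact ⟨k1, k2, k3, by simp, by simpa using k4⟩
  have hmax : m₄.reg .maxDeg = m₃.reg .maxDeg := by subst hm₄; simp
  have hd₄ : m₄.reg .d = 0 := by subst hm₄; simp
  have hmaxDeg := h₃.maxDeg
  rw [hm₄]
  refine (Rebuilding.runs_loop (m₃.reg .maxDeg + 1) (by omega) (by omega) h₄).mono ?_
  rintro t₃ m₅ hE₅ ⟨ht₃, rt₅, h₅⟩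
  rw [hmax] at h₅
  have hfr : ∀ {a : Arr}, a = .inH → m₅.cell a = m.cell a := by
    rintro a rfl
    rw [hE₅.cell_eq rfl, ← hm₄]
    change m₃.cell _ = _
    rw [hE₃.cell_eq rfl, ← hm₂]
    change m₁.cell _ = _
    rw [hE₁.cell_eq rfl]
    rfl
  have hnum : m₅.num = m.num := by
    funext a
    rw [hE₅.num_eq (by cases a <;> rfl), ← hm₄]
    change m₃.num _ = _
    rw [hE₃.num_eq (by cases a <;> rfl), ← hm₂]
    change m₁.num _ = _
    rw [hE₁.num_eq (by cases a <;> rfl)]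
    rfl
  have hv₅ : m₅.reg .v = v := by
    rw [hE₅.reg_eq rfl, ← hm₄]
    exact h₃.reg_v
  obtain ⟨ch₅, F₅⟩ := h₅.forest
  simp only [runs_put, Word.eval, hv₅, Mem.setCell_reg]
  -- A remaining entry would have degree above `maxDeg` and at most `maxDeg`.
  have htab₅ : ∀ i < n, m₅.cell .table i = n := by
    intro i hi
    by_contra k
    obtain ⟨-, -, -, k1, k2⟩ := h₅.table i hi k
    rw [hE₅.reg_eq rfl, hmax] at k2
    omega
  have hmem : ∀ c ∈ S.erase v, m₅.cell .parent c ∉ S.erase v → c ∈ rt₅ := by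
    intro c hc hp
    refine (h₅.mem c hc hp).resolve_right fun k => ?_
    have hlt : m₅.cell .deg c < n := F₅.deg_lt hc
    rw [htab₅ _ hlt] at k
    exact F₅.not_mem (k ▸ hc)
  refine ⟨hvS, rt₅, ⟨⟨by simp [h₅.size], by simpa using h₅.chain, h₅.nodup, ?_, ?_⟩,
    ⟨ch₅, by simpa [Mem.links] using F₅⟩, ?_, ?_, by simpa using htab₅, ?_⟩, ?_⟩
  · intro c
    simp only [Mem.setCell_cell, reduceCtorEq, if_false]
    refine ⟨fun hc => ?_, fun hc => hmem c hc.1 hc.2⟩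
    obtain ⟨k1, k2, -⟩ := h₅.root c hc
    exact ⟨k1, by rw [k2]; exact F₅.not_mem⟩
  · intro c hc
    obtain ⟨-, k2, k3, -⟩ := h₅.root c hc
    simp [k2, k3]
  · rcases h₅.hmin with k1 | k1
    · left
      refine ⟨?_, by simpa using k1.2⟩
      by_contra hne
      obtain ⟨c, hc, hp⟩ := F₅.exists_root (Finset.nonempty_iff_ne_empty.2 hne)
      have := hmem c hc hp
      rw [k1.1] at this
      simp at this
    · exact .inr (by simpa using k1)
  · intro u hu
    simp only [Mem.setCell_cell, if_true, hfr]
    rcases eq_or_ne u v with rfl | huv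
    · simp
    · simp [huv, h.inH u hu]
  · intro u hu
    simp only [Mem.setCell_num, hnum]
    exact h.key u (Finset.mem_of_mem_erase hu)
  · have k1 := h₅.marks
    have k2 := h₅.length
    simp only [potential, Mem.setCell_cell, reduceCtorEq, if_false]
    omega

/-! ### Exploring the graph -/

/-- Adjacency lists. -/
structure AdjLists where
  first : ℕ → ℕ
  last : ℕ → ℕ
  tgt : ℕ → ℕ

/-- The adjacency lists in the memory. -/
def Mem.adj (m : Mem) : AdjLists := ⟨m.cell .first, m.cell .last, m.cell .tgt⟩

/-- The out-degree of `u`. -/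
def AdjLists.out (A : AdjLists) (u : ℕ) : ℕ := A.last u - A.first u

/-- The number of positions in `[j, l)` with an edge to `k`. -/
def AdjLists.count (A : AdjLists) (j l k : ℕ) : ℕ := ((Finset.Ico j l).filter (A.tgt · = k)).card

/-- The number of edges from `u` to `k`. -/
def AdjLists.mult (A : AdjLists) (u k : ℕ) : ℕ := A.count (A.first u) (A.last u) k

/-- All edges lead to vertices. -/
def AdjLists.Valid (A : AdjLists) (n : ℕ) : Prop :=
  ∀ u < n, ∀ p ∈ Finset.Ico (A.first u) (A.last u), A.tgt p < n

theorem AdjLists.count_left (A : AdjLists) {j l : ℕ} (hjl : j < l) (k : ℕ) :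
    A.count j l k = (if A.tgt j = k then 1 else 0) + A.count (j + 1) l k := by
  rw [AdjLists.count, ← Finset.insert_Ico_add_one_left_eq_Ico hjl, Finset.filter_insert]
  split_ifs with h
  · rw [Finset.card_insert_of_notMem (by simp), AdjLists.count, add_comm]
  · rw [AdjLists.count, zero_add]

@[simp] theorem AdjLists.count_self (A : AdjLists) (j k : ℕ) : A.count j j k = 0 := by
  simp [AdjLists.count]

/-- The state of the inner loop: the vertices in `X` have been explored, up to the positions
`[j, l)` of the last one of them; those in the queue `R` are fixed, but not yet explored.  The
arrays `D₀` and `f₀` are earlier values of `D` and `fixed`. -/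
structure Exploring (n : ℕ) (A : AdjLists) (P : Prop) (D₀ : ℕ → WithTop ℝ) (f₀ : ℕ → ℕ) (m : Mem)
    (X : Finset ℕ) (j l : ℕ) : Prop where
  adj : m.adj = A
  queue : ∀ p ∈ Finset.Ico (m.reg .rHead) (m.reg .rTail),
    m.cell .R p < n ∧ m.cell .fixed (m.cell .R p) ≠ 0 ∧ m.cell .R p ∉ X
  inj : ∀ p ∈ Finset.Ico (m.reg .rHead) (m.reg .rTail),
    ∀ q ∈ Finset.Ico (m.reg .rHead) (m.reg .rTail), m.cell .R p = m.cell .R q → p = q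
  explored : ∀ u ∈ X, u < n ∧ m.cell .fixed u ≠ 0
  le : m.reg .rHead ≤ m.reg .rTail
  cover : ∀ u < n, m.cell .fixed u ≠ 0 →
    u ∈ X ∨ ∃ p ∈ Finset.Ico (m.reg .rHead) (m.reg .rTail), m.cell .R p = u
  -- The edges into `k` not yet examined: those out of unexplored vertices and the rest of the
  -- current list.
  pred : ∀ k < n, m.cell .fixed k = 0 →
    m.cell .pred k = ∑ u ∈ Finset.range n \ X, A.mult u k + A.count j l k
  -- `P` switches the acyclic case on: it is `True` there and `False` for the general bound.
  pos : P → ∀ k < n, m.cell .fixed k = 0 → m.cell .pred k ≠ 0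
  q : ∀ p < m.reg .qTail, m.cell .Q p < n
  dist : ∀ u, m.num .D u ≤ D₀ u
  fixed : ∀ u, f₀ u ≠ 0 → m.cell .fixed u ≠ 0

namespace Exploring

variable {n : ℕ} {A : AdjLists} {P : Prop} {D₀ : ℕ → WithTop ℝ} {f₀ : ℕ → ℕ} {m m' : Mem}
  {X : Finset ℕ} {j l : ℕ}

theorem skip (h : Exploring n A P D₀ f₀ m X j l) (hjl : j < l)
    (hk : m.cell .fixed (A.tgt j) ≠ 0) : Exploring n A P D₀ f₀ m X (j + 1) l := by
  refine { h with pred := fun k hk' hf => ?_ }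
  have : A.tgt j ≠ k := by rintro rfl; exact hk hf
  rw [h.pred k hk' hf, A.count_left hjl, if_neg this, zero_add]

theorem relax (h : Exploring n A P D₀ f₀ m X j l) (hjl : j < l)
    (hadj : m'.adj = m.adj) (hR : m'.cell .R = m.cell .R)
    (hfixed : m'.cell .fixed = m.cell .fixed) (hHead : m'.reg .rHead = m.reg .rHead)
    (hTail : m'.reg .rTail = m.reg .rTail)
    (hpred : m'.cell .pred = update (m.cell .pred) (A.tgt j) (m.cell .pred (A.tgt j) - 1))
    (hpos : m'.cell .pred (A.tgt j) ≠ 0) (hq : ∀ p < m'.reg .qTail, m'.cell .Q p < n)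
    (hD : ∀ u, m'.num .D u ≤ m.num .D u) : Exploring n A P D₀ f₀ m' X (j + 1) l := by
  refine ⟨hadj.trans h.adj, ?_, ?_, ?_, ?_, ?_, ?_, ?_, hq, fun u => (hD u).trans (h.dist u), ?_⟩
  · rw [hR, hfixed, hHead, hTail]; exact h.queue
  · rw [hR, hHead, hTail]; exact h.inj
  · rw [hfixed]; exact h.explored
  · rw [hHead, hTail]; exact h.le
  · rw [hR, hfixed, hHead, hTail]; exact h.cover
  · intro k hk' hf'
    rw [hfixed] at hf'
    have h1 := h.pred k hk' hf'
    rw [A.count_left hjl] at h1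
    rcases eq_or_ne k (A.tgt j) with rfl | hkj
    -- The count includes the edge at `j`, so the truncated subtraction of 1 is exact.
    · rw [if_pos rfl] at h1
      rw [hpred, update_self]
      omega
    · rw [if_neg hkj.symm] at h1
      rw [hpred, update_of_ne hkj]
      omega
  · intro hP k hk' hf'
    rcases eq_or_ne k (A.tgt j) with rfl | hkj
    · exact hpos
    · rw [hpred, update_of_ne hkj]
      rw [hfixed] at hf'
      exact h.pos hP k hk' hf'
  · rw [hfixed]; exact h.fixed

/-- A vertex whose counter reaches 0 is fixed at once, and `pred` and `pos` speak only of non-fixed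
vertices; so `pos` survives. -/
theorem fix (h : Exploring n A P D₀ f₀ m X j l) (hjl : j < l) (hk : A.tgt j < n)
    (hf : m.cell .fixed (A.tgt j) = 0) (hadj : m'.adj = m.adj)
    (hR : m'.cell .R = update (m.cell .R) (m.reg .rTail) (A.tgt j))
    (hfixed : m'.cell .fixed = update (m.cell .fixed) (A.tgt j) 1)
    (hHead : m'.reg .rHead = m.reg .rHead) (hTail : m'.reg .rTail = m.reg .rTail + 1)
    (hpred : ∀ k ≠ A.tgt j, m'.cell .pred k = m.cell .pred k)
    (hq : ∀ p < m'.reg .qTail, m'.cell .Q p < n)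
    (hD : ∀ u, m'.num .D u ≤ m.num .D u) : Exploring n A P D₀ f₀ m' X (j + 1) l := by
  have hfx : ∀ u, m.cell .fixed u ≠ 0 → u ≠ A.tgt j ∧ m'.cell .fixed u ≠ 0 := by
    intro u hu
    have : u ≠ A.tgt j := by rintro rfl; exact hu hf
    rw [hfixed, update_of_ne this]
    exact ⟨this, hu⟩
  have hunf : ∀ u, m'.cell .fixed u = 0 → u ≠ A.tgt j ∧ m.cell .fixed u = 0 := by
    intro u hu
    have : u ≠ A.tgt j := by rintro rfl; simp [hfixed] at hu
    rw [hfixed, update_of_ne this] at hu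
    exact ⟨this, hu⟩
  have hfk : m'.cell .fixed (A.tgt j) ≠ 0 := by simp [hfixed]
  have hmem : ∀ p ∈ Finset.Ico (m'.reg .rHead) (m'.reg .rTail),
      p = m.reg .rTail ∧ m'.cell .R p = A.tgt j ∨
      p ∈ Finset.Ico (m.reg .rHead) (m.reg .rTail) ∧ m'.cell .R p = m.cell .R p := by
    intro p hp
    rw [hHead, hTail, Finset.mem_Ico] at hp
    rcases eq_or_ne p (m.reg .rTail) with rfl | hpt
    · left; simp [hR]
    · right
      rw [hR, update_of_ne hpt]
      exact ⟨Finset.mem_Ico.2 (by omega), rfl⟩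
  refine ⟨hadj.trans h.adj, ?_, ?_, ?_, ?_, ?_, ?_, ?_, hq, fun u => (hD u).trans (h.dist u), ?_⟩
  · intro p hp
    rcases hmem p hp with ⟨rfl, h1⟩ | ⟨h1, h2⟩
    · rw [h1]
      exact ⟨hk, hfk, fun hX => (h.explored _ hX).2 hf⟩
    · obtain ⟨k1, k2, k3⟩ := h.queue p h1
      rw [h2]
      exact ⟨k1, (hfx _ k2).2, k3⟩
  -- The new entry was not fixed before, unlike all earlier entries of the queue, so it is not a
  -- repetition.
  · intro p hp q hq hpq
    rcases hmem p hp with ⟨rfl, h1⟩ | ⟨h1, h2⟩ <;> rcases hmem q hq with ⟨rfl, h3⟩ | ⟨h3, h4⟩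
    · rfl
    · rw [h1, h4] at hpq
      exact absurd hpq.symm (hfx _ (h.queue q h3).2.1).1
    · rw [h2, h3] at hpq
      exact absurd hpq (hfx _ (h.queue p h1).2.1).1
    · exact h.inj p h1 q h3 (by rw [← h2, ← h4, hpq])
  · intro u hu
    obtain ⟨k1, k2⟩ := h.explored u hu
    exact ⟨k1, (hfx u k2).2⟩
  · have := h.le
    omega
  · intro u hu hfu
    rcases eq_or_ne u (A.tgt j) with rfl | huj
    · refine .inr ⟨m.reg .rTail, ?_, by simp [hR]⟩
      have := h.le
      rw [hHead, hTail, Finset.mem_Ico]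
      omega
    · rw [hfixed, update_of_ne huj] at hfu
      refine (h.cover u hu hfu).imp_right ?_
      rintro ⟨p, hp, hpu⟩
      rw [Finset.mem_Ico] at hp
      refine ⟨p, ?_, ?_⟩
      · rw [hHead, hTail, Finset.mem_Ico]; omega
      · rw [hR, update_of_ne (by omega)]; exact hpu
  · intro k hk' hf'
    obtain ⟨h1, h2⟩ := hunf k hf'
    rw [hpred k h1, h.pred k hk' h2, A.count_left hjl, if_neg h1.symm, zero_add]
  · intro hP k hk' hf'
    obtain ⟨h1, h2⟩ := hunf k hf'
    rw [hpred k h1]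
    exact h.pos hP k hk' h2
  · exact fun u hu => (hfx u (h.fixed u hu)).2

theorem runs_processEdge (h : Exploring n A P D₀ f₀ m X j l) (hjl : j < l) (hk : A.tgt j < n)
    (hf : m.cell .fixed (A.tgt j) = 0) (hmk : m.reg .k = A.tgt j) :
    Runs processEdge m fun t m' => t ≤ 11 ∧ m'.reg .qTail ≤ m.reg .qTail + 1 ∧
      Exploring n A P D₀ f₀ m' X (j + 1) l := by
  -- The second half of the program, entered after `u` steps, whether or not `D` was lowered.
  have main : ∀ (m₁ : Mem) (u : ℕ), u ≤ 5 → 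
      (∀ a, m₁.cell a = if a = .pred then
        update (m.cell .pred) (A.tgt j) (m.cell .pred (A.tgt j) - 1) else m.cell a) →
      (∀ r, r ≠ .changed → m₁.reg r = m.reg r) →
      (∀ v, m₁.num .D v ≤ m.num .D v) →
      Runs (cond (.eq (.cell .pred .k) (.lit 0))
        (put .fixed .k (.lit 1) ;; insertR .k)
        (cond (.ne (.reg .changed) (.lit 0))
          (cond (.eq (.cell .inQ .k) (.lit 0)) (insertQ .k) Com.skip)
          Com.skip)) m₁ fun t m' => u + t ≤ 11 ∧ m'.reg .qTail ≤ m.reg .qTail + 1 ∧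
          Exploring n A P D₀ f₀ m' X (j + 1) l := by
    intro m₁ u hu hc hr hD
    have hk₁ : m₁.reg .k = A.tgt j := by rw [hr _ (by simp), hmk]
    have hrH : m₁.reg .rHead = m.reg .rHead := hr _ (by simp)
    have hrT : m₁.reg .rTail = m.reg .rTail := hr _ (by simp)
    have hqT : m₁.reg .qTail = m.reg .qTail := hr _ (by simp)
    simp only [insertR, insertQ, runs_cond, runs_seq, runs_put, runs_inc, runs_skip, Test.holds,
      Word.eval, hk₁, Mem.setCell_reg, Mem.setReg_reg, reduceCtorEq, if_false]
    split_ifs with h1 h2 h3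
    · refine ⟨by omega, by simp [hqT], h.fix hjl hk hf ?_ ?_ ?_ ?_ ?_ ?_ ?_ ?_⟩
      · simp [Mem.adj, hc]
      · simp [hc, hrT]
      · simp [hc]
      · simp [hrH]
      · simp [hrT]
      · intro k hk; simp [hc, hk]
      · simpa [hc, hqT] using h.q
      · simpa using hD
    · refine ⟨by omega, by simp [hqT], h.relax hjl ?_ ?_ ?_ ?_ ?_ ?_ ?_ ?_ ?_⟩
      · simp [Mem.adj, hc]
      · simp [hc]
      · simp [hc]
      · simp [hrH]
      · simp [hrT]
      · simp [hc]
      · simpa using h1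
      · intro p hp
        simp only [Mem.setCell_reg, Mem.setReg_reg, if_true, hqT] at hp
        simp only [Mem.setReg_cell, Mem.setCell_cell, if_true, reduceCtorEq, if_false, hqT, hc,
          update_apply]
        split_ifs with h4
        · exact hk
        · exact h.q p (by omega)
      · simpa using hD
    · refine ⟨by omega, by simp [hqT], h.relax hjl ?_ ?_ ?_ hrH hrT ?_ h1 ?_ hD⟩
      · simp [Mem.adj, hc]
      · simp [hc]
      · simp [hc]
      · simp [hc]
      · simpa [hc, hqT] using h.q
    · refine ⟨by omega, by simp [hqT], h.relax hjl ?_ ?_ ?_ hrH hrT ?_ h1 ?_ hD⟩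
      · simp [Mem.adj, hc]
      · simp [hc]
      · simp [hc]
      · simp [hc]
      · simpa [hc, hqT] using h.q
  rw [processEdge, runs_seq, runs_mov, runs_seq, runs_decAt, runs_seq, runs_cond]
  simp only [runs_seq, runs_putNum, runs_mov, runs_skip, Test.holds, Word.eval, Num.eval,
    Mem.setReg_reg, Mem.setCell_reg, Mem.setNum_reg, Mem.setReg_cell, Mem.setReg_num,
    Mem.setCell_num, if_true, reduceCtorEq, if_false, hmk]
  split_ifs with h1
  · refine (main _ 5 le_rfl ?_ ?_ ?_).mono ?_
    · intro a; simp
    · intro r hr; simp [hr]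
    · intro v
      simp only [Mem.setReg_num, Mem.setNum_num, if_true, update_apply, Mem.setCell_num]
      split_ifs with h2
      · rw [h2]; exact h1.le
      · exact le_rfl
    · rintro t m' - ⟨k1, k2, k3⟩
      exact ⟨by omega, k2, k3⟩
  · refine (main _ 4 (by omega) ?_ ?_ ?_).mono ?_
    · intro a; simp
    · intro r hr; simp [hr]
    · intro v; simp
    · rintro t m' - ⟨k1, k2, k3⟩
      exact ⟨by omega, k2, k3⟩

/-- `Exploring` does not depend on registers other than the positions in the queues. -/
theorem congr_reg (h : Exploring n A P D₀ f₀ m X j l) (hc : m'.cell = m.cell)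
    (hn : m'.num = m.num) (hHead : m'.reg .rHead = m.reg .rHead)
    (hTail : m'.reg .rTail = m.reg .rTail) (hq : m'.reg .qTail = m.reg .qTail) :
    Exploring n A P D₀ f₀ m' X j l := by
  obtain ⟨g1, g2, g3, g4, g5, g6, g7, g8, g9, g10, g11⟩ := h
  rw [← hHead, ← hTail] at g2 g3 g5 g6
  rw [← hc] at g2 g3 g4 g6 g7 g8 g9 g11
  rw [← hq] at g9
  rw [← hn] at g10
  exact ⟨by rw [← g1]; simp [Mem.adj, hc], g2, g3, g4, g5, g6, g7, g8, g9, g10, g11⟩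

/-- The loop over the edges out of a vertex. -/
def edgeLoop : Com :=
  loop (.lt (.reg .j) (.reg .fin))
    (mov .k (.cell .tgt .j) ;;
     cond (.eq (.cell .fixed .k) (.lit 0)) processEdge Com.skip ;;
     inc .j)

/-- An edge puts at most one vertex into `Q`; the bound on `qTail` later limits the number of heap
operations. -/
theorem runs_edgeLoop (d : ℕ) : ∀ {m : Mem}, Exploring n A P D₀ f₀ m X (m.reg .j) (m.reg .fin) →
    (∀ p ∈ Finset.Ico (m.reg .j) (m.reg .fin), A.tgt p < n) → m.reg .fin - m.reg .j = d →
    Runs edgeLoop m fun t m' => t ≤ 15 * d + 1 ∧ m'.reg .qTail ≤ m.reg .qTail + d ∧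
      Exploring n A P D₀ f₀ m' X 0 0 := by
  induction d with
  | zero =>
    intro m h hA hd
    refine runs_loop_of_not (by simp; omega) ⟨by omega, by omega, { h with pred := ?_ }⟩
    intro k hk hf
    rw [h.pred k hk hf, AdjLists.count, Finset.Ico_eq_empty (by omega)]
    simp
  | succ d ih =>
    intro m h hA hd
    have hjl : m.reg .j < m.reg .fin := by omega
    have hk : A.tgt (m.reg .j) < n := hA _ (Finset.mem_Ico.2 ⟨le_rfl, hjl⟩)
    have htgt : m.cell .tgt = A.tgt := by rw [← h.adj]; rfl
    have next : ∀ (m₁ : Mem) (u : ℕ), u ≤ 14 → m₁.reg .j = m.reg .j → m₁.reg .fin = m.reg .fin →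
        m₁.reg .qTail ≤ m.reg .qTail + 1 →
        Exploring n A P D₀ f₀ m₁ X (m.reg .j + 1) (m.reg .fin) →
        Runs edgeLoop (m₁.setReg .j (m₁.reg .j + 1)) fun t m' =>
          1 + u + t ≤ 15 * (d + 1) + 1 ∧ m'.reg .qTail ≤ m.reg .qTail + (d + 1) ∧
            Exploring n A P D₀ f₀ m' X 0 0 := by
      intro m₁ u hu hj hfin hq h1
      refine (ih (m := m₁.setReg .j (m₁.reg .j + 1)) ?_ ?_ ?_).mono ?_
      · simp only [Mem.setReg_reg, if_true, reduceCtorEq, if_false, hj, hfin]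
        exact h1.congr_reg rfl rfl (by simp) (by simp) (by simp)
      · intro p hp
        simp only [Mem.setReg_reg, if_true, reduceCtorEq, if_false, hj, hfin, Finset.mem_Ico] at hp
        exact hA p (Finset.mem_Ico.2 (by omega))
      · simp [hj, hfin]; omega
      · rintro t m' - ⟨k1, k2, k3⟩
        simp only [Mem.setReg_reg, reduceCtorEq, if_false] at k2
        exact ⟨by omega, by omega, k3⟩
    refine runs_loop_of hjl ?_
    rw [runs_seq, runs_mov, runs_seq, runs_cond]
    simp only [Test.holds, Word.eval, Mem.setReg_reg, Mem.setReg_cell, if_true, htgt,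
      runs_inc, runs_skip, reduceCtorEq, if_false]
    split_ifs with h1
    · refine (runs_processEdge (m := m.setReg .k (A.tgt (m.reg .j)))
        (h.congr_reg rfl rfl (by simp) (by simp) (by simp)) hjl hk h1 (by simp)).mono ?_
      rintro t₁ m₁ hE ⟨k1, k2, k3⟩
      simp only [Mem.setReg_reg, reduceCtorEq, if_false] at k2
      refine (next m₁ (t₁ + 3) (by omega) ?_ ?_ k2 k3).mono ?_
      · rw [hE.reg_eq rfl]; simp
      · rw [hE.reg_eq rfl]; simp
      · rintro t m' - ⟨k4, k5, k6⟩
        exact ⟨by omega, k5, k6⟩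
    · refine (next (m.setReg .k (A.tgt (m.reg .j))) 4 (by omega) (by simp) (by simp) (by simp)
        ((h.skip hjl h1).congr_reg rfl rfl (by simp) (by simp) (by simp))).mono ?_
      rintro t m' - ⟨k4, k5, k6⟩
      exact ⟨by omega, k5, k6⟩

/-- Take the next vertex out of `R`. -/
theorem pop (h : Exploring n A P D₀ f₀ m X 0 0) (hlt : m.reg .rHead < m.reg .rTail) {z : ℕ}
    (hz : m.cell .R (m.reg .rHead) = z) (hc : m'.cell = m.cell) (hn : m'.num = m.num)
    (hHead : m'.reg .rHead = m.reg .rHead + 1) (hTail : m'.reg .rTail = m.reg .rTail)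
    (hq : m'.reg .qTail = m.reg .qTail) :
    Exploring n A P D₀ f₀ m' (insert z X) (A.first z) (A.last z) := by
  have hmem : m.reg .rHead ∈ Finset.Ico (m.reg .rHead) (m.reg .rTail) :=
    Finset.mem_Ico.2 ⟨le_rfl, hlt⟩
  have hsub : ∀ p ∈ Finset.Ico (m'.reg .rHead) (m'.reg .rTail),
      p ∈ Finset.Ico (m.reg .rHead) (m.reg .rTail) ∧ p ≠ m.reg .rHead := by
    intro p hp
    rw [hHead, hTail, Finset.mem_Ico] at hp
    rw [Finset.mem_Ico]
    omega
  obtain ⟨hzn, hzf, hzX⟩ := h.queue _ hmem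
  rw [hz] at hzn hzf hzX
  refine ⟨?_, ?_, ?_, ?_, ?_, ?_, ?_, ?_, ?_, ?_, ?_⟩
  · rw [← h.adj]; simp [Mem.adj, hc]
  · intro p hp
    obtain ⟨h1, h2⟩ := hsub p hp
    obtain ⟨k1, k2, k3⟩ := h.queue p h1
    rw [hc]
    refine ⟨k1, k2, fun h3 => ?_⟩
    rcases Finset.mem_insert.1 h3 with h3 | h3
    · exact h2 (h.inj p h1 _ hmem (h3.trans hz.symm))
    · exact k3 h3
  · intro p hp q hq hpq
    rw [hc] at hpq
    exact h.inj p (hsub p hp).1 q (hsub q hq).1 hpq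
  · intro u hu
    rw [hc]
    rcases Finset.mem_insert.1 hu with rfl | hu
    · exact ⟨hzn, hzf⟩
    · exact h.explored u hu
  · omega
  · intro u hu hf
    rw [hc] at hf ⊢
    rcases h.cover u hu hf with h1 | ⟨p, hp, hpu⟩
    · exact .inl (Finset.mem_insert_of_mem h1)
    · rcases eq_or_ne p (m.reg .rHead) with rfl | hpH
      · left; rw [← hpu, hz]; exact Finset.mem_insert_self _ _
      · right
        refine ⟨p, ?_, hpu⟩
        rw [Finset.mem_Ico] at hp
        rw [hHead, hTail, Finset.mem_Ico]
        omega
  · intro k hk hf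
    rw [hc] at hf ⊢
    -- The edges out of `z` leave the sum and become the count over the current list.
    rw [h.pred k hk hf, AdjLists.count_self, add_zero, Finset.sdiff_insert,
      ← Finset.sum_erase_add _ _ (a := z) (by simp [hzn, hzX])]
    rfl
  · rw [hc]; exact h.pos
  · rw [hc, hq]; exact h.q
  · rw [hn]; exact h.dist
  · rw [hc]; exact h.fixed

/-- The work that remains when the vertices in `X` have been explored. -/
def work (A : AdjLists) (n : ℕ) (X : Finset ℕ) : ℕ := ∑ u ∈ Finset.range n \ X, (1 + A.out u)

/-- `work` is a second potential. Exploring `u` releases `1 + out u`, which pays with factor 20 for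
the steps and bounds the entries made in `Q`. No vertex is explored twice, so this telescopes over
the whole run. -/
theorem runs_exploreR (hA : A.Valid n) (d : ℕ) : ∀ {m : Mem} {X : Finset ℕ},
    Exploring n A P D₀ f₀ m X 0 0 → (Finset.range n \ X).card = d →
    Runs exploreR m fun t m' => ∃ X', Exploring n A P D₀ f₀ m' X' 0 0 ∧
      m'.reg .rTail ≤ m'.reg .rHead ∧ t + 20 * work A n X' ≤ 20 * work A n X + 1 ∧
      m'.reg .qTail + work A n X' ≤ m.reg .qTail + work A n X := by
  induction d with
  | zero =>
    intro m X h hd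
    have hle : m.reg .rTail ≤ m.reg .rHead := by
      by_contra! hlt
      obtain ⟨h1, -, h2⟩ := h.queue _ (Finset.mem_Ico.2 ⟨le_rfl, hlt⟩)
      rw [Finset.card_eq_zero] at hd
      have : m.cell .R (m.reg .rHead) ∈ Finset.range n \ X := by simp [h1, h2]
      simp [hd] at this
    exact runs_loop_of_not (by simpa using hle) ⟨X, h, hle, by omega, le_rfl⟩
  | succ d ih =>
    intro m X h hd
    by_cases hlt : m.reg .rHead < m.reg .rTail
    swap
    · exact runs_loop_of_not hlt ⟨X, h, not_lt.1 hlt, by omega, le_rfl⟩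
    obtain ⟨z, hz⟩ : ∃ z, m.cell .R (m.reg .rHead) = z := ⟨_, rfl⟩
    obtain ⟨hzn, -, hzX⟩ := h.queue _ (Finset.mem_Ico.2 ⟨le_rfl, hlt⟩)
    rw [hz] at hzn hzX
    have hzm : z ∈ Finset.range n \ X := by simp [hzn, hzX]
    have hwork : work A n (insert z X) + (1 + A.out z) = work A n X := by
      rw [work, work, Finset.sdiff_insert]
      exact Finset.sum_erase_add _ _ hzm
    have hfirst : m.cell .first = A.first := by rw [← h.adj]; rfl
    have hlast : m.cell .last = A.last := by rw [← h.adj]; rfl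
    refine runs_loop_of hlt ?_
    rw [runs_seq, runs_mov, runs_seq, runs_inc, runs_seq, runs_mov, runs_seq, runs_mov]
    simp only [Word.eval, Mem.setReg_reg, Mem.setReg_cell, if_true, reduceCtorEq, if_false, hz,
      hfirst, hlast]
    refine (runs_edgeLoop (n := n) (A := A) (P := P) (D₀ := D₀) (f₀ := f₀) (X := insert z X)
      (A.out z) (m := (((m.setReg .z z).setReg .rHead (m.reg .rHead + 1)).setReg
      .j (A.first z)).setReg .fin (A.last z)) ?_ ?_ ?_).mono ?_
    · simpa using h.pop (m' := (((m.setReg .z z).setReg .rHead (m.reg .rHead + 1)).setReg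
        .j (A.first z)).setReg .fin (A.last z)) hlt hz rfl rfl (by simp) (by simp) (by simp)
    · simpa using hA z hzn
    · simp [AdjLists.out]
    · rintro t₁ m₁ - ⟨ht₁, hq₁, h₁⟩
      simp only [Mem.setReg_reg, reduceCtorEq, if_false] at hq₁
      refine (ih (m := m₁) h₁ ?_).mono ?_
      · rw [Finset.sdiff_insert, Finset.card_erase_of_mem hzm]
        omega
      · rintro t m' - ⟨X', k1, k2, k3, k4⟩
        exact ⟨X', k1, k2, by omega, by omega⟩

end Exploring

/-! ### Executions with recorded calls -/

/-- Started in `m`, the program halts after `t` steps, with recorded calls `l` and in a memory `m'`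
such that `Q t l m'`. -/
def Halts (c : Com) (m : Mem) (Q : ℕ → List Label → Mem → Prop) : Prop :=
  ∃ t l m', Exec c m t l m' ∧ Q t l m'

theorem Halts.mono {c : Com} {m : Mem} {P Q : ℕ → List Label → Mem → Prop} (h : Halts c m P)
    (hPQ : ∀ t l m', Exec c m t l m' → P t l m' → Q t l m') : Halts c m Q := by
  obtain ⟨t, l, m', he, hp⟩ := h
  exact ⟨t, l, m', he, hPQ t l m' he hp⟩

theorem Runs.halts {c : Com} {m : Mem} {Q : ℕ → List Label → Mem → Prop}
    (h : Runs c m fun t m' => Q t [] m') : Halts c m Q := by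
  obtain ⟨t, m', he, hp⟩ := h
  exact ⟨t, [], m', he, hp⟩

theorem Halts.seq {c₁ c₂ : Com} {m : Mem} {Q : ℕ → List Label → Mem → Prop}
    (h : Halts c₁ m fun t₁ l₁ m₁ => Halts c₂ m₁ fun t₂ l₂ m₂ => Q (t₁ + t₂) (l₁ ++ l₂) m₂) :
    Halts (c₁ ;; c₂) m Q := by
  obtain ⟨t₁, l₁, m₁, h₁, t₂, l₂, m₂, h₂, hq⟩ := h
  exact ⟨_, _, _, .seq h₁ h₂, hq⟩

theorem Runs.seq_halts {c₁ c₂ : Com} {m : Mem} {Q : ℕ → List Label → Mem → Prop}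
    (h : Runs c₁ m fun t₁ m₁ => Halts c₂ m₁ fun t₂ l₂ m₂ => Q (t₁ + t₂) l₂ m₂) :
    Halts (c₁ ;; c₂) m Q := by
  obtain ⟨t₁, m₁, h₁, t₂, l₂, m₂, h₂, hq⟩ := h
  exact ⟨_, _, _, .seq h₁ h₂, hq⟩

theorem Halts.call {k : Label} {c : Com} {m : Mem} {Q : ℕ → List Label → Mem → Prop}
    (h : Halts c m fun t l m' => Q (1 + t) (k :: l) m') : Halts (call k c) m Q := by
  obtain ⟨t, l, m', he, hq⟩ := h
  exact ⟨_, _, _, .call he, hq⟩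

theorem Halts.cond_of {b : Test} {c₁ c₂ : Com} {m : Mem} {Q : ℕ → List Label → Mem → Prop}
    (hb : b.holds m) (h : Halts c₁ m fun t l m' => Q (1 + t) l m') : Halts (cond b c₁ c₂) m Q := by
  obtain ⟨t, l, m', he, hq⟩ := h
  exact ⟨_, _, _, .condTrue hb he, hq⟩

theorem Halts.cond_of_not {b : Test} {c₁ c₂ : Com} {m : Mem} {Q : ℕ → List Label → Mem → Prop}
    (hb : ¬ b.holds m) (h : Halts c₂ m fun t l m' => Q (1 + t) l m') :
    Halts (cond b c₁ c₂) m Q := by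
  obtain ⟨t, l, m', he, hq⟩ := h
  exact ⟨_, _, _, .condFalse hb he, hq⟩

theorem Halts.loop_of_not {b : Test} {c : Com} {m : Mem} {Q : ℕ → List Label → Mem → Prop}
    (hb : ¬ b.holds m) (h : Q 1 [] m) : Halts (loop b c) m Q :=
  ⟨_, _, _, .loopFalse hb, h⟩

theorem Halts.loop_of {b : Test} {c : Com} {m : Mem} {Q : ℕ → List Label → Mem → Prop}
    (hb : b.holds m)
    (h : Halts c m fun t₁ l₁ m₁ =>
      Halts (loop b c) m₁ fun t₂ l₂ m₂ => Q (1 + t₁ + t₂) (l₁ ++ l₂) m₂) :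
    Halts (loop b c) m Q := by
  obtain ⟨t₁, l₁, m₁, h₁, t₂, l₂, m₂, h₂, hq⟩ := h
  exact ⟨_, _, _, .loopTrue hb h₁ h₂, hq⟩

/-! ### The outer loop -/

/-- The heap survives whatever the main program does outside it, including lowering `D`. -/
theorem Heap.congr {n : ℕ} {S : Finset ℕ} {m m' : Mem} {rt : List ℕ} (h : Heap n S m rt)
    (hn : m'.reg .n = m.reg .n) (hroots : m'.reg .roots = m.reg .roots)
    (hmin : m'.reg .hmin = m.reg .hmin) (hlinks : m'.links = m.links)
    (hinH : m'.cell .inH = m.cell .inH) (htable : m'.cell .table = m.cell .table)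
    (hD : ∀ u, m'.num .D u ≤ m.num .D u) :
    Heap n S m' rt ∧ potential S m' rt = potential S m rt := by
  have hnxt : m'.cell .nxt = m.cell .nxt := congrArg Links.nxt hlinks
  have hpar : m'.cell .parent = m.cell .parent := congrArg Links.par hlinks
  have hmrk : m'.cell .mark = m.cell .mark := congrArg Links.mrk hlinks
  have hkey : m'.num .key = m.num .key := congrArg Links.key hlinks
  refine ⟨⟨⟨hn.trans h.size, ?_, h.nodup, ?_, ?_⟩, hlinks ▸ h.forest, ?_, ?_, ?_, ?_⟩, ?_⟩
  · rw [hnxt, hroots]; exact h.chain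
  · rw [hpar]; exact h.mem
  · rw [hpar, hmrk]; exact h.root
  · rw [hmin, hkey]; exact h.hmin
  · rw [hinH]; exact h.inH
  · rw [htable]; exact h.table
  · rw [hkey]; exact fun u hu => (hD u).trans (h.key u hu)
  · rw [potential, potential, hmrk]

/-- The removal of the minimum needs a factor above 20 at the potential; doubling the bound of
`runs_decreaseKey` gives the common factor 40. -/
theorem Heap.halts_insertOrAdjust {n : ℕ} {S : Finset ℕ} {m : Mem} {rt : List ℕ}
    (h : Heap n S m rt) (hv : m.reg .v < n) :
    Halts heapInsertOrAdjust m fun t l m' => l = [.heapInsertOrAdjust] ∧ ∃ rt',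
      Heap n (insert (m.reg .v) S) m' rt' ∧
      t + 40 * potential (insert (m.reg .v) S) m' rt' ≤ 40 * potential S m rt + 210 := by
  apply Halts.call
  have hin := h.inH _ hv
  by_cases hS : m.reg .v ∈ S
  · refine Halts.cond_of_not (by simpa [hin] using hS) ((h.runs_decreaseKey hS).mono ?_).halts
    rintro t m' - ⟨rt', h1, h2⟩
    rw [Finset.insert_eq_of_mem hS]
    exact ⟨rfl, rt', h1, by omega⟩
  · refine Halts.cond_of (by simpa [hin] using hS) ((h.runs_insertNode hS hv).mono ?_).halts
    rintro t m' - ⟨h0, h1, h2⟩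
    exact ⟨rfl, _, h1, by omega⟩

/-- The conclusions on `S'` and `l` are what the outer loop needs: only non-fixed vertices enter the
heap, and if there are none, nothing is called. -/
theorem Heap.halts_flushQ {n : ℕ} (d : ℕ) : ∀ {S : Finset ℕ} {m : Mem} {rt : List ℕ},
    Heap n S m rt → (∀ p < m.reg .qTail, m.cell .Q p < n) → m.reg .qTail - m.reg .qHead = d →
    Halts flushQ m fun t l m' => l.count .outerIteration = 0 ∧ ∃ S' rt', Heap n S' m' rt' ∧
      (∀ u ∈ S', u ∈ S ∨ m.cell .fixed u = 0) ∧
      ((∀ u < n, m.cell .fixed u ≠ 0) → l = [] ∧ S' = S) ∧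
      t + 40 * potential S' m' rt' ≤ 40 * potential S m rt + 220 * d + 1 := by
  induction d with
  | zero =>
    intro S m rt h hq hd
    exact Halts.loop_of_not (by simp; omega)
      ⟨rfl, S, rt, h, fun u hu => .inl hu, fun _ => ⟨rfl, rfl⟩, by omega⟩
  | succ d ih =>
    intro S m rt h hq hd
    have hlt : m.reg .qHead < m.reg .qTail := by omega
    obtain ⟨v, hv⟩ : ∃ v, m.cell .Q (m.reg .qHead) = v := ⟨_, rfl⟩
    have hvn : v < n := hv ▸ hq _ hlt
    refine Halts.loop_of hlt (Runs.seq_halts (runs_mov.2 (Runs.seq_halts (runs_inc.2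
      (Runs.seq_halts (runs_put.2 ?_))))))
    simp only [Word.eval, Mem.setReg_reg, if_true, reduceCtorEq, if_false, hv]
    obtain ⟨m₁, hm₁⟩ : ∃ m₁, ((m.setReg .v v).setReg .qHead (m.reg .qHead + 1)).setCell .inQ v 0 =
      m₁ := ⟨_, rfl⟩
    obtain ⟨h₁, hpot⟩ := h.congr (m' := m₁) (by simp [← hm₁]) (by simp [← hm₁]) (by simp [← hm₁])
      (by simp [← hm₁, Mem.links]) (by simp [← hm₁]) (by simp [← hm₁]) (by simp [← hm₁])
    have hv₁ : m₁.reg .v = v := by simp [← hm₁]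
    have hf₁ : m₁.cell .fixed = m.cell .fixed := by simp [← hm₁]
    have hQ₁ : m₁.cell .Q = m.cell .Q := by simp [← hm₁]
    have hqT₁ : m₁.reg .qTail = m.reg .qTail := by simp [← hm₁]
    have hqH₁ : m₁.reg .qHead = m.reg .qHead + 1 := by simp [← hm₁]
    rw [hm₁]
    by_cases hf : m.cell .fixed v = 0
    · refine Halts.cond_of (by simpa [hv₁, hf₁] using hf)
        ((h₁.halts_insertOrAdjust (hv₁ ▸ hvn)).mono ?_)
      rintro t₁ l₁ m₂ hE ⟨rfl, rt₂, h₂, hp₂⟩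
      have hf₂ : m₂.cell .fixed = m₁.cell .fixed := hE.cell_eq rfl
      have hQ₂ : m₂.cell .Q = m₁.cell .Q := hE.cell_eq rfl
      have hqT₂ : m₂.reg .qTail = m₁.reg .qTail := hE.reg_eq rfl
      have hqH₂ : m₂.reg .qHead = m₁.reg .qHead := hE.reg_eq rfl
      refine (ih h₂ (by rw [hQ₂, hqT₂, hQ₁, hqT₁]; exact hq) (by omega)).mono ?_
      rintro t₂ l₂ m' - ⟨k1, S', rt', k2, k3, -, k5⟩
      rw [hf₂, hf₁] at k3
      refine ⟨by simpa using k1, S', rt', k2, fun u hu => ?_, fun hall => absurd hf (hall v hvn),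
        by omega⟩
      rcases k3 u hu with k | k
      · rcases Finset.mem_insert.1 k with k | k
        · rw [k, hv₁]; exact .inr hf
        · exact .inl k
      · exact .inr k
    · refine Halts.cond_of_not (by simpa [hv₁, hf₁] using hf) (runs_skip.2 ?_).halts
      refine (ih h₁ (by rw [hQ₁, hqT₁]; exact hq) (by omega)).mono ?_
      rintro t₂ l₂ m' - ⟨k1, S', rt', k2, k3, k4, k5⟩
      rw [hf₁] at k3 k4
      exact ⟨by simpa using k1, S', rt', k2, k3, by simpa using k4, by omega⟩

/-- The fixed vertices. -/
def fixedSet (n : ℕ) (m : Mem) : Finset ℕ := (Finset.range n).filter fun u => m.cell .fixed u ≠ 0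

/-- The number of vertices that are in the heap or may still get there. -/
def alive (n : ℕ) (S : Finset ℕ) (m : Mem) : ℕ :=
  ((Finset.range n).filter fun u => u ∈ S ∨ m.cell .fixed u = 0).card

/-- The invariant of the outer loop. -/
structure Outer (n : ℕ) (A : AdjLists) (m : Mem) (S : Finset ℕ) (rt : List ℕ) : Prop where
  heap : Heap n S m rt
  adj : m.adj = A
  pred : ∀ k < n, m.cell .fixed k = 0 →
    m.cell .pred k = ∑ u ∈ Finset.range n \ fixedSet n m, A.mult u k

/-- Progress of the outer loop: the removed vertex ends up fixed, whichever branch is taken, so it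
can never be inserted again. -/
theorem alive_lt {n v : ℕ} {S S' : Finset ℕ} {m m' : Mem} (hv : v < n) (hvS : v ∈ S) (hvS' : v ∉ S')
    (hvf : m'.cell .fixed v ≠ 0) (hS : ∀ u ∈ S', u ∈ S ∨ m'.cell .fixed u = 0)
    (hf : ∀ u, m.cell .fixed u ≠ 0 → m'.cell .fixed u ≠ 0) : alive n S' m' < alive n S m := by
  refine Finset.card_lt_card ⟨fun u hu => ?_, fun hsub => ?_⟩
  · simp only [Finset.mem_filter] at hu ⊢
    refine ⟨hu.1, ?_⟩
    have h1 := hf u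
    have h2 := hS u
    tauto
  · have := hsub (Finset.mem_filter.2 ⟨Finset.mem_range.2 hv, .inl hvS⟩)
    simp only [Finset.mem_filter] at this
    tauto

/-- `hacyc` is acyclicity in the form used here: no nonempty set of vertices contains a predecessor
of each of its elements. The factor 240 is 20 for exploring plus 220 for an entry of `Q`. -/
theorem Outer.halts_explore {n : ℕ} {A : AdjLists} {m : Mem} {S : Finset ℕ} {rt : List ℕ}
    {P : Prop} {v : ℕ} (h : Outer n A m S rt) (hA : A.Valid n) (hv : m.reg .v = v) (hvn : v < n)
    (hvS : v ∉ S) (hvf : m.cell .fixed v = 0)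
    (hpos : P → ∀ k < n, k ≠ v → m.cell .fixed k = 0 → m.cell .pred k ≠ 0)
    (hacyc : P → ∀ U : ℕ → Prop, (∀ k < n, U k → ∃ u < n, U u ∧ A.mult u k ≠ 0) →
      ∀ k < n, ¬ U k) :
    Halts (mov .rHead (.lit 0) ;; mov .rTail (.lit 0) ;; mov .qHead (.lit 0) ;;
      mov .qTail (.lit 0) ;; insertR .v ;; put .fixed .v (.lit 1) ;; exploreR ;; flushQ) m
      fun t l m' => l.count .outerIteration = 0 ∧ ∃ S' rt', Outer n A m' S' rt' ∧
        (∀ u ∈ S', u ∈ S ∨ m'.cell .fixed u = 0) ∧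
        (∀ u, m.cell .fixed u ≠ 0 ∨ u = v → m'.cell .fixed u ≠ 0) ∧
        (P → l = [] ∧ S' = S) ∧
        t + 40 * potential S' m' rt' + 240 * Exploring.work A n (fixedSet n m') ≤
          40 * potential S m rt + 240 * Exploring.work A n (fixedSet n m) + 10 := by
  refine Runs.seq_halts (runs_mov.2 (Runs.seq_halts (runs_mov.2 (Runs.seq_halts (runs_mov.2
    (Runs.seq_halts (runs_mov.2 (Runs.seq_halts (runs_seq.2 (runs_put.2 (runs_inc.2
    (Runs.seq_halts (runs_put.2 ?_)))))))))))))
  simp only [Word.eval, Mem.setReg_reg, Mem.setCell_reg, if_true, reduceCtorEq, if_false, hv]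
  obtain ⟨m₁, hm₁⟩ : ∃ m₁, ((((((m.setReg .rHead 0).setReg .rTail 0).setReg .qHead 0).setReg
    .qTail 0).setCell .R 0 v).setReg .rTail (0 + 1)).setCell .fixed v 1 = m₁ := ⟨_, rfl⟩
  rw [hm₁]
  have hrH : m₁.reg .rHead = 0 := by simp [← hm₁]
  have hrT : m₁.reg .rTail = 1 := by simp [← hm₁]
  have hqH : m₁.reg .qHead = 0 := by simp [← hm₁]
  have hqT : m₁.reg .qTail = 0 := by simp [← hm₁]
  have hR : m₁.cell .R = update (m.cell .R) 0 v := by simp [← hm₁]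
  have hf : m₁.cell .fixed = update (m.cell .fixed) v 1 := by simp [← hm₁]
  have hpred : m₁.cell .pred = m.cell .pred := by simp [← hm₁]
  have hunf : ∀ k, m₁.cell .fixed k = 0 → k ≠ v ∧ m.cell .fixed k = 0 := by
    intro k hk
    have : k ≠ v := by rintro rfl; simp [hf] at hk
    rw [hf, update_of_ne this] at hk
    exact ⟨this, hk⟩
  have hfx : ∀ k, m.cell .fixed k ≠ 0 → m₁.cell .fixed k ≠ 0 := fun k hk h => hk (hunf k h).2
  have hI : ∀ p ∈ Finset.Ico (m₁.reg .rHead) (m₁.reg .rTail), p = 0 := by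
    intro p hp
    rw [hrH, hrT, Finset.mem_Ico] at hp
    omega
  have hE : Exploring n A P (m.num .D) (m₁.cell .fixed) m₁ (fixedSet n m) 0 0 := by
    refine ⟨?_, ?_, ?_, ?_, by omega, ?_, ?_, ?_, ?_, ?_, fun _ h => h⟩
    · rw [← h.adj]; simp [← hm₁, Mem.adj]
    · intro p hp
      rw [hI p hp, hR, hf]
      simp [hvn, fixedSet, hvf]
    · intro p hp q hq _
      rw [hI p hp, hI q hq]
    · intro u hu
      obtain ⟨h1, h2⟩ := Finset.mem_filter.1 hu
      exact ⟨Finset.mem_range.1 h1, hfx u h2⟩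
    · intro u hu hfu
      rcases eq_or_ne u v with rfl | huv
      · refine .inr ⟨0, ?_, by simp [hR]⟩
        rw [hrH, hrT]
        simp
      · rw [hf, update_of_ne huv] at hfu
        exact .inl (Finset.mem_filter.2 ⟨Finset.mem_range.2 hu, hfu⟩)
    · intro k hk hfk
      rw [hpred, h.pred k hk (hunf k hfk).2]
      simp
    · intro hP k hk hfk
      rw [hpred]
      exact hpos hP k hk (hunf k hfk).1 (hunf k hfk).2
    · intro p hp
      omega
    · intro u
      simp [← hm₁]
  refine Runs.seq_halts ((Exploring.runs_exploreR hA _ hE rfl).mono ?_)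
  rintro t₁ m₂ hx ⟨X, h₂, hle, ht, hq⟩
  -- `R` is empty, so the fixed vertices are exactly the explored ones; this restores the invariant
  -- `Outer.pred`.
  have hX : fixedSet n m₂ = X := by
    ext u
    simp only [fixedSet, Finset.mem_filter, Finset.mem_range]
    constructor
    · rintro ⟨h1, h2⟩
      refine (h₂.cover u h1 h2).resolve_right ?_
      rintro ⟨p, hp, -⟩
      rw [Finset.mem_Ico] at hp
      omega
    · exact h₂.explored u
  obtain ⟨hheap, hpot⟩ := h.heap.congr (m' := m₂) (by rw [hx.reg_eq rfl]; simp [← hm₁])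
    (by rw [hx.reg_eq rfl]; simp [← hm₁]) (by rw [hx.reg_eq rfl]; simp [← hm₁])
    (by
      simp only [Mem.links]
      rw [hx.cell_eq rfl, hx.cell_eq rfl, hx.cell_eq rfl, hx.cell_eq rfl, hx.cell_eq rfl,
        hx.cell_eq rfl, hx.num_eq rfl]
      simp [← hm₁])
    (by rw [hx.cell_eq rfl]; simp [← hm₁]) (by rw [hx.cell_eq rfl]; simp [← hm₁]) h₂.dist
  have hqH₂ : m₂.reg .qHead = 0 := by rw [hx.reg_eq rfl, hqH]
  refine (hheap.halts_flushQ _ h₂.q rfl).mono ?_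
  rintro t₂ l m' hy ⟨k1, S', rt', k2, k3, k4, k5⟩
  have hf' : m'.cell .fixed = m₂.cell .fixed := hy.cell_eq rfl
  have hp' : m'.cell .pred = m₂.cell .pred := hy.cell_eq rfl
  have hX' : fixedSet n m' = X := by rw [← hX, fixedSet, fixedSet, hf']
  refine ⟨k1, S', rt', ⟨k2, ?_, ?_⟩, ?_, ?_, ?_, ?_⟩
  · rw [← h₂.adj]
    simp only [Mem.adj]
    rw [hy.cell_eq rfl, hy.cell_eq rfl, hy.cell_eq rfl]
  · intro k hk hfk
    rw [hf'] at hfk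
    rw [hp', hX', h₂.pred k hk hfk]
    simp
  · rw [hf']; exact k3
  · intro u hu
    rw [hf']
    refine h₂.fixed u ?_
    rcases hu with hu | rfl
    · exact hfx u hu
    · simp [hf]
  -- A non-fixed vertex still has a nonzero count, hence an edge from a non-fixed vertex; so by
  -- `hacyc` all vertices are fixed.
  · intro hP
    refine k4 fun k hk => ?_
    refine hacyc hP (fun u => m₂.cell .fixed u = 0) (fun k hk hfk => ?_) k hk
    have h1 := h₂.pos hP k hk hfk
    rw [h₂.pred k hk hfk, AdjLists.count_self, add_zero] at h1
    obtain ⟨u, hu, hne⟩ := Finset.exists_ne_zero_of_sum_ne_zero h1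
    rw [← hX] at hu
    simp only [fixedSet, Finset.mem_sdiff, Finset.mem_range, Finset.mem_filter, not_and,
      not_not] at hu
    exact ⟨u, hu.1, hu.2 hu.1, hne⟩
  · rw [hX']
    omega

/-- Under `P` the heap holds a single vertex, so the vertex removed is the only non-fixed one whose
counter may be 0. -/
theorem Outer.halts_iteration {n : ℕ} {A : AdjLists} {m : Mem} {S : Finset ℕ} {rt : List ℕ}
    {P : Prop} (h : Outer n A m S rt) (hA : A.Valid n) (hS : S.Nonempty)
    (hone : P → ∀ u ∈ S, ∀ v ∈ S, u = v)
    (hpos : P → ∀ k < n, k ∉ S → m.cell .fixed k = 0 → m.cell .pred k ≠ 0)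
    (hacyc : P → ∀ U : ℕ → Prop, (∀ k < n, U k → ∃ u < n, U u ∧ A.mult u k ≠ 0) →
      ∀ k < n, ¬ U k) :
    Halts outerIteration m fun t l m' => l.count .outerIteration = 1 ∧ ∃ S' rt',
      Outer n A m' S' rt' ∧ alive n S' m' < alive n S m ∧
      (P → l = [.outerIteration, .heapRemoveMin] ∧ S' = ∅) ∧
      t + 40 * potential S' m' rt' + 240 * Exploring.work A n (fixedSet n m') ≤
        40 * potential S m rt + 240 * Exploring.work A n (fixedSet n m) +
          320 * (Nat.log 2 n + 1) := by
  obtain ⟨ch, F⟩ := h.heap.forest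
  refine Halts.call (Halts.seq (Halts.call ((h.heap.runs_removeMin hS).mono ?_).halts))
  rintro t₁ m₁ hx ⟨hvS, rt₁, h₁, ht₁⟩
  obtain ⟨v, hv⟩ : ∃ v, m₁.reg .v = v := ⟨_, rfl⟩
  rw [hv] at hvS h₁ ht₁
  have hvn : v < n := F.lt v hvS
  have hf : m₁.cell .fixed = m.cell .fixed := hx.cell_eq rfl
  have hp : m₁.cell .pred = m.cell .pred := hx.cell_eq rfl
  have hfs : fixedSet n m₁ = fixedSet n m := by rw [fixedSet, fixedSet, hf]
  have hO : Outer n A m₁ (S.erase v) rt₁ := by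
    refine ⟨h₁, ?_, ?_⟩
    · rw [← h.adj]
      simp only [Mem.adj]
      rw [hx.cell_eq rfl, hx.cell_eq rfl, hx.cell_eq rfl]
    · rw [hf, hp, hfs]; exact h.pred
  have hempty : P → S.erase v = ∅ := by
    intro hP
    rw [Finset.eq_empty_iff_forall_notMem]
    intro u hu
    obtain ⟨h1, h2⟩ := Finset.mem_erase.1 hu
    exact h1 (hone hP u h2 v hvS)
  by_cases hfv : m.cell .fixed v = 0
  · refine Halts.cond_of (by simpa [hv, hf] using hfv)
      ((hO.halts_explore (P := P) hA hv hvn (by simp) (by rwa [hf]) ?_ hacyc).mono ?_)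
    · intro hP k hk hkv hfk
      rw [hp]
      rw [hf] at hfk
      exact hpos hP k hk (fun hkS => hkv (hone hP k hkS v hvS)) hfk
    · rintro t₂ l m' - ⟨k1, S', rt', k2, k3, k4, k5, k6⟩
      have hvf : m'.cell .fixed v ≠ 0 := k4 v (.inr rfl)
      refine ⟨by simpa using k1, S', rt', k2, alive_lt hvn hvS ?_ hvf ?_ ?_, ?_, ?_⟩
      · intro hvS'
        rcases k3 v hvS' with k | k
        · simp at k
        · exact hvf k
      · exact fun u hu => (k3 u hu).imp_left Finset.mem_of_mem_erase
      · intro u hu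
        exact k4 u (.inl (by rwa [hf]))
      · intro hP
        obtain ⟨k7, k8⟩ := k5 hP
        exact ⟨by simp [k7], k8.trans (hempty hP)⟩
      · rw [hfs] at k6
        omega
  · refine Halts.cond_of_not (by simpa [hv, hf] using hfv) (runs_skip.2 ?_).halts
    refine ⟨by simp, _, rt₁, hO, alive_lt hvn hvS (by simp) (by rwa [hf])
      (fun u hu => .inl (Finset.mem_of_mem_erase hu)) (by rw [hf]; exact fun _ h => h),
      fun hP => ⟨by simp, hempty hP⟩, ?_⟩
    rw [hfs]
    omega

theorem Heap.hmin_eq_iff {n : ℕ} {S : Finset ℕ} {m : Mem} {rt : List ℕ} (h : Heap n S m rt) :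
    m.reg .hmin ≠ m.reg .n ↔ S.Nonempty := by
  obtain ⟨ch, F⟩ := h.forest
  rw [h.size]
  constructor
  · intro hne
    rcases h.hmin with h1 | h1
    · exact absurd h1.2 hne
    · exact ⟨_, ((h.mem _).1 h1.1).1⟩
  · intro hS heq
    exact F.not_mem (heq ▸ ((h.mem _).1 (h.hmin_le hS).1).1)

/-- Potential and work telescope and their final values are dropped; only the logarithmic term is
charged per iteration. -/
theorem Outer.halts_loop {n : ℕ} {A : AdjLists} (hA : A.Valid n) (d : ℕ) : ∀ {m : Mem}
    {S : Finset ℕ} {rt : List ℕ}, Outer n A m S rt → alive n S m ≤ d →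
    Halts (loop (.ne (.reg .hmin) (.reg .n)) outerIteration) m fun t l _ =>
      l.count .outerIteration ≤ alive n S m ∧
      t ≤ 40 * potential S m rt + 240 * Exploring.work A n (fixedSet n m) +
        l.count .outerIteration * (330 * (Nat.log 2 n + 1)) + 1 := by
  induction d with
  | zero =>
    intro m S rt h hd
    have hS : ¬ S.Nonempty := by
      rintro ⟨v, hv⟩
      obtain ⟨ch, F⟩ := h.heap.forest
      rw [Nat.le_zero, alive, Finset.card_eq_zero] at hd
      have : v ∈ (Finset.range n).filter fun u => u ∈ S ∨ m.cell .fixed u = 0 :=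
        Finset.mem_filter.2 ⟨Finset.mem_range.2 (F.lt v hv), .inl hv⟩
      simp [hd] at this
    exact Halts.loop_of_not (by simpa using fun h' => hS (h.heap.hmin_eq_iff.1 h'))
      ⟨by simp, by omega⟩
  | succ d ih =>
    intro m S rt h hd
    by_cases hS : S.Nonempty
    · refine Halts.loop_of (h.heap.hmin_eq_iff.2 hS) ((h.halts_iteration (P := False) hA hS
        False.elim False.elim False.elim).mono ?_)
      rintro t₁ l₁ m₁ - ⟨k1, S₁, rt₁, k2, k3, -, k4⟩
      refine (ih k2 (by omega)).mono ?_
      rintro t₂ l₂ m' - ⟨k5, k6⟩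
      rw [List.count_append, k1]
      refine ⟨by omega, ?_⟩
      rw [add_mul, one_mul]
      omega
    · exact Halts.loop_of_not (by simpa using fun h' => hS (h.heap.hmin_eq_iff.1 h'))
        ⟨by simp, by omega⟩

theorem Outer.halts_loop_once {n : ℕ} {A : AdjLists} {m : Mem} {S : Finset ℕ} {rt : List ℕ}
    (h : Outer n A m S rt) (hA : A.Valid n) (hS : S.Nonempty)
    (hone : ∀ u ∈ S, ∀ v ∈ S, u = v)
    (hpos : ∀ k < n, k ∉ S → m.cell .fixed k = 0 → m.cell .pred k ≠ 0)
    (hacyc : ∀ U : ℕ → Prop, (∀ k < n, U k → ∃ u < n, U u ∧ A.mult u k ≠ 0) →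
      ∀ k < n, ¬ U k) :
    Halts (loop (.ne (.reg .hmin) (.reg .n)) outerIteration) m fun t l _ =>
      l = [.outerIteration, .heapRemoveMin] ∧
      t ≤ 40 * potential S m rt + 240 * Exploring.work A n (fixedSet n m) +
        330 * (Nat.log 2 n + 1) + 1 := by
  refine Halts.loop_of (h.heap.hmin_eq_iff.2 hS) ((h.halts_iteration (P := True) hA hS
    (fun _ => hone) (fun _ => hpos) (fun _ => hacyc)).mono ?_)
  rintro t₁ l₁ m₁ - ⟨-, S₁, rt₁, k2, -, k3, k4⟩
  obtain ⟨k5, k6⟩ := k3 trivial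
  refine Halts.loop_of_not ?_ ⟨by simp [k5], by omega⟩
  intro hb
  rw [Test.holds, Word.eval, Word.eval, k2.heap.hmin_eq_iff, k6] at hb
  simp at hb

/-! ### The initialization -/

/-- The first loop of `setup`. -/
def clearLoop : Com :=
  loop (.lt (.reg .i) (.reg .n))
    (putNum .D .i .infty ;;
     put .fixed .i (.lit 0) ;;
     put .pred .i (.lit 0) ;;
     put .inQ .i (.lit 0) ;;
     put .inH .i (.lit 0) ;;
     put .table .i (.reg .n) ;;
     inc .i)

/-- The loop of `setup` over the edges out of a vertex. -/
def countEdges : Com :=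
  loop (.lt (.reg .j) (.reg .fin))
    (mov .k (.cell .tgt .j) ;;
     incAt .pred .k ;;
     inc .j)

/-- The loop of `setup` over all edges. -/
def countLoop : Com :=
  loop (.lt (.reg .i) (.reg .n))
    (mov .j (.cell .first .i) ;;
     mov .fin (.cell .last .i) ;;
     countEdges ;;
     inc .i)

theorem runs_clearLoop (d : ℕ) : ∀ {m : Mem}, m.reg .n - m.reg .i = d →
    (∀ u < m.reg .i, m.cell .fixed u = 0 ∧ m.cell .pred u = 0 ∧ m.cell .inH u = 0 ∧
      m.cell .table u = m.reg .n) →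
    Runs clearLoop m fun t m' => t ≤ 8 * d + 1 ∧
      ∀ u < m.reg .n, m'.cell .fixed u = 0 ∧ m'.cell .pred u = 0 ∧ m'.cell .inH u = 0 ∧
        m'.cell .table u = m.reg .n := by
  induction d with
  | zero =>
    intro m hd h
    exact runs_loop_of_not (by simp; omega) ⟨by omega, fun u hu => h u (by omega)⟩
  | succ d ih =>
    intro m hd h
    refine runs_loop_of (by simp; omega) ?_
    rw [runs_seq, runs_putNum, runs_seq, runs_put, runs_seq, runs_put, runs_seq, runs_put, runs_seq,
      runs_put, runs_seq, runs_put, runs_inc]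
    refine (ih ?_ ?_).mono ?_
    · simp; omega
    · intro u hu
      simp only [Mem.setReg_reg, if_true, Mem.setCell_reg, Mem.setNum_reg] at hu
      rcases eq_or_ne u (m.reg .i) with rfl | hui
      · simp
      · simpa [update_of_ne hui] using h u (by omega)
    · rintro t m' - ⟨h1, h2⟩
      exact ⟨by omega, by simpa using h2⟩

theorem runs_countEdges (A : AdjLists) (d : ℕ) : ∀ {m : Mem}, m.reg .fin - m.reg .j = d →
    m.cell .tgt = A.tgt →
    Runs countEdges m fun t m' => t ≤ 4 * d + 1 ∧
      ∀ k, m'.cell .pred k = m.cell .pred k + A.count (m.reg .j) (m.reg .fin) k := by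
  induction d with
  | zero =>
    intro m hd ht
    refine runs_loop_of_not (by simp; omega) ⟨by omega, fun k => ?_⟩
    rw [AdjLists.count, Finset.Ico_eq_empty (by omega)]
    simp
  | succ d ih =>
    intro m hd ht
    refine runs_loop_of (by simp; omega) ?_
    rw [runs_seq, runs_mov, runs_seq, runs_incAt, runs_inc]
    refine (ih ?_ ?_).mono ?_
    · simp; omega
    · simp [ht]
    · rintro t m' - ⟨h1, h2⟩
      refine ⟨by omega, fun k => ?_⟩
      rw [h2 k, A.count_left (show m.reg .j < m.reg .fin by omega)]
      rcases eq_or_ne k (A.tgt (m.reg .j)) with rfl | hk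
      · simp [ht]; omega
      · simp [ht, hk, hk.symm]

theorem runs_countLoop (A : AdjLists) (d : ℕ) : ∀ {m : Mem}, m.reg .n - m.reg .i = d →
    m.reg .i ≤ m.reg .n → m.adj = A →
    Runs countLoop m fun t m' =>
      t ≤ 4 * ∑ u ∈ Finset.Ico (m.reg .i) (m.reg .n), (2 + A.out u) + 1 ∧
      ∀ k, m'.cell .pred k =
        m.cell .pred k + ∑ u ∈ Finset.Ico (m.reg .i) (m.reg .n), A.mult u k := by
  induction d with
  | zero =>
    intro m hd hle hA
    refine runs_loop_of_not (by simp; omega) ⟨by omega, fun k => ?_⟩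
    rw [Finset.Ico_eq_empty (by omega)]
    simp
  | succ d ih =>
    intro m hd hle hA
    have hlt : m.reg .i < m.reg .n := by omega
    have hfirst : m.cell .first = A.first := by rw [← hA]; rfl
    have hlast : m.cell .last = A.last := by rw [← hA]; rfl
    have htgt : m.cell .tgt = A.tgt := by rw [← hA]; rfl
    refine runs_loop_of hlt ?_
    rw [runs_seq, runs_mov, runs_seq, runs_mov, runs_seq]
    refine (runs_countEdges A _ rfl (by simp [htgt])).mono ?_
    rintro t₁ m₁ hE ⟨h1, h2⟩
    have hn : m₁.reg .n = m.reg .n := by rw [hE.reg_eq rfl]; simp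
    have hi : m₁.reg .i = m.reg .i := by rw [hE.reg_eq rfl]; simp
    have hA₁ : m₁.adj = A := by
      rw [← hA, Mem.adj, hE.cell_eq rfl, hE.cell_eq rfl, hE.cell_eq rfl]; rfl
    simp only [Word.eval, Mem.setReg_reg, Mem.setReg_cell, if_true, reduceCtorEq, if_false, hfirst,
      hlast] at h1 h2
    rw [runs_inc]
    refine (ih ?_ ?_ ?_).mono ?_
    · simp [hn, hi]; omega
    · simp [hn, hi]; omega
    · simpa [Mem.adj] using hA₁
    · rintro t m' - ⟨h3, h4⟩
      simp only [Mem.setReg_reg, if_true, reduceCtorEq, if_false, Mem.setReg_cell, hn, hi] at h3 h4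
      rw [← Finset.insert_Ico_add_one_left_eq_Ico hlt]
      refine ⟨?_, fun k => ?_⟩
      · rw [Finset.sum_insert (by simp), AdjLists.out]
        omega
      · rw [Finset.sum_insert (by simp), h4 k, h2 k, add_assoc]
        rfl

theorem runs_setup {m : Mem} {n : ℕ} (hn : m.reg .n = n) :
    Runs setup m fun t m' => t ≤ 16 * n + 4 * ∑ u ∈ Finset.range n, m.adj.out u + 6 ∧
      m'.adj = m.adj ∧ m'.reg .n = n ∧ m'.reg .hmin = n ∧ m'.reg .roots = n ∧ ∀ u < n,
      m'.cell .fixed u = 0 ∧ m'.cell .inH u = 0 ∧ m'.cell .table u = n ∧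
      m'.cell .pred u = ∑ v ∈ Finset.range n, m.adj.mult v u := by
  unfold setup
  rw [runs_seq, runs_mov, runs_seq]
  refine (runs_clearLoop n (by simp [hn]) (by simp)).mono ?_
  rintro t₁ m₁ hE₁ ⟨ht₁, h₁⟩
  have hn₁ : m₁.reg .n = n := by rw [hE₁.reg_eq rfl]; simp [hn]
  have hA₁ : m₁.adj = m.adj := by
    rw [Mem.adj, hE₁.cell_eq rfl, hE₁.cell_eq rfl, hE₁.cell_eq rfl]; rfl
  simp only [Mem.setReg_reg, reduceCtorEq, if_false, hn] at h₁
  rw [runs_seq, runs_mov, runs_seq]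
  refine (runs_countLoop m.adj n (by simp [hn₁]) (by simp) (by simpa [Mem.adj] using hA₁)).mono ?_
  rintro t₂ m₂ hE₂ ⟨ht₂, h₂⟩
  have hn₂ : m₂.reg .n = n := by rw [hE₂.reg_eq rfl]; simp [hn₁]
  have hA₂ : m₂.adj = m.adj := by
    rw [Mem.adj, hE₂.cell_eq rfl, hE₂.cell_eq rfl, hE₂.cell_eq rfl, ← hA₁]; rfl
  have hf₂ : m₂.cell .fixed = m₁.cell .fixed := by rw [hE₂.cell_eq rfl]; rfl
  have hi₂ : m₂.cell .inH = m₁.cell .inH := by rw [hE₂.cell_eq rfl]; rfl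
  have ht₂' : m₂.cell .table = m₁.cell .table := by rw [hE₂.cell_eq rfl]; rfl
  simp only [Word.eval, Mem.setReg_reg, if_true, reduceCtorEq, if_false, hn₁, Mem.setReg_cell,
    ← Finset.range_eq_Ico, Finset.sum_add_distrib, Finset.sum_const, Finset.card_range,
    smul_eq_mul] at ht₂ h₂
  rw [runs_seq, runs_mov, runs_mov]
  refine ⟨by omega, by simpa [Mem.adj] using hA₂, by simp [hn₂], by simp [hn₂], by simp [hn₂], ?_⟩
  intro u hu
  obtain ⟨k1, k2, k3, k4⟩ := h₁ u hu
  simp [hf₂, hi₂, ht₂', h₂, k1, k2, k3, k4]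

theorem Heap.empty {n : ℕ} {m : Mem} (hn : m.reg .n = n) (hmin : m.reg .hmin = n)
    (hroots : m.reg .roots = n) (hinH : ∀ u < n, m.cell .inH u = 0)
    (htable : ∀ u < n, m.cell .table u = n) : Heap n ∅ m [] :=
  ⟨⟨hn, hroots, .nil, by simp, by simp⟩,
    ⟨fun _ => [], by constructor <;> simp⟩, .inl ⟨rfl, hmin⟩, by simpa using hinH, htable, by simp⟩

/-- The program up to the outer loop. -/
theorem halts_SP₁ {m : Mem} {n s : ℕ} (hn : m.reg .n = n) (hsrc : m.reg .src = s) (hs : s < n)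
    {Q : ℕ → List Label → Mem → Prop}
    (h : ∀ t₀ m₀, t₀ ≤ 16 * n + 4 * ∑ u ∈ Finset.range n, m.adj.out u + 20 →
      Outer n m.adj m₀ {s} [s] → potential {s} m₀ [s] = 1 → (∀ u < n, m₀.cell .fixed u = 0) →
      Halts (loop (.ne (.reg .hmin) (.reg .n)) outerIteration) m₀
        fun t l m' => Q (t₀ + t) (.heapInsert :: l) m') : Halts SP₁ m Q := by
  refine Runs.seq_halts ((runs_setup hn).mono ?_)
  rintro t₁ m₁ hE₁ ⟨ht₁, hA₁, hn₁, hmin₁, hroots₁, h₁⟩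
  refine Runs.seq_halts (runs_putNum.2 (Runs.seq_halts (runs_mov.2 (Halts.seq (Halts.call ?_)))))
  have hsrc₁ : m₁.reg .src = s := by rw [hE₁.reg_eq rfl, hsrc]
  simp only [Word.eval, Mem.setNum_reg, hsrc₁, Num.eval]
  obtain ⟨m₂, hm₂⟩ : ∃ m₂, (m₁.setNum .D s 0).setReg .v s = m₂ := ⟨_, rfl⟩
  rw [hm₂]
  have hv₂ : m₂.reg .v = s := by simp [← hm₂]
  have hc₂ : m₂.cell = m₁.cell := by simp [← hm₂]
  have hH : Heap n ∅ m₂ [] := Heap.empty (by simp [← hm₂, hn₁]) (by simp [← hm₂, hmin₁])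
    (by simp [← hm₂, hroots₁]) (fun u hu => hc₂ ▸ (h₁ u hu).2.1) (fun u hu => hc₂ ▸ (h₁ u hu).2.2.1)
  refine ((hH.runs_insertNode (by simp) (hv₂ ▸ hs)).mono ?_).halts
  rintro t₃ m₃ hE₃ ⟨ht₃, h₃, hp₃⟩
  rw [hv₂, insert_empty_eq] at h₃ hp₃
  have hf₃ : ∀ u < n, m₃.cell .fixed u = 0 := fun u hu => by
    rw [hE₃.cell_eq rfl, hc₂]; exact (h₁ u hu).1
  refine (h (t₁ + (1 + (1 + (1 + t₃)))) m₃ (by omega) ⟨h₃, ?_, ?_⟩ hp₃ hf₃).mono ?_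
  · rw [← hA₁, Mem.adj, hE₃.cell_eq rfl, hE₃.cell_eq rfl, hE₃.cell_eq rfl, hc₂]; rfl
  · intro k hk _
    have : fixedSet n m₃ = ∅ := by
      rw [fixedSet, Finset.filter_eq_empty_iff]
      simpa using hf₃
    rw [this, Finset.sdiff_empty, hE₃.cell_eq rfl, hc₂]
    exact (h₁ k hk).2.2.2
  · intro t l m' _ hQ
    simpa only [add_assoc, List.cons_append, List.nil_append] using hQ

/-! ### The input graph -/

namespace IsInput

variable {n : ℕ} {G : Digraph (Fin n)} {w : Fin n → Fin n → ℝ} {s : Fin n} {m : Mem}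

theorem valid (h : IsInput G w s m) : m.adj.Valid n := by
  intro u hu p hp
  obtain ⟨v, -, hv⟩ := (h.neighbours ⟨u, hu⟩).mapsTo (Finset.mem_Ico.1 hp)
  exact (show m.adj.tgt p = v from hv) ▸ v.2

theorem mult_ne_zero_iff (h : IsInput G w s m) (u v : Fin n) :
    m.adj.mult u v ≠ 0 ↔ G.Adj u v := by
  rw [AdjLists.mult, AdjLists.count, Finset.card_ne_zero]
  constructor
  · rintro ⟨p, hp⟩
    obtain ⟨h1, h2⟩ := Finset.mem_filter.1 hp
    obtain ⟨v', h3, h4⟩ := (h.neighbours u).mapsTo (Finset.mem_Ico.1 h1)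
    rwa [Fin.ext (h2.symm.trans h4)]
  · intro hv
    obtain ⟨p, h1, h2⟩ := (h.neighbours u).surjOn ⟨v, hv, rfl⟩
    exact ⟨p, Finset.mem_filter.2 ⟨Finset.mem_Ico.2 h1, h2⟩⟩

/-- An edge is determined by its tail and its position. The position ranges of different vertices
are not assumed disjoint, so positions are tagged with the tail. -/
theorem sum_out_le (h : IsInput G w s m) :
    ∑ u ∈ Finset.range n, m.adj.out u ≤ numEdges G := by
  classical
  let f : (u : ℕ) × ℕ → ℕ × ℕ := fun x => (x.1, m.cell .tgt x.2)
  let T : Finset ((u : ℕ) × ℕ) :=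
    (Finset.range n).sigma fun u => Finset.Ico (m.cell .first u) (m.cell .last u)
  let E : Finset (ℕ × ℕ) :=
    (Finset.univ.filter fun p : Fin n × Fin n => G.Adj p.1 p.2).image fun p => (↑p.1, ↑p.2)
  have hT : T.card = ∑ u ∈ Finset.range n, m.adj.out u := by
    simp [T, AdjLists.out, Mem.adj]
  have hE : E.card ≤ numEdges G := by
    refine Finset.card_image_le.trans_eq ?_
    rw [numEdges, Set.ncard_eq_toFinset_card', Set.toFinset_ofPred]
  rw [← hT]
  refine le_trans (Finset.card_le_card_of_injOn f ?_ ?_) hE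
  · rintro ⟨u, p⟩ hp
    obtain ⟨hu, hp⟩ := Finset.mem_sigma.1 hp
    rw [Finset.mem_range] at hu
    obtain ⟨v, h1, h2⟩ := (h.neighbours ⟨u, hu⟩).mapsTo (Finset.mem_Ico.1 hp)
    exact Finset.mem_image.2 ⟨(⟨u, hu⟩, v), by simpa using h1, Prod.ext rfl h2.symm⟩
  · rintro ⟨u, p⟩ hp ⟨u', p'⟩ hp' heq
    obtain ⟨rfl, h2⟩ := Prod.mk.inj heq
    obtain ⟨hu, hp⟩ := Finset.mem_sigma.1 hp
    obtain ⟨-, hp'⟩ := Finset.mem_sigma.1 hp'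
    rw [Finset.mem_range] at hu
    exact congrArg (Sigma.mk u)
      ((h.neighbours ⟨u, hu⟩).injOn (Finset.mem_Ico.1 hp) (Finset.mem_Ico.1 hp') h2)

/-- In an acyclic graph, a set of vertices with a predecessor of each of its elements is empty. -/
theorem not_of_isAcyclic (h : IsInput G w s m) (hG : IsAcyclic G) (U : ℕ → Prop)
    (hU : ∀ k < n, U k → ∃ u < n, U u ∧ m.adj.mult u k ≠ 0) : ∀ k < n, ¬ U k := by
  have : IsTrans (Fin n) (Relation.TransGen G.Adj) := ⟨fun _ _ _ => Relation.TransGen.trans⟩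
  have : Std.Irrefl (Relation.TransGen G.Adj) := ⟨hG⟩
  -- On a finite type the transitive closure is well-founded, and a minimal element of `U` has no
  -- predecessor in `U`.
  have hwf := Finite.wellFounded_of_trans_of_irrefl (Relation.TransGen G.Adj)
  have : ∀ k : Fin n, ¬ U k := fun k => hwf.induction (C := fun k : Fin n => ¬ U k) k
    fun k ih hk => by
      obtain ⟨u, hu, hUu, hm⟩ := hU k k.2 hk
      exact ih ⟨u, hu⟩ (.single ((h.mult_ne_zero_iff ⟨u, hu⟩ k).1 hm)) hUu
  exact fun k hk => this ⟨k, hk⟩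

end IsInput

/-! ### Numerical estimates and the total bounds -/

theorem exists_adj_of_inDegree_ne_zero {n : ℕ} {G : Digraph (Fin n)} {v : Fin n}
    (h : inDegree G v ≠ 0) : ∃ u, G.Adj u v := Set.nonempty_of_ncard_ne_zero h

/-- Choosing an incoming edge for each vertex other than `s` is injective, as the edge determines
its head. -/
theorem le_numEdges_add_one {n : ℕ} {G : Digraph (Fin n)} {s : Fin n}
    (h : ∀ v ≠ s, ∃ u, G.Adj u v) : n ≤ numEdges G + 1 := by
  classical
  choose! f hf using h
  have : (Finset.univ.erase s).card ≤ numEdges G := by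
    rw [numEdges, Set.ncard_eq_toFinset_card', Set.toFinset_ofPred]
    refine Finset.card_le_card_of_injOn (fun v => (f v, v)) ?_ ?_
    · intro v hv
      simpa using hf v (Finset.ne_of_mem_erase hv)
    · exact fun v _ v' _ h => (Prod.mk.inj h).2
  rw [Finset.card_erase_of_mem (Finset.mem_univ s), Finset.card_univ, Fintype.card_fin] at this
  omega

/-- The factor comes from `log 2 > 1 / 2`. -/
theorem natLog_le (n : ℕ) : (Nat.log 2 n : ℝ) ≤ 2 * Real.log n := by
  rcases Nat.eq_zero_or_pos n with rfl | hn
  · simp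
  have h1 : (2 : ℝ) ^ Nat.log 2 n ≤ n := by exact_mod_cast Nat.pow_log_le_self 2 hn.ne'
  have h2 := Real.log_le_log (by positivity) h1
  rw [Real.log_pow] at h2
  have h3 := Real.log_two_gt_d9
  have h4 : (0 : ℝ) ≤ Nat.log 2 n := by positivity
  nlinarith

/-- The summand 1 is for `n = 1`, where the logarithm vanishes. -/
theorem le_mul_log (n : ℕ) : (n : ℝ) ≤ 2 * (n * Real.log n) + 1 := by
  rcases lt_or_ge n 2 with hn | hn
  · interval_cases n <;> simp
  have h1 : Real.log 2 ≤ Real.log n := Real.log_le_log (by norm_num) (by exact_mod_cast hn)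
  have h3 := Real.log_two_gt_d9
  have h4 : (0 : ℝ) ≤ n := by positivity
  nlinarith

/-- The constants: 256 = 16 + 240 and 244 = 4 + 240 from the initialization and the initial work, 61
= 20 + 40 + 1 from the initialization, the initial potential and the last test. -/
theorem IsInput.halts_SP₁ {n : ℕ} {G : Digraph (Fin n)} {w : Fin n → Fin n → ℝ} {s : Fin n}
    {m : Mem} (h : IsInput G w s m) :
    Halts SP₁ m fun t _ _ => t ≤ 256 * n + 244 * numEdges G + n * (330 * (Nat.log 2 n + 1)) + 61 := by
  refine SP.halts_SP₁ h.size h.source s.2 fun t₀ m₀ ht₀ hO hp hf =>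
    (hO.halts_loop h.valid _ le_rfl).mono ?_
  rintro t l m' - ⟨hl, ht⟩
  have halive : alive n {(s : ℕ)} m₀ ≤ n := (Finset.card_filter_le _ _).trans_eq (by simp)
  have hfix : fixedSet n m₀ = ∅ := by
    rw [fixedSet, Finset.filter_eq_empty_iff]
    simpa using hf
  have hw : Exploring.work m.adj n (fixedSet n m₀) = n + ∑ u ∈ Finset.range n, m.adj.out u := by
    rw [hfix, Exploring.work, Finset.sdiff_empty, Finset.sum_add_distrib]
    simp
  have hout := h.sum_out_le
  have hmul := Nat.mul_le_mul_right (330 * (Nat.log 2 n + 1)) (hl.trans halive)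
  omega

theorem IsInput.halts_SP₁_of_isAcyclic {n : ℕ} {G : Digraph (Fin n)} {w : Fin n → Fin n → ℝ}
    {s : Fin n} {m : Mem} (h : IsInput G w s m) (hG : IsAcyclic G)
    (hs : ∀ v ≠ s, ∃ u, G.Adj u v) :
    Halts SP₁ m fun t l _ => l = [.heapInsert, .outerIteration, .heapRemoveMin] ∧
      t ≤ 256 * n + 244 * numEdges G + 330 * (Nat.log 2 n + 1) + 61 := by
  refine SP.halts_SP₁ h.size h.source s.2 fun t₀ m₀ ht₀ hO hp hf =>
    (hO.halts_loop_once h.valid (by simp) (by simp) ?_ (h.not_of_isAcyclic hG)).mono ?_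
  · intro k hk hks hfk
    obtain ⟨u, hu⟩ := hs ⟨k, hk⟩ (by rintro rfl; simp at hks)
    rw [hO.pred k hk hfk]
    refine (Finset.sum_pos' (fun _ _ => Nat.zero_le _) ⟨(u : ℕ), ?_,
      Nat.pos_of_ne_zero ((h.mult_ne_zero_iff u ⟨k, hk⟩).2 hu)⟩).ne'
    simp [fixedSet, hf]
  rintro t l m' - ⟨hl, ht⟩
  have hfix : fixedSet n m₀ = ∅ := by
    rw [fixedSet, Finset.filter_eq_empty_iff]
    simpa using hf
  have hw : Exploring.work m.adj n (fixedSet n m₀) = n + ∑ u ∈ Finset.range n, m.adj.out u := by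
    rw [hfix, Exploring.work, Finset.sdiff_empty, Finset.sum_add_distrib]
    simp
  have hout := h.sum_out_le
  exact ⟨by rw [hl], by omega⟩

end SP

theorem mainTheorem2 :
    ∃ C : ℝ, ∀ (n : ℕ) (G : Digraph (Fin n)) (w : Fin n → Fin n → ℝ) (s : Fin n) (m : SP.Mem),
      (∀ u v : Fin n, G.Adj u v → 0 < w u v) →
      SP.IsInput G w s m →
      ∃ (t : ℕ) (l : List SP.Label) (m' : SP.Mem),
        SP.Exec SP.SP₁ m t l m' ∧
        (t : ℝ) ≤ C * (SP.numEdges G + n * Real.log n + 1) ∧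
        (SP.IsAcyclic G → (∀ v : Fin n, SP.inDegree G v = 0 ↔ v = s) →
          (t : ℝ) ≤ C * (SP.numEdges G + 1) ∧
          l.count .outerIteration = 1 ∧
          l.count .heapInsert = 1 ∧
          l.count .heapRemoveMin = 1 ∧
          l.count .heapInsertOrAdjust = 0) := by
  -- In the general case `586 * n + 660 * n * log n ≤ 1832 * n * log n + 586`, so 2000 leaves room;
  -- the acyclic case needs less.
  refine ⟨2000, fun n G w s m _ hin => ?_⟩
  have hlog : (0 : ℝ) ≤ n * Real.log n := mul_nonneg n.cast_nonneg (Real.log_natCast_nonneg n)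
  -- Both bounds concern one execution. Splitting here avoids an appeal to determinism: in the
  -- acyclic case the linear bound implies the general one.
  by_cases hG : SP.IsAcyclic G ∧ ∀ v : Fin n, SP.inDegree G v = 0 ↔ v = s
  · obtain ⟨hG, hs⟩ := hG
    have hs' : ∀ v ≠ s, ∃ u, G.Adj u v := fun v hv =>
      SP.exists_adj_of_inDegree_ne_zero (mt (hs v).1 hv)
    obtain ⟨t, l, m', hE, rfl, ht⟩ := hin.halts_SP₁_of_isAcyclic hG hs'
    have hn := SP.le_numEdges_add_one hs'
    -- The single logarithm is crudely bounded by `n`, hence by the number of edges plus 1.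
    have hL := Nat.log_le_self 2 n
    have ht' : ((t : ℕ) : ℝ) ≤ (2000 * (SP.numEdges G + 1) : ℕ) :=
      Nat.cast_le.2 (by linarith)
    push_cast at ht'
    exact ⟨t, _, m', hE, by linarith, fun _ _ => ⟨ht', by decide⟩⟩
  · obtain ⟨t, l, m', hE, ht⟩ := hin.halts_SP₁
    refine ⟨t, l, m', hE, ?_, fun h₁ h₂ => absurd ⟨h₁, h₂⟩ hG⟩
    have ht' : (t : ℝ) ≤ 256 * n + 244 * SP.numEdges G + n * (330 * (Nat.log 2 n + 1)) + 61 := by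
      exact_mod_cast ht
    have h₁ := mul_le_mul_of_nonneg_left (SP.natLog_le n) n.cast_nonneg
    have h₂ := SP.le_mul_log n
    have h₃ : (0 : ℝ) ≤ SP.numEdges G := Nat.cast_nonneg _
    nlinarith
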